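/- **Definitions.** For $\eta\in\mathbb{C}$ with $\operatorname{Im}\eta>0$ put $E=\mathbb{C}/(\mathbb{Z}+\mathbb{Z}\eta)$, and let $\theta_\alpha$ ($\alpha\in\mathbb{Z}/4$) be non-constant entire functions with $$\theta_\alpha\left(z+\tfrac14\right)=e^{2\pi i\alpha/4}\,\theta_\alpha(z),\qquad \theta_\alpha\left(z+\tfrac{\eta}{4}\right)=\exp\left(-2\pi i z-\tfrac{\pi i}{4}+\tfrac{3\pi i\eta}{4}\right)\theta_{\alpha+1}(z)\qquad(\alpha\in\mathbb{Z}/4).$$ For $\tau\in\mathbb{C}$ such that $\theta_\alpha(\tau)\neq0$ and $\theta_\alpha(-\tau)\neq 0$ for all $\alpha$ (that is, the class of $\tau$ in $E$ is not a $4$-torsion point), let $Q_4(E,\tau)$ be the quotient of the free algebra $\mathbb{C}\langle x_0,x_1,x_2,x_3\rangle$ by the relations $$\sum_{r\in\mathbb{Z}/4}\frac{1}{\theta_{j-i-r}(-\tau)\,\theta_r(\tau)}\,x_{j-r}x_{i+r}=0\qquad(i,j\in\mathbb{Z}/4,\ i\ne j),$$ graded by $\deg x_i=1$. A graded $\mathbb{C}$-algebra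 is a *four-dimensional Sklyanin algebra* if it is isomorphic, as a graded algebra, to some $Q_4(E,\tau)$. For $p=(a_{10},a_{01},a_{11},b_{10},b_{01},b_{11})\in\mathbb{C}^6$ let $A_p$ be the $\mathbb{C}$-algebra with generators $v_{00},v_{10},v_{01},v_{11}$, all of degree one, and relations $$\begin{aligned} {}[v_{00},v_{10}]&=a_{10}\{v_{01},v_{11}\}, & [v_{01},v_{11}]&=b_{10}\{v_{00},v_{10}\},\\ [v_{00},v_{01}]&=a_{01}\{v_{11},v_{10}\}, & [v_{11},v_{10}]&=b_{01}\{v_{00},v_{01}\},\\ [v_{00},v_{11}]&=a_{11}\{v_{10},v_{01}\}, & [v_{10},v_{01}]&=b_{11}\{v_{00},v_{11}\}, \end{aligned}$$ where $[x,y]=xy-yx$ and $\{x,y\}=xy+yx$. Let $$\mathbf{V}_5=\{p\in\mathbb{C}^6:\ a_{10}b_{10}+a_{01}b_{01}+a_{11}b_{11}+a_{10}b_{10}a_{01}b_{01}a_{11}b_{11}=0\}.$$ **Proposition.** There is a Zariski open and dense subset $U\subseteq\mathbf{V}_5$ such that for every $p\in U$ the graded algebra $A_p$ is a four-dimensional Sklyanin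 algebra, and every four-dimensional Sklyanin algebra is isomorphic, as a graded algebra, to $A_p$ for some $p\in U$. -/

import Mathlib

/-- The quotient of the free algebra `ℂ⟨X⟩` by the two-sided ideal generated by the set `R`. -/
abbrev PresentedAlgebra {X : Type} (R : Set (FreeAlgebra ℂ X)) : Type :=
  RingQuot (fun f g : FreeAlgebra ℂ X => f ∈ R ∧ g = 0)

/-- The class of the generator `x` in the presented algebra. -/
noncomputable def PresentedAlgebra.gen {X : Type} (R : Set (FreeAlgebra ℂ X)) (x : X) :
    PresentedAlgebra R :=
  RingQuot.mkAlgHom ℂ (fun f g : FreeAlgebra ℂ X => f ∈ R ∧ g = 0) (FreeAlgebra.ι ℂ x)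

/-- The degree `d` part of the presented algebra, all generators having degree one:
the linear span of the products of `d` generators. -/
noncomputable def PresentedAlgebra.piece {X : Type} (R : Set (FreeAlgebra ℂ X)) (d : ℕ) :
    Submodule ℂ (PresentedAlgebra R) :=
  (Submodule.span ℂ (Set.range (PresentedAlgebra.gen R))) ^ d

/-- Isomorphism of `ℂ`-algebras that respects the given degree parts. -/
def GradedIso {A B : Type*} [Ring A] [Algebra ℂ A] [Ring B] [Algebra ℂ B]
    (𝒜 : ℕ → Submodule ℂ A) (ℬ : ℕ → Submodule ℂ B) : Prop :=
  ∃ e : A ≃ₐ[ℂ] B, ∀ d : ℕ, (𝒜 d).map e.toLinearMap = ℬ d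

/-- `θ₀, θ₁, θ₂, θ₃` are theta functions of order four for the lattice `ℤ + ℤη`: non-constant
entire functions with the quasi-periodicity below, indices being taken modulo four. -/
structure IsThetaSystem (η : ℂ) (θ : ZMod 4 → ℂ → ℂ) : Prop where
  holomorphic : ∀ α, Differentiable ℂ (θ α)
  nonconstant : ∀ α, ¬ ∃ c : ℂ, ∀ z, θ α z = c
  add_quarter : ∀ α z,
    θ α (z + 1 / 4) = Complex.exp (2 * Real.pi * Complex.I * ((α.val : ℂ) / 4)) * θ α z
  add_quarter_period : ∀ α z,
    θ α (z + η / 4) =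
      Complex.exp (-2 * Real.pi * Complex.I * z - Real.pi * Complex.I / 4
        + 3 * Real.pi * Complex.I * η / 4) * θ (α + 1) z

/-- The relations of `Q₄(E, τ)`, indexed by the pairs `i ≠ j` in `ℤ/4`:
`∑ r, x_{j-r} x_{i+r} / (θ_{j-i-r}(-τ) θ_r(τ))`. -/
def sklyaninRelations (θ : ZMod 4 → ℂ → ℂ) (τ : ℂ) : Set (FreeAlgebra ℂ (ZMod 4)) :=
  {f | ∃ i j : ZMod 4, i ≠ j ∧
    f = ∑ r : ZMod 4, (1 / (θ (j - i - r) (-τ) * θ r τ)) •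
      (FreeAlgebra.ι ℂ (j - r) * FreeAlgebra.ι ℂ (i + r))}

/-- The graded algebra `A = ⨁ 𝒜 d` is a four-dimensional Sklyanin algebra: it is isomorphic, as a
graded algebra, to `Q₄(E, τ)` for some elliptic curve `E = ℂ/(ℤ + ℤη)` and some `τ` for which the
denominators in the relations of `Q₄(E, τ)` do not vanish. -/
def IsFourDimSklyanin {A : Type*} [Ring A] [Algebra ℂ A] (𝒜 : ℕ → Submodule ℂ A) : Prop :=
  ∃ (η : ℂ) (θ : ZMod 4 → ℂ → ℂ) (τ : ℂ), 0 < η.im ∧ IsThetaSystem η θ ∧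
    (∀ α, θ α τ ≠ 0 ∧ θ α (-τ) ≠ 0) ∧
    GradedIso (PresentedAlgebra.piece (sklyaninRelations θ τ)) 𝒜

/-- The generator `v_{ij}` of the free algebra on four generators. -/
def vGen (i j : ZMod 2) : FreeAlgebra ℂ (ZMod 2 × ZMod 2) := FreeAlgebra.ι ℂ (i, j)

/-- The commutator `[x, y]`. -/
def ringCommutator {A : Type*} [Ring A] (x y : A) : A := x * y - y * x

/-- The anticommutator `{x, y}`. -/
def ringAnticommutator {A : Type*} [Ring A] (x y : A) : A := x * y + y * x

/-- The six relations with parameters `p = (a₁₀, a₀₁, a₁₁, b₁₀, b₀₁, b₁₁)`. -/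
def familyRelations (p : Fin 6 → ℂ) : Set (FreeAlgebra ℂ (ZMod 2 × ZMod 2)) :=
  {ringCommutator (vGen 0 0) (vGen 1 0) - p 0 • ringAnticommutator (vGen 0 1) (vGen 1 1),
   ringCommutator (vGen 0 1) (vGen 1 1) - p 3 • ringAnticommutator (vGen 0 0) (vGen 1 0),
   ringCommutator (vGen 0 0) (vGen 0 1) - p 1 • ringAnticommutator (vGen 1 1) (vGen 1 0),
   ringCommutator (vGen 1 1) (vGen 1 0) - p 4 • ringAnticommutator (vGen 0 0) (vGen 0 1),
   ringCommutator (vGen 0 0) (vGen 1 1) - p 2 • ringAnticommutator (vGen 1 0) (vGen 0 1),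
   ringCommutator (vGen 1 0) (vGen 0 1) - p 5 • ringAnticommutator (vGen 0 0) (vGen 1 1)}

/-- The fivefold `a₁₀b₁₀ + a₀₁b₀₁ + a₁₁b₁₁ + a₁₀b₁₀a₀₁b₀₁a₁₁b₁₁ = 0` in `ℂ⁶`, with coordinates
`p = (a₁₀, a₀₁, a₁₁, b₁₀, b₀₁, b₁₁)`. -/
def fivefold : Set (Fin 6 → ℂ) :=
  {p | p 0 * p 3 + p 1 * p 4 + p 2 * p 5 + p 0 * p 3 * p 1 * p 4 * p 2 * p 5 = 0}

/-- `U` is a Zariski open and Zariski dense subset of `V ⊆ ℂⁿ`. -/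
def IsZariskiOpenDense {n : ℕ} (U V : Set (Fin n → ℂ)) : Prop :=
  (∃ S : Set (MvPolynomial (Fin n) ℂ),
    U = {p | p ∈ V ∧ ∃ f ∈ S, MvPolynomial.eval p f ≠ 0}) ∧
  ∀ f : MvPolynomial (Fin n) ℂ,
    (∀ p ∈ U, MvPolynomial.eval p f = 0) → ∀ p ∈ V, MvPolynomial.eval p f = 0

/-! Put α = a₁₀b₁₀, β = a₀₁b₀₁, γ = a₁₁b₁₁. When none of them vanishes, a diagonal rescaling of the
generators shows that A_p depends only on (α, β, γ) (`gradedIso_family_of_products`), a point of the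
surface α + β + γ + αβγ = 0. It remains to see which points of this surface come from pairs (E, τ).
The set U is `nondegenerateLocus`: αβγ ≠ 0, and none of the pairs (α, β), (β, γ), (γ, α) equals (−1,
1).

From Q₄ to the family: the reflection formulas `neg0`, ..., `neg3` express θ_r(−τ) through t_r =
θ_r(τ). In the generators x₀ ± x₂, x₁ ± x₃ the relations become those of A_p with (α, β, γ) = (K²,
−ρ², σ²), where K, ρ, σ are ratios of quadratic forms in t (`satisfiesSklyanin_iff`,
`satisfiesSklyanin_iff_quadricParams`). Since theta functions of order one are unique up to a
scalar, t lies on a curve E_k : t₀² + t₂² = k t₁t₃, t₁² + t₃² = k t₀t₂ (`exists_onQuadrics`), with k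
≠ 0 and k² ≠ ±4. These equations imply the surface equation and exclude the degenerate triples.

Back: `exists_quadric_of_nondegenerate` solves for k and t from a nondegenerate triple. To realize k
by a lattice, evaluate the quadrics at z = 1/8. This gives 2(ℓ² + 1) = k²ℓ for a ratio ℓ of theta
constants, and ℓ takes every value with ℓ ≠ 0 and ℓ⁴ ≠ 1 (`isNomeRatio_of_ne`), by descending along
the arithmetic-geometric mean to small ℓ, where the open mapping theorem applies. Finally every
point of E_k with nonzero coordinates is a theta point (`exists_eq_mul`).

Density: away from the origin some partial derivative of the equation of the fivefold is nonzero, so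
one coordinate can be solved for along a curve of generic points. The origin is a limit of such
points. -/

/-- The six relations with parameters `p` hold for four elements of an algebra. -/
structure SatisfiesFamily {B : Type*} [Ring B] [Algebra ℂ B] (p : Fin 6 → ℂ)
    (v00 v10 v01 v11 : B) : Prop where
  r0 : ringCommutator v00 v10 = p 0 • ringAnticommutator v01 v11
  r3 : ringCommutator v01 v11 = p 3 • ringAnticommutator v00 v10
  r1 : ringCommutator v00 v01 = p 1 • ringAnticommutator v11 v10
  r4 : ringCommutator v11 v10 = p 4 • ringAnticommutator v00 v01
  r2 : ringCommutator v00 v11 = p 2 • ringAnticommutator v10 v01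
  r5 : ringCommutator v10 v01 = p 5 • ringAnticommutator v00 v11

/-! ### Presented graded algebras and isomorphisms given on generators -/

section Presented

variable {X Y : Type} {R : Set (FreeAlgebra ℂ X)} {S : Set (FreeAlgebra ℂ Y)}

theorem PresentedAlgebra.mk_rel {f : FreeAlgebra ℂ X} (hf : f ∈ R) :
    FreeAlgebra.lift ℂ (PresentedAlgebra.gen R) f = 0 := by
  have h : FreeAlgebra.lift ℂ (PresentedAlgebra.gen R) =
      RingQuot.mkAlgHom ℂ (fun f g : FreeAlgebra ℂ X => f ∈ R ∧ g = 0) := by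
    ext x
    simp [PresentedAlgebra.gen]
  rw [h, RingQuot.mkAlgHom_rel ℂ (s := fun f g : FreeAlgebra ℂ X => f ∈ R ∧ g = 0) ⟨hf, rfl⟩,
    map_zero]

/-- The algebra map out of a presented algebra given by elements satisfying the relations. -/
noncomputable def PresentedAlgebra.desc {B : Type*} [Ring B] [Algebra ℂ B] (φ : X → B)
    (h : ∀ f ∈ R, FreeAlgebra.lift ℂ φ f = 0) : PresentedAlgebra R →ₐ[ℂ] B :=
  RingQuot.liftAlgHom ℂ ⟨FreeAlgebra.lift ℂ φ, by
    rintro x y ⟨hx, rfl⟩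
    rw [h x hx, map_zero]⟩

theorem PresentedAlgebra.desc_gen {B : Type*} [Ring B] [Algebra ℂ B] (φ : X → B)
    (h : ∀ f ∈ R, FreeAlgebra.lift ℂ φ f = 0) (x : X) :
    PresentedAlgebra.desc φ h (PresentedAlgebra.gen R x) = φ x := by
  simp [PresentedAlgebra.desc, PresentedAlgebra.gen]

theorem PresentedAlgebra.hom_ext {B : Type*} [Ring B] [Algebra ℂ B]
    {f g : PresentedAlgebra R →ₐ[ℂ] B}
    (h : ∀ x, f (PresentedAlgebra.gen R x) = g (PresentedAlgebra.gen R x)) : f = g := by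
  apply RingQuot.ringQuot_ext'
  ext x
  exact h x

/-- A linear change of generators exchanging the relations is a graded isomorphism. -/
theorem gradedIso_of_gens (φ : X → PresentedAlgebra S) (ψ : Y → PresentedAlgebra R)
    (hφ : ∀ f ∈ R, FreeAlgebra.lift ℂ φ f = 0) (hψ : ∀ f ∈ S, FreeAlgebra.lift ℂ ψ f = 0)
    (hφs : ∀ x, φ x ∈ Submodule.span ℂ (Set.range (PresentedAlgebra.gen S)))
    (hψs : ∀ y, ψ y ∈ Submodule.span ℂ (Set.range (PresentedAlgebra.gen R)))
    (hφψ : ∀ y, PresentedAlgebra.desc φ hφ (ψ y) = PresentedAlgebra.gen S y)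
    (hψφ : ∀ x, PresentedAlgebra.desc ψ hψ (φ x) = PresentedAlgebra.gen R x) :
    GradedIso (PresentedAlgebra.piece R) (PresentedAlgebra.piece S) := by
  let e : PresentedAlgebra R ≃ₐ[ℂ] PresentedAlgebra S :=
    AlgEquiv.ofAlgHom (PresentedAlgebra.desc φ hφ) (PresentedAlgebra.desc ψ hψ)
      (PresentedAlgebra.hom_ext fun y => by
        simp [PresentedAlgebra.desc_gen, hφψ])
      (PresentedAlgebra.hom_ext fun x => by
        simp [PresentedAlgebra.desc_gen, hψφ])
  refine ⟨e, fun d => ?_⟩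
  have h1 : (Submodule.span ℂ (Set.range (PresentedAlgebra.gen R))).map
      (PresentedAlgebra.desc φ hφ).toLinearMap =
      Submodule.span ℂ (Set.range (PresentedAlgebra.gen S)) := by
    apply le_antisymm
    · rw [Submodule.map_span, Submodule.span_le]
      rintro _ ⟨_, ⟨x, rfl⟩, rfl⟩
      simpa [PresentedAlgebra.desc_gen] using hφs x
    · rw [Submodule.span_le]
      rintro _ ⟨y, rfl⟩
      exact ⟨ψ y, hψs y, hφψ y⟩
  have h2 : e.toLinearMap = (PresentedAlgebra.desc φ hφ).toLinearMap := rfl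
  rw [PresentedAlgebra.piece, PresentedAlgebra.piece, h2, Submodule.map_pow, h1]

end Presented

theorem GradedIso.symm {A B : Type*} [Ring A] [Algebra ℂ A] [Ring B] [Algebra ℂ B]
    {𝒜 : ℕ → Submodule ℂ A} {ℬ : ℕ → Submodule ℂ B} (h : GradedIso 𝒜 ℬ) : GradedIso ℬ 𝒜 := by
  obtain ⟨e, he⟩ := h
  refine ⟨e.symm, fun d => ?_⟩
  rw [← he d]
  ext x
  simp

theorem GradedIso.trans {A B C : Type*} [Ring A] [Algebra ℂ A] [Ring B] [Algebra ℂ B]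
    [Ring C] [Algebra ℂ C] {𝒜 : ℕ → Submodule ℂ A} {ℬ : ℕ → Submodule ℂ B}
    {𝒞 : ℕ → Submodule ℂ C} (h : GradedIso 𝒜 ℬ) (h' : GradedIso ℬ 𝒞) : GradedIso 𝒜 𝒞 := by
  obtain ⟨e, he⟩ := h
  obtain ⟨e', he'⟩ := h'
  refine ⟨e.trans e', fun d => ?_⟩
  rw [← he' d, ← he d]
  ext x
  simp

theorem satisfiesFamily_iff {B : Type*} [Ring B] [Algebra ℂ B] (p : Fin 6 → ℂ)
    (v : ZMod 2 × ZMod 2 → B) :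
    (∀ f ∈ familyRelations p, FreeAlgebra.lift ℂ v f = 0) ↔
      SatisfiesFamily p (v (0, 0)) (v (1, 0)) (v (0, 1)) (v (1, 1)) := by
  simp only [familyRelations, Set.mem_insert_iff, Set.mem_singleton_iff, forall_eq_or_imp,
    forall_eq, ringCommutator, ringAnticommutator, vGen, map_sub, map_mul, map_add, map_smul,
    FreeAlgebra.lift_ι_apply, sub_eq_zero]
  constructor
  · rintro ⟨h0, h3, h1, h4, h2, h5⟩
    exact ⟨h0, h3, h1, h4, h2, h5⟩
  · rintro ⟨h0, h3, h1, h4, h2, h5⟩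
    exact ⟨h0, h3, h1, h4, h2, h5⟩

/-! ### The relations of Q₄ in theta values, and the change of generators -/

/-- The relations of `Q₄(E, τ)` after clearing denominators, `t r` standing for `θ r τ`. -/
structure SatisfiesSklyanin {B : Type*} [Ring B] [Algebra ℂ B] (t : ZMod 4 → ℂ)
    (x : ZMod 4 → B) : Prop where
  r02 : (t 1 * t 3) • (x 2 * x 0 - x 0 * x 2) +
    (Complex.I * (t 0 * t 2)) • (x 1 * x 1 - x 3 * x 3) = 0
  r13 : (t 1 * t 3) • (x 3 * x 1 - x 1 * x 3) +
    (Complex.I * (t 0 * t 2)) • (x 2 * x 2 - x 0 * x 0) = 0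
  r01 : (t 1 * t 2) • (x 1 * x 0) + (Complex.I * (t 2 * t 3)) • (x 0 * x 1) -
    (t 0 * t 3) • (x 3 * x 2) - (Complex.I * (t 0 * t 1)) • (x 2 * x 3) = 0
  r23 : (t 1 * t 2) • (x 3 * x 2) + (Complex.I * (t 2 * t 3)) • (x 2 * x 3) -
    (t 0 * t 3) • (x 1 * x 0) - (Complex.I * (t 0 * t 1)) • (x 0 * x 1) = 0
  r12 : (t 1 * t 2) • (x 2 * x 1) + (Complex.I * (t 2 * t 3)) • (x 1 * x 2) -
    (t 0 * t 3) • (x 0 * x 3) - (Complex.I * (t 0 * t 1)) • (x 3 * x 0) = 0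
  r30 : (t 1 * t 2) • (x 0 * x 3) + (Complex.I * (t 2 * t 3)) • (x 3 * x 0) -
    (t 0 * t 3) • (x 2 * x 1) - (Complex.I * (t 0 * t 1)) • (x 1 * x 2) = 0

theorem sum_zmod_four {M : Type*} [AddCommMonoid M] (f : ZMod 4 → M) :
    ∑ r : ZMod 4, f r = f 0 + f 1 + f 2 + f 3 :=
  Fin.sum_univ_four f

theorem forall_zmod_four {P : ZMod 4 → Prop} : (∀ r, P r) ↔ P 0 ∧ P 1 ∧ P 2 ∧ P 3 := by
  refine ⟨fun h => ⟨h 0, h 1, h 2, h 3⟩, fun ⟨h0, h1, h2, h3⟩ r => ?_⟩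
  fin_cases r
  exacts [h0, h1, h2, h3]

/-- The factor ε is common to all four values at −τ, so clearing denominators leaves products of two
values at τ. The twelve ordered pairs i ≠ j yield only six relations up to scalars, since (i, j) and
(j, i) involve the same monomials. -/
theorem satisfiesSklyanin_iff {B : Type*} [Ring B] [Algebra ℂ B] (θ : ZMod 4 → ℂ → ℂ) (τ ε : ℂ)
    (hε : ε ≠ 0) (ht : ∀ r, θ r τ ≠ 0) (h0 : θ 0 (-τ) = ε * θ 0 τ)
    (h1 : θ 1 (-τ) = ε * Complex.I * θ 3 τ) (h2 : θ 2 (-τ) = -ε * θ 2 τ)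
    (h3 : θ 3 (-τ) = -ε * Complex.I * θ 1 τ) (x : ZMod 4 → B) :
    (∀ f ∈ sklyaninRelations θ τ, FreeAlgebra.lift ℂ x f = 0) ↔
      SatisfiesSklyanin (fun r => θ r τ) x := by
  obtain ⟨ht0, ht1, ht2, ht3⟩ := forall_zmod_four.1 ht
  have e1 : (0 : ZMod 4) - 1 = 3 := rfl
  have e2 : (0 : ZMod 4) - 2 = 2 := rfl
  have e3 : (0 : ZMod 4) - 3 = 1 := rfl
  have e4 : (1 : ZMod 4) - 2 = 3 := rfl
  have e5 : (1 : ZMod 4) - 3 = 2 := rfl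
  have e6 : (2 : ZMod 4) - 3 = 3 := rfl
  have e7 : (2 : ZMod 4) - 1 = 1 := rfl
  have e8 : (3 : ZMod 4) - 1 = 2 := rfl
  have e9 : (3 : ZMod 4) - 2 = 1 := rfl
  have f1 : (1 : ZMod 4) + 1 = 2 := rfl
  have f2 : (1 : ZMod 4) + 2 = 3 := rfl
  have f3 : (1 : ZMod 4) + 3 = 0 := rfl
  have f4 : (2 : ZMod 4) + 2 = 0 := rfl
  have f5 : (2 : ZMod 4) + 3 = 1 := rfl
  have f6 : (3 : ZMod 4) + 3 = 2 := rfl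
  have f7 : (2 : ZMod 4) + 1 = 3 := rfl
  have f8 : (3 : ZMod 4) + 1 = 0 := rfl
  have f9 : (3 : ZMod 4) + 2 = 1 := rfl
  have expand : ∀ i j : ZMod 4, FreeAlgebra.lift ℂ x (∑ r : ZMod 4,
      (1 / (θ (j - i - r) (-τ) * θ r τ)) •
        (FreeAlgebra.ι ℂ (j - r) * FreeAlgebra.ι ℂ (i + r))) =
      (1 / (θ (j - i - 0) (-τ) * θ 0 τ)) • (x (j - 0) * x (i + 0)) +
      (1 / (θ (j - i - 1) (-τ) * θ 1 τ)) • (x (j - 1) * x (i + 1)) +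
      (1 / (θ (j - i - 2) (-τ) * θ 2 τ)) • (x (j - 2) * x (i + 2)) +
      (1 / (θ (j - i - 3) (-τ) * θ 3 τ)) • (x (j - 3) * x (i + 3)) := by
    intro i j
    simp [sum_zmod_four]
  set t0 := θ 0 τ
  set t1 := θ 1 τ
  set t2 := θ 2 τ
  set t3 := θ 3 τ
  -- D and J are the scalars, up to sign, by which the original relations differ from the cleared
  -- ones.
  obtain ⟨D, hD⟩ : ∃ D, D = 1 / (ε * t0 * t1 * t2 * t3) := ⟨_, rfl⟩
  have hD0 : D ≠ 0 := by
    rw [hD]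
    simp [*]
  obtain ⟨J, hJ⟩ : ∃ J, J = D * Complex.I := ⟨_, rfl⟩
  have hI := Complex.I_ne_zero
  have hII : Complex.I ^ 2 = -1 := Complex.I_sq
  have hJ0 : J ≠ 0 := by simp [*]
  have c1 : 1 / (-ε * t2 * t0) = -(D * (t1 * t3)) := by rw [hD]; field_simp
  have c2 : 1 / (ε * Complex.I * t3 * t1) = -(D * (Complex.I * (t0 * t2))) := by
    rw [hD]; field_simp; simp [hII]
  have c3 : 1 / (ε * t0 * t2) = D * (t1 * t3) := by rw [hD]; field_simp
  have c4 : 1 / (-ε * Complex.I * t1 * t3) = D * (Complex.I * (t0 * t2)) := by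
    rw [hD]; field_simp; simp [hII]
  have c5 : 1 / (ε * Complex.I * t3 * t0) = -(J * (t1 * t2)) := by
    rw [hJ, hD]; field_simp; simp [hII]
  have c6 : 1 / (ε * t0 * t1) = -(J * (Complex.I * (t2 * t3))) := by
    rw [hJ, hD]; field_simp; simp [hII]
  have c7 : 1 / (-ε * Complex.I * t1 * t2) = J * (t0 * t3) := by
    rw [hJ, hD]; field_simp; simp [hII]
  have c8 : 1 / (-ε * t2 * t3) = J * (Complex.I * (t0 * t1)) := by
    rw [hJ, hD]; field_simp; simp [hII]
  have c9 : 1 / (-ε * Complex.I * t1 * t0) = D * (Complex.I * (t2 * t3)) := by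
    rw [hD]; field_simp; simp [hII]
  have c10 : 1 / (-ε * t2 * t1) = -(D * (t0 * t3)) := by rw [hD]; field_simp
  have c11 : 1 / (ε * Complex.I * t3 * t2) = -(D * (Complex.I * (t0 * t1))) := by
    rw [hD]; field_simp; simp [hII]
  have c12 : 1 / (ε * t0 * t3) = D * (t1 * t2) := by rw [hD]; field_simp
  have cancel : ∀ {c : ℂ} {b : B}, c ≠ 0 → c • b = 0 → b = 0 := fun hc hb =>
    (smul_eq_zero.1 hb).resolve_left hc
  constructor
  · intro h
    have h' := fun i j hij => (expand i j).symm.trans (h _ ⟨i, j, hij, rfl⟩)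
    have a02 := h' 0 2 (by decide)
    have a13 := h' 1 3 (by decide)
    have a01 := h' 0 1 (by decide)
    have a23 := h' 2 3 (by decide)
    have a12 := h' 1 2 (by decide)
    have a30 := h' 3 0 (by decide)
    simp only [e1, e2, e3, e4, e5, e6, e7, e8, e9, f1, f2, f3, f4, f5, f6, f7, f8, f9,
      sub_zero, add_zero, zero_add, sub_self, h0, h1, h2, h3, c1, c2, c3, c4, c5, c6, c7, c8]
      at a02 a13 a01 a23 a12 a30
    constructor
    · refine cancel hD0 ?_
      linear_combination (norm := module) (-1 : ℂ) • a02
    · refine cancel hD0 ?_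
      linear_combination (norm := module) (-1 : ℂ) • a13
    · refine cancel hJ0 ?_
      linear_combination (norm := module) (-1 : ℂ) • a01
    · refine cancel hJ0 ?_
      linear_combination (norm := module) (-1 : ℂ) • a23
    · refine cancel hJ0 ?_
      linear_combination (norm := module) (-1 : ℂ) • a12
    · refine cancel hJ0 ?_
      linear_combination (norm := module) (-1 : ℂ) • a30
  · rintro ⟨r02, r13, r01, r23, r12, r30⟩ f ⟨i, j, hij, rfl⟩
    rw [expand]
    revert i j
    simp only [forall_zmod_four]
    refine ⟨⟨?_, ?_, ?_, ?_⟩, ⟨?_, ?_, ?_, ?_⟩, ⟨?_, ?_, ?_, ?_⟩, ⟨?_, ?_, ?_, ?_⟩⟩ <;> intro hij <;>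
    first
    | exact absurd rfl hij
    | simp only [e1, e2, e3, e4, e5, e6, e7, e8, e9, f1, f2, f3, f4, f5, f6, f7,
        f8, f9, sub_zero, add_zero, zero_add, sub_self, h0, h1, h2, h3, c1, c2, c3, c4, c5, c6,
        c7, c8, c9, c10, c11, c12]
      first
      | linear_combination (norm := module) (-D) • r02
      | linear_combination (norm := module) (-D) • r13
      | linear_combination (norm := module) D • r02
      | linear_combination (norm := module) D • r13
      | linear_combination (norm := module) (-J) • r01
      | linear_combination (norm := module) (-J) • r12
      | linear_combination (norm := module) (-J) • r23
      | linear_combination (norm := module) (-J) • r30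
      | linear_combination (norm := module) D • r01
      | linear_combination (norm := module) D • r12
      | linear_combination (norm := module) D • r23
      | linear_combination (norm := module) D • r30

/-- The change of variables `y₀ = x₀ + x₂`, `y₂ = x₀ - x₂`, `y₁ = x₁ + x₃`, `y₃ = x₁ - x₃` carries
the relations of `Q₄(E, τ)` to the six relations of the family. -/
theorem satisfiesSklyanin_iff_family {B : Type*} [Ring B] [Algebra ℂ B] {t : ZMod 4 → ℂ}
    {K ρ σ w w' : ℂ} (hm : t 1 * t 3 ≠ 0) (hw : w ≠ 0) (hw' : w' ≠ 0)
    (h02 : t 0 * t 2 = K * (t 1 * t 3))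
    (h12 : t 1 * t 2 = ((ρ + 1) * w + (σ + 1) * w') / 4)
    (h03 : t 0 * t 3 = ((σ + 1) * w' - (ρ + 1) * w) / 4)
    (h23 : Complex.I * (t 2 * t 3) = ((ρ - 1) * w + (σ - 1) * w') / 4)
    (h01 : Complex.I * (t 0 * t 1) = ((σ - 1) * w' - (ρ - 1) * w) / 4) (x : ZMod 4 → B) :
    SatisfiesSklyanin t x ↔
      SatisfiesFamily ![-Complex.I * K, ρ, σ, Complex.I * K, -ρ, σ]
        (x 0 + x 2) (x 0 - x 2) (x 1 + x 3) (x 1 - x 3) := by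
  have cancel : ∀ {c : ℂ} {a b : B}, c ≠ 0 → c • (a - b) = 0 → a = b := fun hc hb =>
    sub_eq_zero.1 ((smul_eq_zero.1 hb).resolve_left hc)
  constructor
  · rintro ⟨r02, r13, r01, r23, r12, r30⟩
    rw [h02] at r02 r13
    rw [h12, h03, h23, h01] at r01 r23 r12 r30
    constructor <;> simp only [ringCommutator, ringAnticommutator] <;> simp
    · refine cancel hm ?_
      simp only [add_mul, mul_add, sub_mul, mul_sub]
      linear_combination (norm := module) (2 : ℂ) • r02
    · refine cancel hm ?_
      simp only [add_mul, mul_add, sub_mul, mul_sub]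
      linear_combination (norm := module) (2 : ℂ) • r13
    -- Signed sums of the four mixed relations separate the terms carrying w from those carrying w'.
    · refine cancel hw ?_
      simp only [add_mul, mul_add, sub_mul, mul_sub] at *
      linear_combination (norm := module) (2 : ℂ) • r12 + (2 : ℂ) • r30 - (2 : ℂ) • r01 -
        (2 : ℂ) • r23
    · refine cancel hw ?_
      simp only [add_mul, mul_add, sub_mul, mul_sub] at *
      linear_combination (norm := module) (2 : ℂ) • r12 + (2 : ℂ) • r30 + (2 : ℂ) • r01 +
        (2 : ℂ) • r23
    · refine cancel hw' ?_
      simp only [add_mul, mul_add, sub_mul, mul_sub] at *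
      linear_combination (norm := module) (2 : ℂ) • r12 - (2 : ℂ) • r30 - (2 : ℂ) • r01 +
        (2 : ℂ) • r23
    · refine cancel hw' ?_
      simp only [add_mul, mul_add, sub_mul, mul_sub] at *
      linear_combination (norm := module) (-2 : ℂ) • r12 + (2 : ℂ) • r30 - (2 : ℂ) • r01 +
        (2 : ℂ) • r23
  · rintro ⟨R0, R3, R1, R4, R2, R5⟩
    simp [ringCommutator, ringAnticommutator] at R0 R3 R1 R4 R2 R5
    simp only [add_mul, mul_add, sub_mul, mul_sub] at R0 R3 R1 R4 R2 R5
    constructor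
    · rw [h02]
      linear_combination (norm := module) (t 1 * t 3 / 2) • R0
    · rw [h02]
      linear_combination (norm := module) (t 1 * t 3 / 2) • R3
    · rw [h12, h03, h23, h01]
      linear_combination (norm := module) (w / 8) • R4 - (w / 8) • R1 - (w' / 8) • R2 -
        (w' / 8) • R5
    · rw [h12, h03, h23, h01]
      linear_combination (norm := module) (w / 8) • R4 - (w / 8) • R1 + (w' / 8) • R2 +
        (w' / 8) • R5
    · rw [h12, h03, h23, h01]
      linear_combination (norm := module) (w / 8) • R4 + (w / 8) • R1 + (w' / 8) • R2 -
        (w' / 8) • R5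
    · rw [h12, h03, h23, h01]
      linear_combination (norm := module) (w / 8) • R4 + (w / 8) • R1 - (w' / 8) • R2 +
        (w' / 8) • R5

theorem PresentedAlgebra.gen_mem_span {X : Type} (R : Set (FreeAlgebra ℂ X)) (x : X) :
    PresentedAlgebra.gen R x ∈ Submodule.span ℂ (Set.range (PresentedAlgebra.gen R)) :=
  Submodule.subset_span ⟨x, rfl⟩

theorem satisfiesFamily_gen (p : Fin 6 → ℂ) :
    SatisfiesFamily p (PresentedAlgebra.gen (familyRelations p) (0, 0))
      (PresentedAlgebra.gen (familyRelations p) (1, 0))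
      (PresentedAlgebra.gen (familyRelations p) (0, 1))
      (PresentedAlgebra.gen (familyRelations p) (1, 1)) :=
  (satisfiesFamily_iff p _).1 fun _ hf => PresentedAlgebra.mk_rel hf

theorem forall_zmod_two_prod {P : ZMod 2 × ZMod 2 → Prop} :
    (∀ r, P r) ↔ P (0, 0) ∧ P (1, 0) ∧ P (0, 1) ∧ P (1, 1) := by
  refine ⟨fun h => ⟨h _, h _, h _, h _⟩, fun ⟨h0, h1, h2, h3⟩ ⟨r, s⟩ => ?_⟩
  fin_cases r <;> fin_cases s
  exacts [h0, h2, h1, h3]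

/-- The function on `(ℤ/2)²` with the given values. -/
def pairFun {B : Type*} (a b c d : B) (i : ZMod 2 × ZMod 2) : B :=
  if i.2 = 0 then if i.1 = 0 then a else b else if i.1 = 0 then c else d

section pairFun

variable {B : Type*} (a b c d : B)

@[simp] theorem pairFun_zero_zero : pairFun a b c d (0, 0) = a := by simp [pairFun]
@[simp] theorem pairFun_one_zero : pairFun a b c d (1, 0) = b := by simp [pairFun]
@[simp] theorem pairFun_zero_one : pairFun a b c d (0, 1) = c := by simp [pairFun]
@[simp] theorem pairFun_one_one : pairFun a b c d (1, 1) = d := by simp [pairFun]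

end pairFun

/-- Because the equivalence holds for all quadruples in all algebras, the universal properties
supply both maps; the inverse change of generators takes halved sums and differences. -/
theorem gradedIso_sklyanin_family {θ : ZMod 4 → ℂ → ℂ} {τ : ℂ} {p : Fin 6 → ℂ}
    (h : ∀ {B : Type} [Ring B] [Algebra ℂ B] (x : ZMod 4 → B),
      (∀ f ∈ sklyaninRelations θ τ, FreeAlgebra.lift ℂ x f = 0) ↔
      SatisfiesFamily p (x 0 + x 2) (x 0 - x 2) (x 1 + x 3) (x 1 - x 3)) :
    GradedIso (PresentedAlgebra.piece (sklyaninRelations θ τ))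
      (PresentedAlgebra.piece (familyRelations p)) := by
  set x := PresentedAlgebra.gen (sklyaninRelations θ τ) with hx
  set v := PresentedAlgebra.gen (familyRelations p) with hv
  have hxs := PresentedAlgebra.gen_mem_span (sklyaninRelations θ τ)
  have hvs := PresentedAlgebra.gen_mem_span (familyRelations p)
  rw [← hx] at hxs
  rw [← hv] at hvs
  let φ : ZMod 4 → PresentedAlgebra (familyRelations p) :=
    (![(1 / 2 : ℂ) • (v (0, 0) + v (1, 0)), (1 / 2 : ℂ) • (v (0, 1) + v (1, 1)),
      (1 / 2 : ℂ) • (v (0, 0) - v (1, 0)), (1 / 2 : ℂ) • (v (0, 1) - v (1, 1))] : Fin 4 → _)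
  have φ0 : φ 0 = (1 / 2 : ℂ) • (v (0, 0) + v (1, 0)) := rfl
  have φ1 : φ 1 = (1 / 2 : ℂ) • (v (0, 1) + v (1, 1)) := rfl
  have φ2 : φ 2 = (1 / 2 : ℂ) • (v (0, 0) - v (1, 0)) := rfl
  have φ3 : φ 3 = (1 / 2 : ℂ) • (v (0, 1) - v (1, 1)) := rfl
  let ψ := pairFun (x 0 + x 2) (x 0 - x 2) (x 1 + x 3) (x 1 - x 3)
  refine gradedIso_of_gens φ ψ ?_ ?_ ?_ ?_ ?_ ?_
  · rw [h]
    have hg := satisfiesFamily_gen p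
    rw [← hv] at hg
    convert hg using 1
    · rw [φ0, φ2]; module
    · rw [φ0, φ2]; module
    · rw [φ1, φ3]; module
    · rw [φ1, φ3]; module
  · rw [satisfiesFamily_iff]
    simp only [ψ, pairFun_zero_zero, pairFun_one_zero, pairFun_zero_one, pairFun_one_one]
    exact (h x).1 fun _ hf => PresentedAlgebra.mk_rel hf
  · rw [forall_zmod_four, φ0, φ1, φ2, φ3]
    exact ⟨Submodule.smul_mem _ _ (add_mem (hvs _) (hvs _)),
      Submodule.smul_mem _ _ (add_mem (hvs _) (hvs _)),
      Submodule.smul_mem _ _ (sub_mem (hvs _) (hvs _)),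
      Submodule.smul_mem _ _ (sub_mem (hvs _) (hvs _))⟩
  · rw [forall_zmod_two_prod]
    simp only [ψ, pairFun_zero_zero, pairFun_one_zero, pairFun_zero_one, pairFun_one_one]
    exact ⟨add_mem (hxs _) (hxs _), sub_mem (hxs _) (hxs _), add_mem (hxs _) (hxs _),
      sub_mem (hxs _) (hxs _)⟩
  · rw [forall_zmod_two_prod]
    simp only [ψ, pairFun_zero_zero, pairFun_one_zero, pairFun_zero_one, pairFun_one_one, map_add,
      map_sub, hx, PresentedAlgebra.desc_gen, φ0, φ1, φ2, φ3]
    refine ⟨?_, ?_, ?_, ?_⟩ <;> module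
  · rw [forall_zmod_four]
    simp only [φ0, φ1, φ2, φ3, map_add, map_sub, map_smul, hv, PresentedAlgebra.desc_gen, ψ,
      pairFun_zero_zero, pairFun_one_zero, pairFun_zero_one, pairFun_one_one]
    refine ⟨?_, ?_, ?_, ?_⟩ <;> module

/-! ### Diagonal rescaling of the generators of A_p -/

theorem ringCommutator_smul_smul {B : Type*} [Ring B] [Algebra ℂ B] (a b : ℂ) (x y : B) :
    ringCommutator (a • x) (b • y) = (a * b) • ringCommutator x y := by
  simp only [ringCommutator, smul_mul_smul_comm, smul_sub, mul_comm b a]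

theorem ringAnticommutator_smul_smul {B : Type*} [Ring B] [Algebra ℂ B] (a b : ℂ) (x y : B) :
    ringAnticommutator (a • x) (b • y) = (a * b) • ringAnticommutator x y := by
  simp only [ringAnticommutator, smul_mul_smul_comm, smul_add, mul_comm b a]

theorem SatisfiesFamily.rescale {B : Type*} [Ring B] [Algebra ℂ B] {p q : Fin 6 → ℂ}
    {v00 v10 v01 v11 : B} (h : SatisfiesFamily q v00 v10 v01 v11) {a b c : ℂ}
    (h0 : q 0 * a = p 0 * (b * c)) (h1 : q 1 * b = p 1 * (c * a)) (h2 : q 2 * c = p 2 * (a * b))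
    (h3 : q 3 * (b * c) = p 3 * a) (h4 : q 4 * (c * a) = p 4 * b)
    (h5 : q 5 * (a * b) = p 5 * c) :
    SatisfiesFamily p v00 (a • v10) (b • v01) (c • v11) := by
  have aux : ∀ {d e d' e' s s' : ℂ} {x y z w : B}, ringCommutator x y = s • ringAnticommutator z w →
      s * (d * e) = s' * (d' * e') →
      ringCommutator (d • x) (e • y) = s' • ringAnticommutator (d' • z) (e' • w) := by
    intro d e d' e' s s' x y z w hxy hs
    rw [ringCommutator_smul_smul, ringAnticommutator_smul_smul, hxy, smul_smul, smul_smul, ← hs,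
      mul_comm]
  obtain ⟨r0, r3, r1, r4, r2, r5⟩ := h
  constructor
  · simpa using aux (d := 1) (e := a) (d' := b) (e' := c) r0 (by simpa using h0)
  · simpa using aux (d := b) (e := c) (d' := 1) (e' := a) r3 (by simpa using h3)
  · simpa using aux (d := 1) (e := b) (d' := c) (e' := a) r1 (by simpa using h1)
  · simpa using aux (d := c) (e := a) (d' := 1) (e' := b) r4 (by simpa using h4)
  · simpa using aux (d := 1) (e := c) (d' := a) (e' := b) r2 (by simpa using h2)
  · simpa using aux (d := a) (e := b) (d' := 1) (e' := c) r5 (by simpa using h5)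

/-- The algebra `A_p` depends only on the three products, when these do not vanish. -/
theorem gradedIso_family_of_products {p q : Fin 6 → ℂ} (h0 : p 0 * p 3 = q 0 * q 3)
    (h1 : p 1 * p 4 = q 1 * q 4) (h2 : p 2 * p 5 = q 2 * q 5) (n0 : p 0 * p 3 ≠ 0)
    (n1 : p 1 * p 4 ≠ 0) (n2 : p 2 * p 5 ≠ 0) :
    GradedIso (PresentedAlgebra.piece (familyRelations p))
      (PresentedAlgebra.piece (familyRelations q)) := by
  have m0 := h0 ▸ n0
  have m1 := h1 ▸ n1
  have m2 := h2 ▸ n2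
  simp only [ne_eq, mul_eq_zero, not_or] at n0 n1 n2 m0 m1 m2
  obtain ⟨p0, p3⟩ := n0
  obtain ⟨p1, p4⟩ := n1
  obtain ⟨p2, p5⟩ := n2
  obtain ⟨q0, q3⟩ := m0
  obtain ⟨q1, q4⟩ := m1
  obtain ⟨q2, q5⟩ := m2
  -- Solving the three conditions on the a-parameters for a, b, c gives these squares. Then c is
  -- read off from one condition instead of being a third square root, which keeps the signs
  -- coherent.
  obtain ⟨a, ha⟩ := IsAlgClosed.exists_pow_nat_eq (q 1 / p 1 * (q 2 / p 2)) zero_lt_two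
  obtain ⟨b, hb⟩ := IsAlgClosed.exists_pow_nat_eq (q 0 / p 0 * (q 2 / p 2)) zero_lt_two
  have a0 : a ≠ 0 := by rintro rfl; simp [*] at ha
  have b0 : b ≠ 0 := by rintro rfl; simp [*] at hb
  obtain ⟨c, hc⟩ : ∃ c, c = a * b * p 2 / q 2 := ⟨_, rfl⟩
  have c0 : c ≠ 0 := by simp [*]
  have k2 : q 2 * c = p 2 * (a * b) := by rw [hc]; field_simp
  have k0 : q 0 * a = p 0 * (b * c) := by
    rw [hc, show p 0 * (b * (a * b * p 2 / q 2)) = p 0 * a * p 2 / q 2 * b ^ 2 by ring, hb]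
    field_simp
  have k1 : q 1 * b = p 1 * (c * a) := by
    rw [hc, show p 1 * (a * b * p 2 / q 2 * a) = p 1 * b * p 2 / q 2 * a ^ 2 by ring, ha]
    field_simp
  -- The conditions on the b-parameters follow from those on the a-parameters because the products
  -- agree.
  have k3 : q 3 * (b * c) = p 3 * a := by
    refine mul_left_cancel₀ p0 ?_
    linear_combination a * (-h0) - q 3 * k0
  have k4 : q 4 * (c * a) = p 4 * b := by
    refine mul_left_cancel₀ p1 ?_
    linear_combination b * (-h1) - q 4 * k1
  have k5 : q 5 * (a * b) = p 5 * c := by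
    refine mul_left_cancel₀ p2 ?_
    linear_combination c * (-h2) - q 5 * k2
  set v := PresentedAlgebra.gen (familyRelations p) with hv
  set w := PresentedAlgebra.gen (familyRelations q) with hw
  refine gradedIso_of_gens (pairFun (w (0, 0)) (a • w (1, 0)) (b • w (0, 1)) (c • w (1, 1)))
    (pairFun (v (0, 0)) (a⁻¹ • v (1, 0)) (b⁻¹ • v (0, 1)) (c⁻¹ • v (1, 1))) ?_ ?_ ?_ ?_ ?_ ?_
  · rw [satisfiesFamily_iff]
    simpa using (satisfiesFamily_gen q).rescale k0 k1 k2 k3 k4 k5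
  · rw [satisfiesFamily_iff]
    simp only [pairFun_zero_zero, pairFun_one_zero, pairFun_zero_one, pairFun_one_one]
    refine (satisfiesFamily_gen p).rescale ?_ ?_ ?_ ?_ ?_ ?_
    · field_simp; linear_combination -k0
    · field_simp; linear_combination -k1
    · field_simp; linear_combination -k2
    · field_simp; linear_combination -k3
    · field_simp; linear_combination -k4
    · field_simp; linear_combination -k5
  · have hs := PresentedAlgebra.gen_mem_span (familyRelations q)
    rw [forall_zmod_two_prod]
    simp only [pairFun_zero_zero, pairFun_one_zero, pairFun_zero_one, pairFun_one_one]
    exact ⟨hs _, Submodule.smul_mem _ _ (hs _), Submodule.smul_mem _ _ (hs _),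
      Submodule.smul_mem _ _ (hs _)⟩
  · have hs := PresentedAlgebra.gen_mem_span (familyRelations p)
    rw [forall_zmod_two_prod]
    simp only [pairFun_zero_zero, pairFun_one_zero, pairFun_zero_one, pairFun_one_one]
    exact ⟨hs _, Submodule.smul_mem _ _ (hs _), Submodule.smul_mem _ _ (hs _),
      Submodule.smul_mem _ _ (hs _)⟩
  · rw [forall_zmod_two_prod]
    simp [hv, PresentedAlgebra.desc_gen, smul_smul, a0, b0, c0, hw]
  · rw [forall_zmod_two_prod]
    simp [hw, PresentedAlgebra.desc_gen, smul_smul, a0, b0, c0, hv]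

/-! ### The curves E_k and the surface α + β + γ + αβγ = 0 -/

/-- The curve of degree four in projective space cut out by two quadrics with parameter `k`. -/
structure OnQuadrics (k : ℂ) (t : ZMod 4 → ℂ) : Prop where
  even : t 0 ^ 2 + t 2 ^ 2 = k * (t 1 * t 3)
  odd : t 1 ^ 2 + t 3 ^ 2 = k * (t 0 * t 2)

/-- The nondegenerate values of the three products of the parameters of the family. -/
structure IsNondegenerate (α β γ : ℂ) : Prop where
  ne_zero_left : α ≠ 0
  ne_zero_middle : β ≠ 0
  ne_zero_right : γ ≠ 0
  left : ¬ (α = -1 ∧ β = 1)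
  middle : ¬ (β = -1 ∧ γ = 1)
  right : ¬ (γ = -1 ∧ α = 1)

section Quadrics

variable {k : ℂ} {t : ZMod 4 → ℂ}

/-- The three parameters attached to a point of `ℙ³`. -/
noncomputable def paramK (t : ZMod 4 → ℂ) : ℂ := t 0 * t 2 / (t 1 * t 3)

/-- The denominator of `paramRho`. -/
noncomputable def denRho (t : ZMod 4 → ℂ) : ℂ :=
  t 1 * t 2 - t 0 * t 3 - Complex.I * (t 2 * t 3 - t 0 * t 1)

/-- The denominator of `paramSigma`. -/
noncomputable def denSigma (t : ZMod 4 → ℂ) : ℂ :=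
  t 1 * t 2 + t 0 * t 3 - Complex.I * (t 2 * t 3 + t 0 * t 1)

/-- The numerator of `paramRho`. -/
noncomputable def numRho (t : ZMod 4 → ℂ) : ℂ :=
  t 1 * t 2 - t 0 * t 3 + Complex.I * (t 2 * t 3 - t 0 * t 1)

/-- The numerator of `paramSigma`. -/
noncomputable def numSigma (t : ZMod 4 → ℂ) : ℂ :=
  t 1 * t 2 + t 0 * t 3 + Complex.I * (t 2 * t 3 + t 0 * t 1)

/-- The second parameter attached to a point of `ℙ³`. -/
noncomputable def paramRho (t : ZMod 4 → ℂ) : ℂ := numRho t / denRho t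

/-- The third parameter attached to a point of `ℙ³`. -/
noncomputable def paramSigma (t : ZMod 4 → ℂ) : ℂ := numSigma t / denSigma t

/-- The parameters of the member of the family attached to a point of `ℙ³`. -/
noncomputable def quadricParams (t : ZMod 4 → ℂ) : Fin 6 → ℂ :=
  ![-Complex.I * paramK t, paramRho t, paramSigma t, Complex.I * paramK t, -paramRho t,
    paramSigma t]

/-- A difference of squares, evaluated by the two quadrics. With nonzero coordinates, only k² = 4
can make the numerator or the denominator of ρ vanish. -/
theorem numRho_mul_denRho (h : OnQuadrics k t) :
    numRho t * denRho t = (k ^ 2 - 4) * (t 0 * t 1 * t 2 * t 3) := by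
  have hI := Complex.I_sq
  simp only [numRho, denRho]
  linear_combination (t 1 ^ 2 + t 3 ^ 2) * h.even + k * (t 1 * t 3) * h.odd -
    (t 2 * t 3 - t 0 * t 1) ^ 2 * hI

theorem numSigma_mul_denSigma (h : OnQuadrics k t) :
    numSigma t * denSigma t = (k ^ 2 + 4) * (t 0 * t 1 * t 2 * t 3) := by
  have hI := Complex.I_sq
  simp only [numSigma, denSigma]
  linear_combination (t 1 ^ 2 + t 3 ^ 2) * h.even + k * (t 1 * t 3) * h.odd -
    (t 2 * t 3 + t 0 * t 1) ^ 2 * hI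

variable (h : OnQuadrics k t) (ht : ∀ r, t r ≠ 0)

include h ht

theorem rho_ne_zero (hk4 : k ^ 2 ≠ 4) : numRho t ≠ 0 ∧ denRho t ≠ 0 := by
  rw [← mul_ne_zero_iff, numRho_mul_denRho h]
  simp [ht, sub_eq_zero, hk4]

theorem sigma_ne_zero (hk4' : k ^ 2 ≠ -4) : numSigma t ≠ 0 ∧ denSigma t ≠ 0 := by
  rw [← mul_ne_zero_iff, numSigma_mul_denSigma h]
  simp [ht, add_eq_zero_iff_eq_neg, hk4']

theorem params_surface (hk4 : k ^ 2 ≠ 4) (hk4' : k ^ 2 ≠ -4) :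
    paramK t ^ 2 - paramRho t ^ 2 + paramSigma t ^ 2 -
      paramK t ^ 2 * paramRho t ^ 2 * paramSigma t ^ 2 = 0 := by
  obtain ⟨-, hd⟩ := rho_ne_zero h ht hk4
  obtain ⟨-, hd'⟩ := sigma_ne_zero h ht hk4'
  have h1 := ht 1
  have h3 := ht 3
  have hI := Complex.I_sq
  -- Both sides equal k t₀t₁t₂t₃: this is what remains of the quadrics after eliminating k.
  have hS : t 1 * t 3 * (t 1 ^ 2 + t 3 ^ 2) = t 0 * t 2 * (t 0 ^ 2 + t 2 ^ 2) := by
    rw [h.even, h.odd]; ring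
  have key : (t 0 * t 2) ^ 2 * (denRho t ^ 2 * denSigma t ^ 2 - numRho t ^ 2 * numSigma t ^ 2) =
      (t 1 * t 3) ^ 2 * (numRho t ^ 2 * denSigma t ^ 2 - denRho t ^ 2 * numSigma t ^ 2) := by
    -- Each difference of squares in the goal factors, and every factor is a simple form in t.
    have e1 : denRho t * denSigma t - numRho t * numSigma t =
        -4 * (Complex.I * (t 1 * t 3) * (t 2 ^ 2 - t 0 ^ 2)) := by
      simp only [numRho, denRho, numSigma, denSigma]; ring
    have e2 : denRho t * denSigma t + numRho t * numSigma t =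
        2 * ((t 1 ^ 2 - t 3 ^ 2) * (t 0 ^ 2 + t 2 ^ 2)) := by
      simp only [numRho, denRho, numSigma, denSigma]
      linear_combination 2 * (t 2 * t 3 + t 0 * t 1) * (t 2 * t 3 - t 0 * t 1) * hI
    have e3 : numRho t * denSigma t - denRho t * numSigma t =
        4 * (Complex.I * (t 0 * t 2) * (t 3 ^ 2 - t 1 ^ 2)) := by
      simp only [numRho, denRho, numSigma, denSigma]; ring
    have e4 : numRho t * denSigma t + denRho t * numSigma t =
        2 * ((t 2 ^ 2 - t 0 ^ 2) * (t 1 ^ 2 + t 3 ^ 2)) := by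
      simp only [numRho, denRho, numSigma, denSigma]
      linear_combination -2 * (t 2 * t 3 + t 0 * t 1) * (t 2 * t 3 - t 0 * t 1) * hI
    have e5 : (t 0 * t 2) ^ 2 * ((denRho t * denSigma t - numRho t * numSigma t) *
        (denRho t * denSigma t + numRho t * numSigma t)) =
        (t 1 * t 3) ^ 2 * ((numRho t * denSigma t - denRho t * numSigma t) *
        (numRho t * denSigma t + denRho t * numSigma t)) := by
      rw [e1, e2, e3, e4]
      linear_combination 8 * Complex.I * (t 1 * t 3) * (t 0 * t 2) * (t 1 ^ 2 - t 3 ^ 2) *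
        (t 2 ^ 2 - t 0 ^ 2) * hS
    linear_combination e5
  simp only [paramK, paramRho, paramSigma]
  field_simp
  linear_combination key

theorem quadricParams_mem_fivefold (hk4 : k ^ 2 ≠ 4) (hk4' : k ^ 2 ≠ -4) :
    quadricParams t ∈ fivefold := by
  have hI := Complex.I_sq
  have := params_surface h ht hk4 hk4'
  change -Complex.I * paramK t * (Complex.I * paramK t) + paramRho t * (-paramRho t) +
    paramSigma t * paramSigma t + -Complex.I * paramK t * (Complex.I * paramK t) * paramRho t *
    (-paramRho t) * paramSigma t * paramSigma t = 0
  linear_combination this - paramK t ^ 2 * (1 - paramRho t ^ 2 * paramSigma t ^ 2) * hI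

theorem quadric_products_nondegenerate (hk : k ≠ 0) (hk4 : k ^ 2 ≠ 4) (hk4' : k ^ 2 ≠ -4) :
    IsNondegenerate (paramK t ^ 2) (-paramRho t ^ 2) (paramSigma t ^ 2) := by
  obtain ⟨hn, hd⟩ := rho_ne_zero h ht hk4
  obtain ⟨hn', hd'⟩ := sigma_ne_zero h ht hk4'
  have h0 := ht 0
  have h1 := ht 1
  have h2 := ht 2
  have h3 := ht 3
  have hI := Complex.I_sq
  have hI0 := Complex.I_ne_zero
  have ek : paramK t ^ 2 * (t 1 * t 3) ^ 2 = (t 0 * t 2) ^ 2 := by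
    rw [paramK]; field_simp
  have er : paramRho t ^ 2 * denRho t ^ 2 = numRho t ^ 2 := by
    rw [paramRho]; field_simp
  have es : paramSigma t ^ 2 * denSigma t ^ 2 = numSigma t ^ 2 := by
    rw [paramSigma]; field_simp
  have rs : numRho t ^ 2 + denRho t ^ 2 = 2 * ((t 1 ^ 2 - t 3 ^ 2) * (t 2 ^ 2 - t 0 ^ 2)) := by
    simp only [numRho, denRho]
    linear_combination 2 * (t 2 * t 3 - t 0 * t 1) ^ 2 * hI
  have ss : numSigma t ^ 2 + denSigma t ^ 2 =
      2 * ((t 1 ^ 2 - t 3 ^ 2) * (t 2 ^ 2 - t 0 ^ 2)) := by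
    simp only [numSigma, denSigma]
    linear_combination 2 * (t 2 * t 3 + t 0 * t 1) ^ 2 * hI
  have even := h.even
  have odd := h.odd
  -- By `rs` and `ss`, this product vanishes as soon as ρ² = −1 or σ² = −1. Then t₁² = t₃² or t₀² =
  -- t₂², and the quadrics tie k² to K².
  have main : (t 1 ^ 2 - t 3 ^ 2) * (t 2 ^ 2 - t 0 ^ 2) = 0 → k ^ 2 = 4 * paramK t ^ 2 ∨
      k ^ 2 * paramK t ^ 2 = 4 := by
    intro hz
    rcases mul_eq_zero.1 hz with hz | hz
    · right
      have : (k ^ 2 * paramK t ^ 2 - 4) * (t 1 * t 3) ^ 2 = 0 := by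
        linear_combination k ^ 2 * ek + (-k * (t 0 * t 2) - t 1 ^ 2 - t 3 ^ 2) * odd +
          (t 1 ^ 2 - t 3 ^ 2) * hz
      exact sub_eq_zero.1 ((mul_eq_zero.1 this).resolve_right (by simp [*]))
    · left
      have : (k ^ 2 - 4 * paramK t ^ 2) * (t 1 * t 3) ^ 2 = 0 := by
        linear_combination -4 * ek - (k * (t 1 * t 3) + t 0 ^ 2 + t 2 ^ 2) * even +
          (t 2 ^ 2 - t 0 ^ 2) * hz
      exact sub_eq_zero.1 ((mul_eq_zero.1 this).resolve_right (by simp [*]))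
  refine ⟨?_, ?_, ?_, ?_, ?_, ?_⟩
  · simp [paramK, *]
  · simp [paramRho, *]
  · simp [paramSigma, *]
  · rintro ⟨ha, hb⟩
    have hz : (t 1 ^ 2 - t 3 ^ 2) * (t 2 ^ 2 - t 0 ^ 2) = 0 := by
      linear_combination -(1 / 2) * rs - (1 / 2) * er - (1 / 2) * denRho t ^ 2 * hb
    rcases main hz with h' | h' <;> rw [ha] at h'
    · exact hk4' (by linear_combination h')
    · exact hk4' (by linear_combination -h')
  -- Here ρ² = σ² = 1, so `z1` and `z2` each kill a factor. Two combinations make a product of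
  -- coordinates vanish, the other two force t₀² + t₂² = 0, against k ≠ 0.
  · rintro ⟨hb, hc⟩
    have z1 : (t 1 * t 2 - t 0 * t 3) * (t 2 * t 3 - t 0 * t 1) = 0 := by
      refine (mul_eq_zero.1 (?_ : (4 * Complex.I) * _ = 0)).resolve_left (by simp)
      simp only [numRho, denRho] at er
      linear_combination -er - (t 1 * t 2 - t 0 * t 3 - Complex.I * (t 2 * t 3 - t 0 * t 1)) ^ 2 * hb
    have z2 : (t 1 * t 2 + t 0 * t 3) * (t 2 * t 3 + t 0 * t 1) = 0 := by
      refine (mul_eq_zero.1 (?_ : (4 * Complex.I) * _ = 0)).resolve_left (by simp)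
      simp only [numSigma, denSigma] at es
      linear_combination -es + (t 1 * t 2 + t 0 * t 3 - Complex.I * (t 2 * t 3 + t 0 * t 1)) ^ 2 * hc
    have z3 : ∀ s, s ≠ 0 → s * (t 0 ^ 2 + t 2 ^ 2) ≠ 0 := by
      intro s hs
      rw [even]
      simp [*]
    rcases mul_eq_zero.1 z1 with y1 | y1 <;> rcases mul_eq_zero.1 z2 with y2 | y2
    · have : t 1 * t 2 = 0 := by linear_combination (y1 + y2) / 2
      simp [*] at this
    · exact z3 _ h1 (by linear_combination t 2 * y1 + t 0 * y2)
    · exact z3 _ h3 (by linear_combination t 2 * y1 + t 0 * y2)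
    · have : t 2 * t 3 = 0 := by linear_combination (y1 + y2) / 2
      simp [*] at this
  · rintro ⟨hc, ha⟩
    have hz : (t 1 ^ 2 - t 3 ^ 2) * (t 2 ^ 2 - t 0 ^ 2) = 0 := by
      linear_combination -(1 / 2) * ss - (1 / 2) * es + (1 / 2) * denSigma t ^ 2 * hc
    rcases main hz with h' | h' <;> rw [ha] at h'
    · exact hk4 (by linear_combination h')
    · exact hk4 (by linear_combination h')

omit h

theorem satisfiesSklyanin_iff_quadricParams (hd : denRho t ≠ 0) (hd' : denSigma t ≠ 0)
    {B : Type*} [Ring B] [Algebra ℂ B] (x : ZMod 4 → B) :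
    SatisfiesSklyanin t x ↔ SatisfiesFamily (quadricParams t)
      (x 0 + x 2) (x 0 - x 2) (x 1 + x 3) (x 1 - x 3) := by
  have h1 := ht 1
  have h3 := ht 3
  have er : paramRho t * denRho t = numRho t := by
    rw [paramRho]; field_simp
  have es : paramSigma t * denSigma t = numSigma t := by
    rw [paramSigma]; field_simp
  refine satisfiesSklyanin_iff_family (by simp [*]) hd hd' ?_ ?_ ?_ ?_ ?_ x
  · rw [paramK]; field_simp
  all_goals
    simp only [add_mul, sub_mul, er, es]
    simp only [numRho, denRho, numSigma, denSigma]
    ring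

end Quadrics

/-! ### Recovering a point of some E_k from (K, ρ, σ) -/

/-- The products of an even-indexed and an odd-indexed coordinate are linear in the denominators of
ρ and σ, with coefficients depending on ρ and σ. The compatibility (t₁t₂)(t₀t₃) = (t₂t₃)(t₀t₁) fixes
the squared ratio of these denominators as (1 + σ²) : (1 + ρ²), whence a and b. -/
theorem exists_quadric_generic {K ρ σ : ℂ} (hsurf : K ^ 2 * (1 - ρ ^ 2 * σ ^ 2) = ρ ^ 2 - σ ^ 2)
    (hK : K ≠ 0) (hρ : ρ ≠ 0) (hσ : σ ≠ 0) (hρσ : ρ ^ 2 ≠ σ ^ 2) (hρσ' : ρ ^ 2 * σ ^ 2 ≠ 1)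
    (hρ' : ρ ^ 2 ≠ -1) (hσ' : σ ^ 2 ≠ -1) :
    ∃ (k : ℂ) (t : ZMod 4 → ℂ), OnQuadrics k t ∧ (∀ r, t r ≠ 0) ∧ k ≠ 0 ∧ k ^ 2 ≠ 4 ∧
      k ^ 2 ≠ -4 ∧ paramK t = K ∧ paramRho t = ρ ∧ paramSigma t = σ := by
  have hI := Complex.I_sq
  have hI0 := Complex.I_ne_zero
  obtain ⟨a, ha⟩ := IsAlgClosed.exists_pow_nat_eq (1 + σ ^ 2) zero_lt_two
  obtain ⟨b, hb⟩ := IsAlgClosed.exists_pow_nat_eq (1 + ρ ^ 2) zero_lt_two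
  have a0 : a ≠ 0 := by
    rintro rfl
    exact hσ' (by linear_combination -ha)
  have b0 : b ≠ 0 := by
    rintro rfl
    exact hρ' (by linear_combination -hb)
  obtain ⟨A12, h12⟩ : ∃ A, A = ((σ + 1) * b + (ρ + 1) * a) / 2 := ⟨_, rfl⟩
  obtain ⟨A03, h03⟩ : ∃ A, A = ((σ + 1) * b - (ρ + 1) * a) / 2 := ⟨_, rfl⟩
  obtain ⟨A23, h23⟩ : ∃ A, A = -Complex.I * ((σ - 1) * b + (ρ - 1) * a) / 2 := ⟨_, rfl⟩
  obtain ⟨A01, h01⟩ : ∃ A, A = -Complex.I * ((σ - 1) * b - (ρ - 1) * a) / 2 := ⟨_, rfl⟩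
  have prod1 : A12 * A03 = (σ - ρ) * (1 - ρ * σ) / 2 := by
    rw [h12, h03]
    linear_combination (σ + 1) ^ 2 / 4 * hb - (ρ + 1) ^ 2 / 4 * ha
  have prod2 : A23 * A01 = (σ - ρ) * (1 - ρ * σ) / 2 := by
    rw [h23, h01]
    linear_combination -(σ - 1) ^ 2 / 4 * hb + (ρ - 1) ^ 2 / 4 * ha +
      ((σ - 1) ^ 2 * b ^ 2 - (ρ - 1) ^ 2 * a ^ 2) / 4 * hI
  have pne : (σ - ρ) * (1 - ρ * σ) / 2 ≠ 0 := by
    intro h0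
    have : (ρ ^ 2 - σ ^ 2) * (ρ ^ 2 * σ ^ 2 - 1) = 0 := by
      linear_combination 2 * (ρ + σ) * (ρ * σ + 1) * h0
    rcases mul_eq_zero.1 this with h | h
    · exact hρσ (by linear_combination h)
    · exact hρσ' (by linear_combination h)
  have n12 : A12 ≠ 0 := by rintro h; rw [h, zero_mul] at prod1; exact pne prod1.symm
  have n03 : A03 ≠ 0 := by rintro h; rw [h, mul_zero] at prod1; exact pne prod1.symm
  have n23 : A23 ≠ 0 := by rintro h; rw [h, zero_mul] at prod2; exact pne prod2.symm
  have n01 : A01 ≠ 0 := by rintro h; rw [h, mul_zero] at prod2; exact pne prod2.symm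
  have hA : A12 * A03 = A23 * A01 := prod1.trans prod2.symm
  -- The mixed products leave free the scaling of (t₀, t₂) against (t₁, t₃); n adjusts it to the
  -- prescribed K.
  obtain ⟨n, hn⟩ := IsAlgClosed.exists_pow_nat_eq (K * A12 / A03) zero_lt_two
  have n0 : n ≠ 0 := by
    rintro rfl
    rw [zero_pow two_ne_zero, eq_comm, div_eq_zero_iff, mul_eq_zero] at hn
    tauto
  let t : ZMod 4 → ℂ := (![A01 * n, A01 * A12 / A03, A12 * n, A12] : Fin 4 → ℂ)
  have t0 : t 0 = A01 * n := rfl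
  have t1 : t 1 = A01 * A12 / A03 := rfl
  have t2 : t 2 = A12 * n := rfl
  have t3 : t 3 = A12 := rfl
  obtain ⟨c, hc⟩ : ∃ c, c = A01 * A12 * n / A03 := ⟨_, rfl⟩
  have c0 : c ≠ 0 := by rw [hc]; positivity
  have p12 : t 1 * t 2 = c * A12 := by rw [t1, t2, hc]; ring
  have p03 : t 0 * t 3 = c * A03 := by rw [t0, t3, hc]; field_simp
  have p01 : t 0 * t 1 = c * A01 := by rw [t0, t1, hc]; ring
  have p23 : t 2 * t 3 = c * A23 := by
    rw [t2, t3, hc]; field_simp; linear_combination hA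
  have htne : ∀ r, t r ≠ 0 := by
    rw [forall_zmod_four, t0, t1, t2, t3]
    refine ⟨?_, ?_, ?_, ?_⟩ <;> positivity
  have dR : denRho t = 2 * a * c := by
    rw [denRho, p12, p03, p23, p01, h12, h03, h23, h01]
    linear_combination c * (ρ - 1) * a * hI
  have nR : numRho t = 2 * ρ * a * c := by
    rw [numRho, p12, p03, p23, p01, h12, h03, h23, h01]
    linear_combination -c * (ρ - 1) * a * hI
  have dS : denSigma t = 2 * b * c := by
    rw [denSigma, p12, p03, p23, p01, h12, h03, h23, h01]
    linear_combination c * (σ - 1) * b * hI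
  have nS : numSigma t = 2 * σ * b * c := by
    rw [numSigma, p12, p03, p23, p01, h12, h03, h23, h01]
    linear_combination -c * (σ - 1) * b * hI
  -- The surface equation enters here: it makes the two quadrics agree on the value of k.
  have hS : A12 * (A01 ^ 2 + A03 ^ 2) = K ^ 2 * A03 * (A01 ^ 2 + A12 ^ 2) := by
    have e1 : A01 ^ 2 + A03 ^ 2 = (b - a) * (σ * b - ρ * a) := by
      rw [h01, h03]
      linear_combination ((σ - 1) * b - (ρ - 1) * a) ^ 2 / 4 * hI
    have e2 : A01 ^ 2 + A12 ^ 2 = (b + ρ * a) * (σ * b + a) := by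
      rw [h01, h12]
      linear_combination ((σ - 1) * b - (ρ - 1) * a) ^ 2 / 4 * hI
    have hne : 1 - ρ ^ 2 * σ ^ 2 ≠ 0 := fun h => hρσ' (by linear_combination -h)
    refine mul_left_cancel₀ hne ?_
    rw [e1, e2, h12, h03]
    linear_combination (((1 - ρ ^ 2 * σ ^ 2) * ((ρ + 1) * ρ) + (ρ ^ 2 - σ ^ 2) * ((ρ + 1) * ρ)) * a +
      ((1 - ρ ^ 2 * σ ^ 2) * ((σ + 1) * ρ - (ρ + 1) * (ρ + σ)) -
      (ρ ^ 2 - σ ^ 2) * ((σ + 1) * ρ - (ρ + 1) * (1 + ρ * σ))) * b) / 2 * ha + (((1 - ρ ^ 2 * σ ^ 2) * ((ρ + 1) * σ - (σ + 1) * (ρ + σ)) -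
      (ρ ^ 2 - σ ^ 2) * ((σ + 1) * (1 + ρ * σ) - (ρ + 1) * σ)) * a +
      ((1 - ρ ^ 2 * σ ^ 2) * ((σ + 1) * σ) - (ρ ^ 2 - σ ^ 2) * ((σ + 1) * σ)) * b) / 2 * hb -
      ((σ + 1) * b - (ρ + 1) * a) / 2 * (b + ρ * a) * (σ * b + a) * hsurf
  have hodd : (t 1 ^ 2 + t 3 ^ 2) * (t 1 * t 3) = (t 0 ^ 2 + t 2 ^ 2) * (t 0 * t 2) := by
    rw [t0, t1, t2, t3, show ((A01 * n) ^ 2 + (A12 * n) ^ 2) * (A01 * n * (A12 * n)) =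
      (A01 ^ 2 + A12 ^ 2) * A01 * A12 * (n ^ 2) ^ 2 by ring, hn]
    field_simp
    linear_combination hS
  have n1 := htne 1
  have n3 := htne 3
  have hq : OnQuadrics ((t 0 ^ 2 + t 2 ^ 2) / (t 1 * t 3)) t := by
    constructor
    · field_simp
    · field_simp
      linear_combination hodd
  have f1 := numRho_mul_denRho hq
  have f2 := numSigma_mul_denSigma hq
  rw [nR, dR] at f1
  rw [nS, dS] at f2
  refine ⟨_, t, hq, htne, ?_, ?_, ?_, ?_, ?_, ?_⟩
  · intro hk
    rw [hk] at f1 f2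
    have : c ^ 2 * ((ρ + σ) * (1 + ρ * σ)) = 0 := by
      linear_combination (f1 + f2) / 4 - ρ * c ^ 2 * ha - σ * c ^ 2 * hb
    rcases mul_eq_zero.1 ((mul_eq_zero.1 this).resolve_left (by simp [c0])) with h | h
    · exact hρσ (by linear_combination (ρ - σ) * h)
    · exact hρσ' (by linear_combination (ρ * σ - 1) * h)
  · intro hk
    rw [hk, sub_self, zero_mul] at f1
    simp [hρ, a0, c0] at f1
  · intro hk
    rw [hk, neg_add_cancel, zero_mul] at f2
    simp [hσ, b0, c0] at f2
  · rw [paramK, t0, t1, t2, t3, show A01 * n * (A12 * n) = A01 * A12 * n ^ 2 by ring, hn]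
    field_simp
  · rw [paramRho, nR, dR]; field_simp
  · rw [paramSigma, nS, dS]; field_simp

/-- At ρ² = σ² = −1 the generic construction breaks down, since a and b vanish. Points with t₁ = t₃
cover this case; the quadratic equation for x is what the quadrics become for k = 2/K. -/
theorem exists_quadric_special {K : ℂ} (hK : K ≠ 0) (h1 : K ^ 2 ≠ 1) (h2 : K ^ 2 ≠ -1) :
    ∃ (k : ℂ) (t : ZMod 4 → ℂ), OnQuadrics k t ∧ (∀ r, t r ≠ 0) ∧ k ≠ 0 ∧ k ^ 2 ≠ 4 ∧
      k ^ 2 ≠ -4 ∧ paramK t = K ∧ paramRho t = Complex.I ∧ paramSigma t = Complex.I := by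
  have hI := Complex.I_sq
  obtain ⟨e, he⟩ := IsAlgClosed.exists_pow_nat_eq (1 - K ^ 4) zero_lt_two
  obtain ⟨x, hx⟩ : ∃ x, x = (1 + e) / K ^ 2 := ⟨_, rfl⟩
  have hx2 : K ^ 2 * (x ^ 2 + 1) = 2 * x := by
    rw [hx]; field_simp; linear_combination he
  clear hx
  have x0 : x ≠ 0 := by
    rintro rfl
    simp [hK] at hx2
  obtain ⟨n, hn⟩ := IsAlgClosed.exists_pow_nat_eq (K / x) zero_lt_two
  have n0 : n ≠ 0 := by
    rintro rfl
    rw [zero_pow two_ne_zero, eq_comm, div_eq_zero_iff] at hn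
    tauto
  have x1 : 1 - x ≠ 0 := by
    intro h
    obtain rfl : x = 1 := by linear_combination -h
    exact h1 (by linear_combination hx2 / 2)
  have x1' : 1 + x ≠ 0 := by
    intro h
    obtain rfl : x = -1 := by linear_combination h
    exact h2 (by linear_combination hx2 / 2)
  have hI1 : 1 - Complex.I ≠ 0 := by
    intro h
    have := congrArg Complex.re h
    simp at this
  let t : ZMod 4 → ℂ := (![x * n, 1, n, 1] : Fin 4 → ℂ)
  have t0 : t 0 = x * n := rfl
  have t1 : t 1 = 1 := rfl
  have t2 : t 2 = n := rfl
  have t3 : t 3 = 1 := rfl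
  have hn' : n ^ 2 * x = K := by rw [hn]; field_simp
  have hk : K * (2 / K) = 2 := by field_simp
  have hk2 : (2 / K) ^ 2 * K ^ 2 = 4 := by field_simp; norm_num
  refine ⟨2 / K, t, ⟨?_, ?_⟩, ?_, ?_, ?_, ?_, ?_, ?_, ?_⟩
  · rw [t0, t1, t2, t3]
    field_simp
    refine mul_left_cancel₀ x0 ?_
    linear_combination K * (x ^ 2 + 1) * hn' + hx2
  · rw [t0, t1, t2, t3]
    field_simp
    linear_combination -2 * hn'
  · rw [forall_zmod_four, t0, t1, t2, t3]
    simp [*]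
  · simp [hK]
  · intro h
    exact h1 (by linear_combination (hk2 - K ^ 2 * h) / 4)
  · intro h
    exact h2 (by linear_combination -(hk2 - K ^ 2 * h) / 4)
  · rw [paramK, t0, t1, t2, t3]
    linear_combination hn'
  · have hd : denRho t = n * (1 - x) * (1 - Complex.I) := by
      rw [denRho, t0, t1, t2, t3]; ring
    rw [paramRho, hd, div_eq_iff (by simp [*]), numRho, t0, t1, t2, t3]
    linear_combination n * (1 - x) * hI
  · have hd : denSigma t = n * (1 + x) * (1 - Complex.I) := by
      rw [denSigma, t0, t1, t2, t3]; ring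
    rw [paramSigma, hd, div_eq_iff (by simp [*]), numSigma, t0, t1, t2, t3]
    linear_combination n * (1 + x) * hI

/-- Every nondegenerate point of the surface comes from a point of a smooth curve `E_k`. -/
theorem exists_quadric_of_nondegenerate {α β γ : ℂ} (hnd : IsNondegenerate α β γ)
    (hsurf : α + β + γ + α * β * γ = 0) :
    ∃ (k : ℂ) (t : ZMod 4 → ℂ), OnQuadrics k t ∧ (∀ r, t r ≠ 0) ∧ k ≠ 0 ∧ k ^ 2 ≠ 4 ∧
      k ^ 2 ≠ -4 ∧ paramK t ^ 2 = α ∧ -paramRho t ^ 2 = β ∧ paramSigma t ^ 2 = γ := by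
  obtain ⟨hα, hβ, hγ, hl, hm, hr⟩ := hnd
  obtain ⟨K, rfl⟩ := IsAlgClosed.exists_pow_nat_eq α zero_lt_two
  obtain ⟨σ, rfl⟩ := IsAlgClosed.exists_pow_nat_eq γ zero_lt_two
  obtain ⟨ρ, hρ⟩ := IsAlgClosed.exists_pow_nat_eq (-β) zero_lt_two
  obtain rfl : β = -ρ ^ 2 := by rw [hρ, neg_neg]
  have hK0 : K ≠ 0 := by rintro rfl; simp at hα
  have hρ0 : ρ ≠ 0 := by rintro rfl; simp at hβ
  have hσ0 : σ ≠ 0 := by rintro rfl; simp at hγ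
  by_cases hs : -ρ ^ 2 = 1 ∧ σ ^ 2 = -1
  · obtain ⟨hs1, hs2⟩ := hs
    obtain ⟨k, t, h1, h2, h3, h4, h5, h6, h7, h8⟩ := exists_quadric_special (K := K) hK0
      (fun h => hr ⟨hs2, h⟩) (fun h => hl ⟨h, hs1⟩)
    refine ⟨k, t, h1, h2, h3, h4, h5, ?_, ?_, ?_⟩
    · rw [h6]
    · rw [h7, hs1, Complex.I_sq, neg_neg]
    · rw [h8, hs2, Complex.I_sq]
  · have split : ∀ {x y : ℂ}, x * y = 0 → x = 0 ∨ y = 0 := fun h => mul_eq_zero.1 h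
    have surf : K ^ 2 * (1 - ρ ^ 2 * σ ^ 2) = ρ ^ 2 - σ ^ 2 := by linear_combination hsurf
    -- Outside the special case, the surface equation turns each equality to be excluded into a
    -- vanishing product, whose factors give a forbidden pair or the special case, or else reduces
    -- it to the preceding exclusion.
    have hρσ : ρ ^ 2 ≠ σ ^ 2 := by
      intro h
      have h0 : K ^ 2 * ((1 - σ ^ 2) * (1 + σ ^ 2)) = 0 := by
        linear_combination surf + (K ^ 2 * σ ^ 2 + 1) * h
      rcases split ((split h0).resolve_left hα) with h1 | h1
      · exact hm ⟨by linear_combination -h + h1, by linear_combination -h1⟩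
      · exact hs ⟨by linear_combination -h - h1, by linear_combination h1⟩
    have hρσ' : ρ ^ 2 * σ ^ 2 ≠ 1 := by
      intro h
      exact hρσ (by linear_combination -surf - K ^ 2 * h)
    have hρ' : ρ ^ 2 ≠ -1 := by
      intro h
      have h0 : (1 + K ^ 2) * (1 + σ ^ 2) = 0 := by
        linear_combination surf + (K ^ 2 * σ ^ 2 + 1) * h
      rcases split h0 with h1 | h1
      · exact hl ⟨by linear_combination h1, by linear_combination -h⟩
      · exact hs ⟨by linear_combination -h, by linear_combination h1⟩
    have hσ' : σ ^ 2 ≠ -1 := by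
      intro h
      have h0 : (K ^ 2 - 1) * (1 + ρ ^ 2) = 0 := by
        linear_combination surf + (K ^ 2 * ρ ^ 2 - 1) * h
      rcases split h0 with h1 | h1
      · exact hr ⟨h, by linear_combination h1⟩
      · exact hs ⟨by linear_combination -h1, h⟩
    obtain ⟨k, t, h1, h2, h3, h4, h5, h6, h7, h8⟩ :=
      exists_quadric_generic surf hK0 hρ0 hσ0 hρσ hρσ' hρ' hσ'
    exact ⟨k, t, h1, h2, h3, h4, h5, by rw [h6], by rw [h7], by rw [h8]⟩

/-! ### The nondegenerate locus is Zariski open and dense -/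

/-- The nondegenerate points of the fivefold. -/
def nondegenerateLocus : Set (Fin 6 → ℂ) :=
  {p | p ∈ fivefold ∧ IsNondegenerate (p 0 * p 3) (p 1 * p 4) (p 2 * p 5)}

-- A forbidden pair is avoided when one of two polynomials is nonzero. Choosing one polynomial for
-- each of the three pairs and multiplying gives eight polynomials whose nonvanishing loci cover the
-- set.
open MvPolynomial in
theorem nondegenerateLocus_open : ∃ S : Set (MvPolynomial (Fin 6) ℂ),
    nondegenerateLocus = {p | p ∈ fivefold ∧ ∃ f ∈ S, eval p f ≠ 0} := by
  refine ⟨{f | ∃ a ∈ ({X 0 * X 3 + 1, X 1 * X 4 - 1} : Set (MvPolynomial (Fin 6) ℂ)),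
    ∃ b ∈ ({X 1 * X 4 + 1, X 2 * X 5 - 1} : Set (MvPolynomial (Fin 6) ℂ)),
    ∃ c ∈ ({X 2 * X 5 + 1, X 0 * X 3 - 1} : Set (MvPolynomial (Fin 6) ℂ)),
    f = X 0 * X 3 * (X 1 * X 4) * (X 2 * X 5) * (a * b * c)}, ?_⟩
  ext p
  simp only [nondegenerateLocus, Set.mem_ofPred_eq]
  refine and_congr_right fun _ => ?_
  have aux : ∀ x y : ℂ, ¬ (x = -1 ∧ y = 1) ↔ x + 1 ≠ 0 ∨ y - 1 ≠ 0 := by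
    intro x y
    rw [not_and_or, sub_ne_zero, ← sub_neg_eq_add, sub_ne_zero]
  constructor
  · rintro ⟨h0, h1, h2, h3, h4, h5⟩
    rw [aux] at h3 h4 h5
    have key : ∀ {x y : MvPolynomial (Fin 6) ℂ}, eval p x ≠ 0 ∨ eval p y ≠ 0 →
        ∃ a ∈ ({x, y} : Set (MvPolynomial (Fin 6) ℂ)), eval p a ≠ 0 := by
      rintro x y (h | h)
      exacts [⟨x, by simp, h⟩, ⟨y, by simp, h⟩]
    obtain ⟨a, ha, ha'⟩ := key (x := X 0 * X 3 + 1) (y := X 1 * X 4 - 1) (by simpa using h3)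
    obtain ⟨b, hb, hb'⟩ := key (x := X 1 * X 4 + 1) (y := X 2 * X 5 - 1) (by simpa using h4)
    obtain ⟨c, hc, hc'⟩ := key (x := X 2 * X 5 + 1) (y := X 0 * X 3 - 1) (by simpa using h5)
    refine ⟨_, ⟨a, ha, b, hb, c, hc, rfl⟩, ?_⟩
    simp only [map_mul, eval_X]
    exact mul_ne_zero (mul_ne_zero (mul_ne_zero h0 h1) h2) (mul_ne_zero (mul_ne_zero ha' hb') hc')
  · rintro ⟨_, ⟨a, ha, b, hb, c, hc, rfl⟩, hf⟩
    simp only [map_mul, eval_X, ne_eq, mul_eq_zero, not_or] at hf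
    obtain ⟨⟨⟨h0, h1⟩, h2⟩, ⟨ha', hb'⟩, hc'⟩ := hf
    refine ⟨by simp [h0], by simp [h1], by simp [h2], ?_, ?_, ?_⟩
    · rw [aux]
      rcases ha with rfl | rfl
      exacts [Or.inl (by simpa using ha'), Or.inr (by simpa using ha')]
    · rw [aux]
      rcases hb with rfl | rfl
      exacts [Or.inl (by simpa using hb'), Or.inr (by simpa using hb')]
    · rw [aux]
      rcases hc with rfl | rfl
      exacts [Or.inl (by simpa using hc'), Or.inr (by simpa using hc')]

/-- A symmetric dense part of the nondegenerate locus. -/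
def genericLocus : Set (Fin 6 → ℂ) :=
  {p | p ∈ fivefold ∧ p 0 * p 3 ≠ 0 ∧ p 1 * p 4 ≠ 0 ∧ p 2 * p 5 ≠ 0 ∧ (p 0 * p 3) ^ 2 ≠ 1 ∧
    (p 1 * p 4) ^ 2 ≠ 1 ∧ (p 2 * p 5) ^ 2 ≠ 1}

theorem genericLocus_subset : genericLocus ⊆ nondegenerateLocus := by
  rintro p ⟨hp, h0, h1, h2, h3, h4, h5⟩
  exact ⟨hp, h0, h1, h2, fun h => h3 (by rw [h.1]; norm_num), fun h => h4 (by rw [h.1]; norm_num),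
    fun h => h5 (by rw [h.1]; norm_num)⟩

open Filter Topology in
theorem eventually_quadratic_ne_zero (a b : ℂ) {c : ℂ} (hc : c ≠ 0) :
    ∀ᶠ s in 𝓝[≠] (0 : ℂ), a + b * s + c * s ^ 2 ≠ 0 := by
  let P : Polynomial ℂ := Polynomial.C a + Polynomial.C b * Polynomial.X +
    Polynomial.C c * Polynomial.X ^ 2
  have hP : P ≠ 0 := by
    intro h
    have := congrArg (fun R => Polynomial.coeff R 2) h
    simp [P] at this
    exact hc this
  have hfin := Polynomial.finite_setOfPred_isRoot hP
  have := hfin.eventually_cofinite_notMem.filter_mono (nhdsNE_le_cofinite 0)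
  filter_upwards [this] with s hs h
  exact hs (by simpa [P] using h)

open Filter Topology in
/-- A point of the fivefold with nonvanishing derivative in the first coordinate is a limit of
points of the generic locus. -/
theorem eval_eq_zero_of_partial {f : MvPolynomial (Fin 6) ℂ}
    (hf : ∀ p ∈ genericLocus, MvPolynomial.eval p f = 0) {p : Fin 6 → ℂ} (hp : p ∈ fivefold)
    (h3 : p 3 ≠ 0) (hβγ : 1 + p 1 * p 4 * (p 2 * p 5) ≠ 0) : MvPolynomial.eval p f = 0 := by
  -- Along the curve β and γ are quadratic in s with leading coefficients 1 and 2, so neither they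
  -- nor their sum can be constant; the first coordinate is then solved from the equation of the
  -- fivefold.
  let b : ℂ → ℂ := fun s => (p 1 + s) * (p 4 + s)
  let c : ℂ → ℂ := fun s => (p 2 + s) * (p 5 + 2 * s)
  let q : ℂ → Fin 6 → ℂ := fun s =>
    ![-(b s + c s) / (p 3 * (1 + b s * c s)), p 1 + s, p 2 + s, p 3, p 4 + s, p 5 + 2 * s]
  have hb : Continuous b := by fun_prop
  have hc : Continuous c := by fun_prop
  have hden : 1 + b 0 * c 0 ≠ 0 := by simpa [b, c] using hβγ
  have q0 : q 0 = p := by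
    have : p 0 = -(b 0 + c 0) / (p 3 * (1 + b 0 * c 0)) := by
      rw [eq_div_iff (mul_ne_zero h3 hden)]
      have hp' : p 0 * p 3 + p 1 * p 4 + p 2 * p 5 + p 0 * p 3 * p 1 * p 4 * p 2 * p 5 = 0 := hp
      simp only [b, c]
      linear_combination hp'
    ext i
    fin_cases i
    · exact this.symm
    all_goals simp [q]
  have hq : ContinuousAt q 0 := by
    rw [continuousAt_pi]
    intro i
    fin_cases i
    · change ContinuousAt (fun s => -(b s + c s) / (p 3 * (1 + b s * c s))) 0
      refine ContinuousAt.div (by fun_prop) (by fun_prop) (mul_ne_zero h3 hden)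
    all_goals
      simp only [q]
      first
      | exact continuousAt_const
      | exact Continuous.continuousAt (by simp; fun_prop)
  have hcont : ContinuousAt (fun s => MvPolynomial.eval (q s) f) 0 :=
    ContinuousAt.comp (f := q) (g := fun x => MvPolynomial.eval x f)
      (MvPolynomial.continuous_eval f).continuousAt hq
  have hmem : ∀ᶠ s in 𝓝[≠] (0 : ℂ), q s ∈ genericLocus := by
    have hdc : ContinuousAt (fun s => 1 + b s * c s) 0 := by fun_prop
    have hd := (hdc.eventually_ne hden).filter_mono (nhdsWithin_le_nhds (s := {0}ᶜ))
    have c2 : (2 : ℂ) ≠ 0 := two_ne_zero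
    have c3 : (3 : ℂ) ≠ 0 := three_ne_zero
    filter_upwards [hd, eventually_quadratic_ne_zero (p 1 * p 4) (p 1 + p 4) one_ne_zero,
      eventually_quadratic_ne_zero (p 1 * p 4 - 1) (p 1 + p 4) one_ne_zero,
      eventually_quadratic_ne_zero (p 1 * p 4 + 1) (p 1 + p 4) one_ne_zero,
      eventually_quadratic_ne_zero (p 2 * p 5) (2 * p 2 + p 5) c2,
      eventually_quadratic_ne_zero (p 2 * p 5 - 1) (2 * p 2 + p 5) c2,
      eventually_quadratic_ne_zero (p 2 * p 5 + 1) (2 * p 2 + p 5) c2,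
      eventually_quadratic_ne_zero (p 1 * p 4 + p 2 * p 5) (p 1 + p 4 + (2 * p 2 + p 5)) c3]
      with s e1 e2 e3 e4 e5 e6 e7 e8
    have hbs : b s = p 1 * p 4 + (p 1 + p 4) * s + 1 * s ^ 2 := by simp only [b]; ring
    have hcs : c s = p 2 * p 5 + (2 * p 2 + p 5) * s + 2 * s ^ 2 := by simp only [c]; ring
    rw [← hbs] at e2
    rw [← hcs] at e5
    have e3' : b s - 1 ≠ 0 := by rw [hbs]; convert e3 using 1; ring
    have e4' : b s + 1 ≠ 0 := by rw [hbs]; convert e4 using 1; ring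
    have e6' : c s - 1 ≠ 0 := by rw [hcs]; convert e6 using 1; ring
    have e7' : c s + 1 ≠ 0 := by rw [hcs]; convert e7 using 1; ring
    have e8' : b s + c s ≠ 0 := by rw [hbs, hcs]; convert e8 using 1; ring
    have ha : q s 0 * q s 3 = -(b s + c s) / (1 + b s * c s) := by
      change -(b s + c s) / (p 3 * (1 + b s * c s)) * p 3 = _
      field_simp
    have hb' : q s 1 * q s 4 = b s := rfl
    have hc' : q s 2 * q s 5 = c s := rfl
    refine ⟨?_, ?_, ?_, ?_, ?_, ?_, ?_⟩
    · change q s 0 * q s 3 + q s 1 * q s 4 + q s 2 * q s 5 +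
        q s 0 * q s 3 * q s 1 * q s 4 * q s 2 * q s 5 = 0
      rw [show q s 0 * q s 3 * q s 1 * q s 4 * q s 2 * q s 5 =
        q s 0 * q s 3 * (q s 1 * q s 4) * (q s 2 * q s 5) by ring, ha, hb', hc']
      field_simp
      ring
    · rw [ha]
      exact div_ne_zero (neg_ne_zero.2 e8') e1
    · rwa [hb']
    · rwa [hc']
    -- Since (1 + βγ)² − (β + γ)² = (β² − 1)(γ² − 1), the condition on α follows from those on β and
    -- γ.
    · rw [ha, div_pow, ne_eq, div_eq_one_iff_eq (pow_ne_zero 2 e1)]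
      intro h
      exact mul_ne_zero (mul_ne_zero e3' e4') (mul_ne_zero e6' e7') (by linear_combination -h)
    · rw [hb']
      intro h
      exact mul_ne_zero e3' e4' (by linear_combination h)
    · rw [hc']
      intro h
      exact mul_ne_zero e6' e7' (by linear_combination h)
  have hlim := hcont.tendsto.mono_left (nhdsWithin_le_nhds (s := {0}ᶜ))
  rw [q0] at hlim
  refine tendsto_nhds_unique_of_eventuallyEq hlim (tendsto_const_nhds (x := (0 : ℂ))) ?_
  filter_upwards [hmem] with s hs
  exact hf _ hs

/-- An involution of the coordinates that preserves the fivefold and its generic locus. -/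
structure IsSymmetry (e : Fin 6 → Fin 6) : Prop where
  involutive : ∀ i, e (e i) = i
  map_fivefold : ∀ p : Fin 6 → ℂ, p ∈ fivefold → p ∘ e ∈ fivefold
  map_generic : ∀ p : Fin 6 → ℂ, p ∈ genericLocus → p ∘ e ∈ genericLocus

/-- Both loci are defined by conditions symmetric in the three products. Quantifying over all P
invariant under two transpositions expresses that e permutes the products. -/
theorem isSymmetry_of_products {e : Fin 6 → Fin 6} (hinv : ∀ i, e (e i) = i)
    (h : ∀ p : Fin 6 → ℂ, ∀ P : ℂ → ℂ → ℂ → Prop, (∀ x y z, P x y z → P y x z) →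
      (∀ x y z, P x y z → P z y x) → P (p 0 * p 3) (p 1 * p 4) (p 2 * p 5) →
      P (p (e 0) * p (e 3)) (p (e 1) * p (e 4)) (p (e 2) * p (e 5))) : IsSymmetry e := by
  have h1 : ∀ p : Fin 6 → ℂ, p ∈ fivefold → p ∘ e ∈ fivefold := by
    intro p hp
    have := h p (fun x y z => x + y + z + x * y * z = 0) (fun x y z h => by linear_combination h)
      (fun x y z h => by linear_combination h)
      (by have hp' : p 0 * p 3 + p 1 * p 4 + p 2 * p 5 + p 0 * p 3 * p 1 * p 4 * p 2 * p 5 = 0 := hp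
          linear_combination hp')
    change p (e 0) * p (e 3) + p (e 1) * p (e 4) + p (e 2) * p (e 5) +
      p (e 0) * p (e 3) * p (e 1) * p (e 4) * p (e 2) * p (e 5) = 0
    linear_combination this
  refine ⟨hinv, h1, fun p hp => ⟨h1 p hp.1, ?_⟩⟩
  exact h p (fun x y z => x ≠ 0 ∧ y ≠ 0 ∧ z ≠ 0 ∧ x ^ 2 ≠ 1 ∧ y ^ 2 ≠ 1 ∧ z ^ 2 ≠ 1)
    (fun x y z h => by tauto) (fun x y z h => by tauto) hp.2

theorem eval_eq_zero_of_symmetry {e : Fin 6 → Fin 6} (he : IsSymmetry e)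
    {f : MvPolynomial (Fin 6) ℂ} (hf : ∀ p ∈ genericLocus, MvPolynomial.eval p f = 0)
    {p : Fin 6 → ℂ} (hp : p ∈ fivefold) (h3 : p (e 3) ≠ 0)
    (h : 1 + p (e 1) * p (e 4) * (p (e 2) * p (e 5)) ≠ 0) : MvPolynomial.eval p f = 0 := by
  have key := eval_eq_zero_of_partial (f := MvPolynomial.rename e f) (p := p ∘ e)
    (fun q hq => by
      rw [MvPolynomial.eval_rename]
      exact hf _ (he.map_generic q hq)) (he.map_fivefold p hp) h3 h
  rw [MvPolynomial.eval_rename] at key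
  have hpe : (p ∘ e) ∘ e = p := by
    ext i
    simp [he.involutive]
  rwa [hpe] at key

/-- The symmetries let any coordinate play the role of a₁₀, so only points where all six partial
derivatives vanish remain. If α ≠ 0 there, then αβ = βγ = γα = −1 yields β = γ while the equation
yields β + γ = 0, a contradiction; with α = 0 everything vanishes. -/
theorem eval_eq_zero_on_fivefold {f : MvPolynomial (Fin 6) ℂ}
    (hf : ∀ p ∈ genericLocus, MvPolynomial.eval p f = 0) {p : Fin 6 → ℂ} (hp : p ∈ fivefold) :
    MvPolynomial.eval p f = 0 := by
  have s0 : IsSymmetry ![3, 1, 2, 0, 4, 5] := isSymmetry_of_products (by decide)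
    fun p P _ _ h => by
      convert h using 1 <;> first | rfl | exact mul_comm _ _
  have s4 : IsSymmetry ![1, 0, 2, 4, 3, 5] := isSymmetry_of_products (by decide)
    fun p P h1 _ h => h1 _ _ _ h
  have s1 : IsSymmetry ![4, 3, 2, 1, 0, 5] := isSymmetry_of_products (by decide)
    fun p P h1 _ h => by
      convert h1 _ _ _ h using 1 <;> first | rfl | exact mul_comm _ _
  have s5 : IsSymmetry ![2, 1, 0, 5, 4, 3] := isSymmetry_of_products (by decide)
    fun p P _ h1 h => h1 _ _ _ h
  have s2 : IsSymmetry ![5, 1, 3, 2, 4, 0] := isSymmetry_of_products (by decide)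
    fun p P _ h1 h => by
      convert h1 _ _ _ h using 1 <;> first | rfl | exact mul_comm _ _
  have hF : p 0 * p 3 + p 1 * p 4 + p 2 * p 5 + p 0 * p 3 * p 1 * p 4 * p 2 * p 5 = 0 := hp
  by_contra hne
  have k3 : p 3 * (1 + p 1 * p 4 * (p 2 * p 5)) = 0 := by
    by_contra h
    exact hne (eval_eq_zero_of_partial hf hp (left_ne_zero_of_mul h) (right_ne_zero_of_mul h))
  have k0 : p 0 * (1 + p 1 * p 4 * (p 2 * p 5)) = 0 := by
    by_contra h
    exact hne (eval_eq_zero_of_symmetry s0 hf hp (left_ne_zero_of_mul h) (right_ne_zero_of_mul h))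
  have k4 : p 4 * (1 + p 0 * p 3 * (p 2 * p 5)) = 0 := by
    by_contra h
    exact hne (eval_eq_zero_of_symmetry s4 hf hp (left_ne_zero_of_mul h) (right_ne_zero_of_mul h))
  have k1 : p 1 * (1 + p 3 * p 0 * (p 2 * p 5)) = 0 := by
    by_contra h
    exact hne (eval_eq_zero_of_symmetry s1 hf hp (left_ne_zero_of_mul h) (right_ne_zero_of_mul h))
  have k5 : p 5 * (1 + p 1 * p 4 * (p 0 * p 3)) = 0 := by
    by_contra h
    exact hne (eval_eq_zero_of_symmetry s5 hf hp (left_ne_zero_of_mul h) (right_ne_zero_of_mul h))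
  have k2 : p 2 * (1 + p 1 * p 4 * (p 3 * p 0)) = 0 := by
    by_contra h
    exact hne (eval_eq_zero_of_symmetry s2 hf hp (left_ne_zero_of_mul h) (right_ne_zero_of_mul h))
  have hα : p 0 * p 3 = 0 := by
    by_contra h
    obtain ⟨α, hα⟩ : ∃ α, α = p 0 * p 3 := ⟨_, rfl⟩
    obtain ⟨β, hβ⟩ : ∃ β, β = p 1 * p 4 := ⟨_, rfl⟩
    obtain ⟨γ, hγ⟩ : ∃ γ, γ = p 2 * p 5 := ⟨_, rfl⟩
    have a1 : 1 + β * γ = 0 := by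
      rw [hβ, hγ]
      exact (mul_eq_zero.1 k3).resolve_left (right_ne_zero_of_mul h)
    have a2 : β * (1 + α * γ) = 0 := by rw [hα, hβ, hγ]; linear_combination p 1 * k4
    have a3 : γ * (1 + β * α) = 0 := by rw [hα, hβ, hγ]; linear_combination p 2 * k5
    have a4 : α + β + γ + α * β * γ = 0 := by rw [hα, hβ, hγ]; linear_combination hF
    have b0 : β ≠ 0 := by rintro h0; simp [h0] at a1
    have c0 : γ ≠ 0 := by rintro h0; simp [h0] at a1
    have a2' := (mul_eq_zero.1 a2).resolve_left b0
    have a3' := (mul_eq_zero.1 a3).resolve_left c0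
    have : β = 0 := by
      linear_combination (a4 - α * a1) / 2 + (β * a2' - γ * a3') / 2
    exact b0 this
  have hα' : p 3 * p 0 = 0 := by rw [mul_comm, hα]
  simp only [hα, hα', zero_mul, mul_zero, add_zero, mul_one] at k4 k1 k5 k2
  simp only [k4, k5, mul_zero, add_zero, mul_one] at k3 k0
  have hp0 : p = 0 := by
    ext i
    fin_cases i <;> assumption
  -- The origin is a limit of points of a coordinate axis contained in the fivefold, and these are
  -- already covered.
  let q : ℂ → Fin 6 → ℂ := fun s => ![0, 0, 0, s, 0, 0]
  have hcont : ContinuousAt (fun s => MvPolynomial.eval (q s) f) 0 := by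
    refine Continuous.continuousAt ((MvPolynomial.continuous_eval f).comp ?_)
    refine continuous_pi fun i => ?_
    fin_cases i
    all_goals simp only [q]
    all_goals first
      | exact continuous_const
      | exact continuous_id
  have hlim := hcont.tendsto.mono_left (nhdsWithin_le_nhds (s := {0}ᶜ))
  have hqp : q 0 = p := by
    rw [hp0]
    ext i
    fin_cases i <;> rfl
  rw [hqp] at hlim
  refine hne (tendsto_nhds_unique_of_eventuallyEq hlim (tendsto_const_nhds (x := (0 : ℂ))) ?_)
  filter_upwards [self_mem_nhdsWithin] with s hs
  refine eval_eq_zero_of_partial hf ?_ hs ?_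
  · change (0 : ℂ) * s + 0 * 0 + 0 * 0 + 0 * s * 0 * 0 * 0 * 0 = 0
    ring
  · change 1 + (0 : ℂ) * 0 * (0 * 0) ≠ 0
    simp

theorem nondegenerateLocus_openDense : IsZariskiOpenDense nondegenerateLocus fivefold :=
  ⟨nondegenerateLocus_open, fun _ hf _ hp =>
    eval_eq_zero_on_fivefold (fun q hq => hf q (genericLocus_subset hq)) hp⟩

/-! ### Theta constants and the arithmetic-geometric mean -/

/-- The even part `∑ w^{(2n)²}` of the theta constant. -/
noncomputable def nomeEven (w : ℂ) : ℂ := ∑' n : ℤ, w ^ (2 * n).natAbs ^ 2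

/-- The odd part `∑ w^{(2n+1)²}` of the theta constant. -/
noncomputable def nomeOdd (w : ℂ) : ℂ := ∑' n : ℤ, w ^ (2 * n + 1).natAbs ^ 2

theorem summable_pow_natAbs {r : ℝ} (h0 : 0 ≤ r) (h1 : r < 1) :
    Summable fun n : ℤ => r ^ n.natAbs := by
  have h := summable_geometric_of_lt_one h0 h1
  refine Summable.of_nat_of_neg ?_ ?_ <;> simpa using h

theorem norm_pow_even_le {r : ℝ} (h1 : r ≤ 1) {w : ℂ} (hw : ‖w‖ ≤ r) (n : ℤ) :
    ‖w ^ (2 * n).natAbs ^ 2‖ ≤ r ^ n.natAbs := by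
  rw [norm_pow]
  refine (pow_le_pow_left₀ (norm_nonneg _) hw _).trans
    (pow_le_pow_of_le_one ((norm_nonneg _).trans hw) h1 ?_)
  have : n.natAbs ≤ (2 * n).natAbs := by omega
  exact this.trans (Nat.le_self_pow two_ne_zero _)

theorem norm_pow_odd_le {r : ℝ} (h1 : r ≤ 1) {w : ℂ} (hw : ‖w‖ ≤ r) (n : ℤ) :
    ‖w ^ (2 * n + 1).natAbs ^ 2‖ ≤ r ^ n.natAbs := by
  rw [norm_pow]
  refine (pow_le_pow_left₀ (norm_nonneg _) hw _).trans
    (pow_le_pow_of_le_one ((norm_nonneg _).trans hw) h1 ?_)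
  have : n.natAbs ≤ (2 * n + 1).natAbs := by omega
  exact this.trans (Nat.le_self_pow two_ne_zero _)

theorem summable_norm_even {w : ℂ} (hw : ‖w‖ < 1) :
    Summable fun n : ℤ => ‖w ^ (2 * n).natAbs ^ 2‖ :=
  (summable_pow_natAbs (norm_nonneg w) hw).of_nonneg_of_le (fun _ => norm_nonneg _)
    (norm_pow_even_le hw.le le_rfl)

theorem summable_norm_odd {w : ℂ} (hw : ‖w‖ < 1) :
    Summable fun n : ℤ => ‖w ^ (2 * n + 1).natAbs ^ 2‖ :=
  (summable_pow_natAbs (norm_nonneg w) hw).of_nonneg_of_le (fun _ => norm_nonneg _)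
    (norm_pow_odd_le hw.le le_rfl)

theorem differentiableOn_nomeEven : DifferentiableOn ℂ nomeEven (Metric.ball 0 (1 / 2)) :=
  Complex.differentiableOn_tsum_of_summable_norm
    (summable_pow_natAbs (r := 1 / 2) (by norm_num) (by norm_num))
    (fun i => by fun_prop) Metric.isOpen_ball fun i w hw =>
      norm_pow_even_le (by norm_num) (by simpa using (mem_ball_zero_iff.1 hw).le) i

theorem differentiableOn_nomeOdd : DifferentiableOn ℂ nomeOdd (Metric.ball 0 (1 / 2)) :=
  Complex.differentiableOn_tsum_of_summable_norm
    (summable_pow_natAbs (r := 1 / 2) (by norm_num) (by norm_num))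
    (fun i => by fun_prop) Metric.isOpen_ball fun i w hw =>
      norm_pow_odd_le (by norm_num) (by simpa using (mem_ball_zero_iff.1 hw).le) i

theorem nomeEven_zero : nomeEven 0 = 1 := by
  rw [nomeEven, tsum_eq_single 0]
  · simp
  · intro n hn
    simp [hn]

theorem nomeOdd_zero : nomeOdd 0 = 0 := by
  rw [nomeOdd]
  convert tsum_zero with n
  rw [zero_pow]
  have : (2 * n + 1).natAbs ≠ 0 := by omega
  positivity

theorem nomeEven_neg (w : ℂ) : nomeEven (-w) = nomeEven w := by
  refine tsum_congr fun n => Even.neg_pow ?_ w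
  rw [Nat.even_pow' two_ne_zero, Int.natAbs_even]
  exact even_two_mul n

theorem nomeOdd_neg (w : ℂ) : nomeOdd (-w) = -nomeOdd w := by
  rw [nomeOdd, nomeOdd, ← tsum_neg]
  refine tsum_congr fun n => Odd.neg_pow ?_ w
  refine Odd.pow ?_
  rw [Int.natAbs_odd]
  exact odd_two_mul_add_one n

theorem nomeOdd_ne_zero {x : ℝ} (h0 : 0 < x) (h1 : x < 1) : nomeOdd x ≠ 0 := by
  have hs : Summable fun n : ℤ => x ^ (2 * n + 1).natAbs ^ 2 := by
    have := summable_norm_odd (w := (x : ℂ)) (by simpa [abs_of_pos h0] using h1)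
    simpa [abs_of_pos h0] using this
  have : nomeOdd x = ((∑' n : ℤ, x ^ (2 * n + 1).natAbs ^ 2 : ℝ) : ℂ) := by
    rw [nomeOdd, Complex.ofReal_tsum]
    simp
  rw [this, Complex.ofReal_ne_zero]
  exact (hs.tsum_pos (fun n => by positivity) 0 (by positivity)).ne'

/-- The change of variables `(m, n) ↦ (m + n, m - n)`, on the two parity classes. -/
def parityEquiv : (ℤ × ℤ) ⊕ (ℤ × ℤ) ≃ ℤ × ℤ where
  toFun := Sum.elim (fun p => (p.1 + p.2, p.1 - p.2)) (fun p => (p.1 + p.2 + 1, p.1 - p.2))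
  invFun q := if Even (q.1 + q.2) then Sum.inl ((q.1 + q.2) / 2, (q.1 - q.2) / 2)
    else Sum.inr ((q.1 + q.2 - 1) / 2, (q.1 - q.2 - 1) / 2)
  left_inv := by
    rintro (⟨m, n⟩ | ⟨m, n⟩)
    · have : Even (m + n + (m - n)) := ⟨m, by ring⟩
      simp only [Sum.elim_inl, this, if_true, Sum.inl.injEq, Prod.mk.injEq]
      omega
    · have : ¬ Even (m + n + 1 + (m - n)) := by
        rw [Int.not_even_iff_odd]
        exact ⟨m, by ring⟩
      simp only [Sum.elim_inr, this, if_false, Sum.inr.injEq, Prod.mk.injEq]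
      omega
  right_inv := by
    rintro ⟨a, b⟩
    by_cases h : Even (a + b)
    · simp only [h, if_true, Sum.elim_inl, Prod.mk.injEq]
      obtain ⟨k, hk⟩ := h
      omega
    · simp only [h, if_false, Sum.elim_inr, Prod.mk.injEq]
      rw [Int.not_even_iff_odd] at h
      obtain ⟨k, hk⟩ := h
      omega

theorem tsum_int_prod_parity {f : ℤ × ℤ → ℂ} (hf : Summable f) :
    ∑' p, f p = ∑' p : ℤ × ℤ, f (p.1 + p.2, p.1 - p.2) +
      ∑' p : ℤ × ℤ, f (p.1 + p.2 + 1, p.1 - p.2) := by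
  have hs := (parityEquiv.summable_iff (f := f)).2 hf
  rw [← parityEquiv.tsum_eq f]
  exact Summable.tsum_sum (f := fun s => f (parityEquiv s)) (hs.comp_injective Sum.inl_injective)
    (hs.comp_injective Sum.inr_injective)

/-- By (m + n)² + (m − n)² = 2(m² + n²), splitting the double series by the parity of the sum of the
indices gives two squares at w². -/
theorem nomeEven_sq {w : ℂ} (hw : ‖w‖ < 1) :
    nomeEven w ^ 2 = nomeEven (w ^ 2) ^ 2 + nomeOdd (w ^ 2) ^ 2 := by
  have hw2 : ‖w ^ 2‖ < 1 := by
    rw [norm_pow]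
    exact pow_lt_one₀ (norm_nonneg _) hw two_ne_zero
  obtain ⟨v, hv⟩ : ∃ v, v = w ^ 2 := ⟨_, rfl⟩
  have h1 := summable_norm_even hw
  have h2 := summable_norm_even hw2
  have h3 := summable_norm_odd hw2
  rw [← hv] at h2 h3 ⊢
  rw [sq, sq, sq, nomeEven, nomeEven, nomeOdd, tsum_mul_tsum_of_summable_norm h1 h1,
    tsum_mul_tsum_of_summable_norm h2 h2, tsum_mul_tsum_of_summable_norm h3 h3,
    tsum_int_prod_parity (summable_mul_of_summable_norm h1 h1)]
  congr 1 <;> refine tsum_congr fun p => ?_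
  · simp only [hv, ← pow_mul, ← pow_add]
    congr 1
    zify
    simp only [sq_abs]
    ring
  · simp only [hv, ← pow_mul, ← pow_add]
    congr 1
    zify
    simp only [sq_abs]
    ring

theorem nomeEven_eq_shift (v : ℂ) : nomeEven v = ∑' n : ℤ, v ^ (2 * (n + 1)).natAbs ^ 2 := by
  rw [nomeEven, ← (Equiv.addRight (1 : ℤ)).tsum_eq fun n : ℤ => v ^ (2 * n).natAbs ^ 2]
  rfl

/-- The same parity split produces two mixed products; in the second the even index is shifted by
one. -/
theorem nomeOdd_sq {w : ℂ} (hw : ‖w‖ < 1) :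
    nomeOdd w ^ 2 = 2 * nomeEven (w ^ 2) * nomeOdd (w ^ 2) := by
  have hw2 : ‖w ^ 2‖ < 1 := by
    rw [norm_pow]
    exact pow_lt_one₀ (norm_nonneg _) hw two_ne_zero
  obtain ⟨v, hv⟩ : ∃ v, v = w ^ 2 := ⟨_, rfl⟩
  have h1 := summable_norm_odd hw
  have h2 := summable_norm_even hw2
  have h3 := summable_norm_odd hw2
  rw [← hv] at h2 h3 ⊢
  have h2' : Summable fun n : ℤ => ‖v ^ (2 * (n + 1)).natAbs ^ 2‖ :=
    h2.comp_injective (add_left_injective (1 : ℤ))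
  have e1 : nomeOdd w ^ 2 = ∑' p : ℤ × ℤ, w ^ (2 * p.1 + 1).natAbs ^ 2 *
      w ^ (2 * p.2 + 1).natAbs ^ 2 := by
    rw [sq, nomeOdd, tsum_mul_tsum_of_summable_norm h1 h1]
  have e2 : nomeOdd v * nomeEven v = ∑' p : ℤ × ℤ, v ^ (2 * p.1 + 1).natAbs ^ 2 *
      v ^ (2 * p.2).natAbs ^ 2 := by
    rw [nomeOdd, nomeEven, tsum_mul_tsum_of_summable_norm h3 h2]
  have e3 : nomeEven v * nomeOdd v = ∑' p : ℤ × ℤ, v ^ (2 * (p.1 + 1)).natAbs ^ 2 *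
      v ^ (2 * p.2 + 1).natAbs ^ 2 := by
    rw [nomeEven_eq_shift, nomeOdd, tsum_mul_tsum_of_summable_norm h2' h3]
  rw [show 2 * nomeEven v * nomeOdd v = nomeOdd v * nomeEven v + nomeEven v * nomeOdd v by ring,
    e1, e2, e3, tsum_int_prod_parity (summable_mul_of_summable_norm h1 h1)]
  congr 1 <;> refine tsum_congr fun p => ?_
  · simp only [hv, ← pow_mul, ← pow_add]
    congr 1
    zify
    simp only [sq_abs]
    ring
  · simp only [hv, ← pow_mul, ← pow_add]
    congr 1
    zify
    simp only [sq_abs]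
    ring

/-- The value `ℓ` is attained by the quotient of the odd and even theta constants. -/
def IsNomeRatio (ℓ : ℂ) : Prop :=
  ∃ w : ℂ, w ≠ 0 ∧ ‖w‖ < 1 ∧ nomeEven w ≠ 0 ∧ nomeOdd w = ℓ * nomeEven w

-- The ratio is analytic at 0 with value 0, and it is not constant there because the odd series is
-- positive on (0, 1). The open mapping theorem does the rest.
open Filter Topology in
theorem isNomeRatio_of_small : ∃ δ > 0, ∀ ℓ : ℂ, ℓ ≠ 0 → ‖ℓ‖ < δ → IsNomeRatio ℓ := by
  have hU : Metric.ball (0 : ℂ) (1 / 2) ∈ 𝓝 0 := Metric.ball_mem_nhds _ (by norm_num)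
  have aE := differentiableOn_nomeEven.analyticAt hU
  have aO := differentiableOn_nomeOdd.analyticAt hU
  have hE : nomeEven 0 ≠ 0 := by simp [nomeEven_zero]
  have aL : AnalyticAt ℂ (fun w => nomeOdd w / nomeEven w) 0 := aO.div aE hE
  have hL0 : nomeOdd 0 / nomeEven 0 = 0 := by simp [nomeOdd_zero]
  have hEev := aE.continuousAt.eventually_ne hE
  rcases aL.eventually_constant_or_nhds_le_map_nhds with h | h
  · exfalso
    obtain ⟨ε, hε, hb⟩ := Metric.eventually_nhds_iff.1 (h.and hEev)
    obtain ⟨x, hx0, hx1⟩ := exists_between (lt_min hε one_pos)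
    obtain ⟨hx, hx'⟩ := hb (y := (x : ℂ)) (by
      simpa [abs_of_pos hx0] using hx1.trans_le (min_le_left _ _))
    rw [hL0, div_eq_zero_iff] at hx
    exact nomeOdd_ne_zero hx0 (hx1.trans_le (min_le_right _ _)) (hx.resolve_right hx')
  · rw [hL0] at h
    have hV : {w : ℂ | nomeEven w ≠ 0 ∧ w ∈ Metric.ball (0 : ℂ) (1 / 2)} ∈ 𝓝 (0 : ℂ) :=
      hEev.and hU
    obtain ⟨δ, hδ, hb⟩ := Metric.mem_nhds_iff.1 (h (image_mem_map hV))
    refine ⟨δ, hδ, fun ℓ hℓ hℓδ => ?_⟩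
    obtain ⟨w, ⟨hwE, hwU⟩, hw⟩ := hb (by simpa using hℓδ : ℓ ∈ Metric.ball (0 : ℂ) δ)
    refine ⟨w, ?_, ?_, hwE, ?_⟩
    · rintro rfl
      exact hℓ (hw.symm.trans hL0)
    · exact (mem_ball_zero_iff.1 hwU).trans (by norm_num)
    · exact (div_eq_iff hwE).1 hw

/-- The duplication formulas determine the squared ratio at a square root w of w'. Replacing w by −w
changes the sign of the ratio, so either root ℓ is reached. -/
theorem IsNomeRatio.ascend {ℓ ℓ' : ℂ} (h : IsNomeRatio ℓ') (h2 : ℓ ^ 2 * (1 + ℓ' ^ 2) = 2 * ℓ')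
    (hne : ℓ' ^ 2 ≠ -1) : IsNomeRatio ℓ := by
  obtain ⟨w', h0, h1, hE, hO⟩ := h
  obtain ⟨w, rfl⟩ := IsAlgClosed.exists_pow_nat_eq w' zero_lt_two
  have w0 : w ≠ 0 := by rintro rfl; simp at h0
  have w1 : ‖w‖ < 1 := by
    rw [norm_pow] at h1
    exact (pow_lt_one_iff_of_nonneg (norm_nonneg _) two_ne_zero).1 h1
  have e1 := nomeEven_sq w1
  have e2 := nomeOdd_sq w1
  rw [hO] at e1 e2
  have hE' : nomeEven w ≠ 0 := by
    intro h
    have : (1 + ℓ' ^ 2) * nomeEven (w ^ 2) ^ 2 = 0 := by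
      rw [h] at e1; linear_combination -e1
    rcases mul_eq_zero.1 this with h' | h'
    · exact hne (by linear_combination h')
    · exact hE (pow_eq_zero_iff two_ne_zero |>.1 h')
  have hsq : nomeOdd w ^ 2 = (ℓ * nomeEven w) ^ 2 := by
    rw [mul_pow, e1, e2]
    linear_combination -nomeEven (w ^ 2) ^ 2 * h2
  rcases sq_eq_sq_iff_eq_or_eq_neg.1 hsq with h | h
  · exact ⟨w, w0, w1, hE', h⟩
  · exact ⟨-w, by simpa, by simpa, by rwa [nomeEven_neg], by
      rw [nomeOdd_neg, nomeEven_neg, h, neg_neg]⟩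

/-- One step of the arithmetic-geometric mean. -/
theorem exists_agm_step {ℓ : ℂ} (h0 : ℓ ≠ 0) (h4 : ℓ ^ 4 ≠ 1) :
    ∃ ℓ' : ℂ, ℓ' ≠ 0 ∧ ℓ' ^ 4 ≠ 1 ∧ ℓ ^ 2 * (1 + ℓ' ^ 2) = 2 * ℓ' ∧ ‖ℓ'‖ ≤ 1 ∧
      ‖ℓ'‖ < ‖ℓ‖ ^ 2 := by
  -- With Re e ≥ 0 one has |1 + e| > 1 and |1 − e| ≤ |1 + e|. Hence ℓ²/(1 + e) = (1 − e)/ℓ² is the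
  -- root of least modulus of a quadratic whose roots have product 1.
  obtain ⟨e, he, hre⟩ : ∃ e : ℂ, e ^ 2 = 1 - ℓ ^ 4 ∧ 0 ≤ e.re := by
    obtain ⟨e, he⟩ := IsAlgClosed.exists_pow_nat_eq (1 - ℓ ^ 4) zero_lt_two
    rcases le_total 0 e.re with h | h
    · exact ⟨e, he, h⟩
    · exact ⟨-e, by rw [neg_sq, he], by simpa using h⟩
  have e0 : e ≠ 0 := by
    rintro rfl
    exact h4 (by linear_combination he)
  have hn1 : 1 < ‖1 + e‖ := by
    rw [← one_lt_sq_iff₀ (norm_nonneg _), ← Complex.normSq_eq_norm_sq, Complex.normSq_apply]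
    have : 0 < e.re ∨ e.im ≠ 0 := by
      by_contra! h
      exact e0 (Complex.ext (le_antisymm h.1 hre) h.2)
    simp only [Complex.add_re, Complex.one_re, Complex.add_im, Complex.one_im, zero_add]
    rcases this with h | h
    · nlinarith [mul_self_nonneg e.im]
    · nlinarith [mul_self_pos.2 h, mul_self_nonneg e.re]
  have hd : 1 + e ≠ 0 := norm_pos_iff.1 (one_pos.trans hn1)
  have hle : ‖1 - e‖ ≤ ‖1 + e‖ := by
    rw [← sq_le_sq₀ (norm_nonneg _) (norm_nonneg _), ← Complex.normSq_eq_norm_sq,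
      ← Complex.normSq_eq_norm_sq, Complex.normSq_apply, Complex.normSq_apply]
    simp only [Complex.add_re, Complex.one_re, Complex.add_im, Complex.one_im, Complex.sub_re,
      Complex.sub_im]
    nlinarith
  have hstep : ℓ ^ 2 * (1 + (ℓ ^ 2 / (1 + e)) ^ 2) = 2 * (ℓ ^ 2 / (1 + e)) := by
    field_simp
    linear_combination he
  refine ⟨ℓ ^ 2 / (1 + e), by simp [h0, hd], ?_, hstep, ?_, ?_⟩
  · intro h
    have : ((ℓ ^ 2 / (1 + e)) ^ 2 - 1) * ((ℓ ^ 2 / (1 + e)) ^ 2 + 1) = 0 := by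
      linear_combination h
    rcases mul_eq_zero.1 this with h' | h'
    · have : (ℓ ^ 2) ^ 2 = (ℓ ^ 2 / (1 + e)) ^ 2 := by
        linear_combination (ℓ ^ 2 * ((1 + (ℓ ^ 2 / (1 + e)) ^ 2) + 2) / 4 +
          2 * (ℓ ^ 2 / (1 + e)) / 4 - ℓ ^ 2 * 2 / 4) * hstep -
          (ℓ ^ 2) ^ 2 * ((ℓ ^ 2 / (1 + e)) ^ 2 + 3) / 4 * h'
      exact h4 (by linear_combination this + h')
    · have : ℓ ^ 2 / (1 + e) = 0 := by
        linear_combination -(1 / 2) * hstep + ℓ ^ 2 / 2 * h'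
      rw [this] at h'
      norm_num at h'
  · rw [norm_div, div_le_one (one_pos.trans hn1), norm_pow,
      ← sq_le_sq₀ (by positivity) (norm_nonneg _), ← pow_mul, ← norm_pow,
      show ℓ ^ (2 * 2) = (1 - e) * (1 + e) by linear_combination he, norm_mul, sq]
    exact mul_le_mul_of_nonneg_right hle (norm_nonneg _)
  · rw [norm_div, norm_pow]
    exact div_lt_self (by positivity) hn1

/-- The quotient of the odd and even theta constants takes every value other than the cusps. -/
theorem isNomeRatio_of_ne {ℓ : ℂ} (h0 : ℓ ≠ 0) (h4 : ℓ ^ 4 ≠ 1) : IsNomeRatio ℓ := by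
  have hne : ∀ {x : ℂ}, x ^ 4 ≠ 1 → x ^ 2 ≠ -1 := fun hx h =>
    hx (by linear_combination (_ ^ 2 - 1) * h)
  obtain ⟨δ, hδ, hsmall⟩ := isNomeRatio_of_small
  -- Each step multiplies the modulus by at most r, so n steps lead into the disc of radius δ.
  have main : ∀ r : ℝ, 0 ≤ r → ∀ n : ℕ, ∀ x : ℂ, x ≠ 0 → x ^ 4 ≠ 1 → ‖x‖ ≤ r →
      ‖x‖ * r ^ n < δ → r ≤ 1 → IsNomeRatio x := by
    intro r hr n
    induction n with
    | zero => exact fun x hx _ _ hx' _ => hsmall x hx (by simpa using hx')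
    | succ n ih =>
      intro x hx hx4 hxr hxn hr1
      obtain ⟨y, hy0, hy4, hyx, -, hlt⟩ := exists_agm_step hx hx4
      have h1 : ‖y‖ ≤ ‖x‖ * r := hlt.le.trans (by rw [sq]; gcongr)
      refine (ih y hy0 hy4 ?_ ?_ hr1).ascend hyx (hne hy4)
      · exact h1.trans ((mul_le_of_le_one_right (norm_nonneg _) hr1).trans hxr)
      · refine lt_of_le_of_lt ?_ hxn
        rw [pow_succ', ← mul_assoc]
        gcongr
  -- Two preliminary steps: the first brings the modulus to at most 1, the second strictly below 1,
  -- as geometric decay requires.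
  obtain ⟨x, hx0, hx4, hx, hx1, -⟩ := exists_agm_step h0 h4
  obtain ⟨y, hy0, hy4, hy, -, hy1⟩ := exists_agm_step hx0 hx4
  have hlt : ‖y‖ < 1 := hy1.trans_le (pow_le_one₀ (norm_nonneg _) hx1)
  obtain ⟨n, hn⟩ := exists_pow_lt_of_lt_one hδ hlt
  refine IsNomeRatio.ascend (IsNomeRatio.ascend ?_ hy (hne hy4)) hx (hne hx4)
  exact main ‖y‖ (norm_nonneg _) n y hy0 hy4 le_rfl
    ((mul_le_of_le_one_left (by positivity) hlt.le).trans_lt hn) hlt.le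

/-! ### Theta functions of order one are unique up to a scalar -/

open Complex in
/-- Contour shift for entire functions of period one. -/
theorem integral_add_eq_of_periodic {F : ℂ → ℂ} (hF : Differentiable ℂ F)
    (hp : ∀ z, F (z + 1) = F z) (w : ℂ) :
    ∫ x : ℝ in 0..1, F (x + w) = ∫ x : ℝ in 0..1, F x := by
  have hrect := Complex.integral_boundary_rect_eq_zero_of_differentiableOn F 0 (1 + w.im * I)
    hF.differentiableOn
  simp only [zero_re, zero_im, ofReal_zero, zero_mul, add_zero, add_re, one_re, mul_re, ofReal_re,
    I_re, mul_zero, ofReal_im, I_im, mul_one, sub_self, add_im, one_im, mul_im, zero_add,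
    ofReal_one] at hrect
  -- Periodicity cancels the two vertical sides of the rectangle.
  have hv : ∀ y : ℝ, F (1 + y * I) = F (y * I) := fun y => by rw [add_comm, hp]
  simp only [hv, add_sub_cancel_right] at hrect
  have hper : Function.Periodic (fun x : ℝ => F (x + w.im * I)) 1 := by
    intro x
    simp only [ofReal_add, ofReal_one]
    rw [add_right_comm, hp]
  have h1 : ∫ x : ℝ in 0..1, F (x + w) = ∫ x : ℝ in 0..1, F (x + w.im * I) := by
    have := intervalIntegral.integral_comp_add_right (a := 0) (b := 1)
      (fun x : ℝ => F (x + w.im * I)) w.re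
    have hper' := hper.intervalIntegral_add_eq w.re 0
    simp only [zero_add] at this hper'
    rw [add_comm 1 w.re, hper'] at this
    rw [← this]
    refine intervalIntegral.integral_congr fun x _ => ?_
    simp only [ofReal_add]
    congr 1
    rw [add_assoc, re_add_im]
  rw [h1]
  linear_combination -hrect

/-- A continuous function of period one with vanishing Fourier coefficients is zero. -/
theorem eq_zero_of_fourier_integrals {g : ℝ → ℂ} (hg : Continuous g) (hp : Function.Periodic g 1)
    (h : ∀ n : ℤ, ∫ x : ℝ in 0..1, Complex.exp (2 * Real.pi * Complex.I * n * x) * g x = 0)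
    (x : ℝ) : g x = 0 := by
  have : Fact ((0 : ℝ) < 1) := ⟨one_pos⟩
  let G : C(AddCircle (1 : ℝ), ℂ) := ⟨hp.lift, continuous_coinduced_dom.mpr hg⟩
  have hc : ∀ n, fourierCoeff G n = 0 := by
    intro n
    rw [fourierCoeff_eq_intervalIntegral G n 0]
    have := h (-n)
    simp only [zero_add, div_one, one_smul, smul_eq_mul]
    rw [← this]
    refine intervalIntegral.integral_congr fun x _ => ?_
    simp only [fourier_coe_apply, Complex.ofReal_one, div_one]
    rfl
  have hs := has_pointwise_sum_fourier_series_of_summable (f := G)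
    (by rw [funext hc]; exact summable_zero) (x : AddCircle (1 : ℝ))
  simp only [hc, zero_smul] at hs
  exact (hs.unique hasSum_zero : G x = 0)

/-- Entire functions of period `1` that are theta functions of order one for `ℤ + ℤη`. -/
structure IsOrderOne (η C : ℂ) (f : ℂ → ℂ) : Prop where
  differentiable : Differentiable ℂ f
  add_one : ∀ z, f (z + 1) = f z
  add_period : ∀ z, f (z + η) = C * Complex.exp (-(2 * Real.pi * Complex.I * z)) * f z

theorem exp_two_pi_int (n : ℤ) : Complex.exp (2 * Real.pi * Complex.I * n) = 1 := by
  rw [mul_comm]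
  exact Complex.exp_int_mul_two_pi_mul_I n

namespace IsOrderOne

variable {η C : ℂ} {f g : ℂ → ℂ}

/-- Moving the contour by η expresses each Fourier integral through its neighbour, so that a single
one determines all. -/
theorem coeff_succ (hf : IsOrderOne η C f) (n : ℤ) :
    ∫ x : ℝ in 0..1, Complex.exp (2 * Real.pi * Complex.I * n * x) * f x =
      C * Complex.exp (2 * Real.pi * Complex.I * n * η) *
        ∫ x : ℝ in 0..1, Complex.exp (2 * Real.pi * Complex.I * (n - 1 : ℤ) * x) * f x := by
  have hd := hf.differentiable
  rw [← integral_add_eq_of_periodic (F := fun z => Complex.exp (2 * Real.pi * Complex.I * n * z) *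
    f z) (by fun_prop) (fun z => ?_) η, ← intervalIntegral.integral_const_mul]
  · refine intervalIntegral.integral_congr fun x _ => ?_
    simp only [hf.add_period]
    rw [show 2 * Real.pi * Complex.I * n * (x + η) = 2 * Real.pi * Complex.I * n * η +
      2 * Real.pi * Complex.I * (n - 1 : ℤ) * x + 2 * Real.pi * Complex.I * x by push_cast; ring,
      Complex.exp_add, Complex.exp_add, Complex.exp_neg]
    field_simp
  · rw [mul_add, Complex.exp_add, mul_one, exp_two_pi_int, hf.add_one, mul_one]

theorem coeff_eq_zero (hf : IsOrderOne η C f) (hC : C ≠ 0) (h0 : ∫ x : ℝ in 0..1, f x = 0)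
    (n : ℤ) : ∫ x : ℝ in 0..1, Complex.exp (2 * Real.pi * Complex.I * n * x) * f x = 0 := by
  induction n using Int.induction_on with
  | zero => simpa using h0
  | succ n ih =>
    rw [hf.coeff_succ, add_sub_cancel_right, ih, mul_zero]
  | pred n ih =>
    rw [hf.coeff_succ] at ih
    exact (mul_eq_zero.1 ih).resolve_left (mul_ne_zero hC (Complex.exp_ne_zero _))

/-- Fourier uniqueness is applied on the horizontal line through z, whose coefficients are compared
with those on the real line by a contour shift. -/
theorem eq_zero (hf : IsOrderOne η C f) (hC : C ≠ 0) (h0 : ∫ x : ℝ in 0..1, f x = 0) (z : ℂ) :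
    f z = 0 := by
  have hd := hf.differentiable
  have hc : Continuous f := hd.continuous
  have := eq_zero_of_fourier_integrals (g := fun x => f (x + z)) (by fun_prop)
    (fun x => by simp only [Complex.ofReal_add, Complex.ofReal_one]; rw [add_right_comm, hf.add_one])
    (fun n => ?_) 0
  · simpa using this
  · have h1 := integral_add_eq_of_periodic
      (F := fun z => Complex.exp (2 * Real.pi * Complex.I * n * z) * f z) (by fun_prop)
      (fun z => by
        rw [mul_add, Complex.exp_add, mul_one, exp_two_pi_int, hf.add_one, mul_one]) z
    rw [hf.coeff_eq_zero hC h0] at h1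
    have h2 : ∫ x : ℝ in 0..1, Complex.exp (2 * Real.pi * Complex.I * n * x) * f (x + z) =
        Complex.exp (-(2 * Real.pi * Complex.I * n * z)) * ∫ x : ℝ in 0..1,
          Complex.exp (2 * Real.pi * Complex.I * n * (x + z)) * f (x + z) := by
      rw [← intervalIntegral.integral_const_mul]
      refine intervalIntegral.integral_congr fun x _ => ?_
      rw [← mul_assoc, ← Complex.exp_add]
      congr 2
      ring
    rw [h2, h1, mul_zero]

theorem sub_smul (hf : IsOrderOne η C f) (hg : IsOrderOne η C g) (k : ℂ) :
    IsOrderOne η C fun z => f z - k * g z where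
  differentiable := hf.differentiable.sub (hg.differentiable.const_mul k)
  add_one z := by rw [hf.add_one, hg.add_one]
  add_period z := by rw [hf.add_period, hg.add_period]; ring

theorem exists_eq_smul (hf : IsOrderOne η C f) (hg : IsOrderOne η C g) (hC : C ≠ 0)
    (hg0 : ∃ z, g z ≠ 0) : ∃ k, ∀ z, f z = k * g z := by
  have hI : ∫ x : ℝ in 0..1, g x ≠ 0 := fun h => hg0.elim fun z hz => hz (hg.eq_zero hC h z)
  refine ⟨(∫ x : ℝ in 0..1, f x) / ∫ x : ℝ in 0..1, g x, fun z => ?_⟩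
  have hcf := hf.differentiable.continuous
  have hcg := hg.differentiable.continuous
  refine sub_eq_zero.1 ((hf.sub_smul hg _).eq_zero hC ?_ z)
  rw [intervalIntegral.integral_sub, intervalIntegral.integral_const_mul]
  · field_simp
    ring
  · exact (hcf.comp Complex.continuous_ofReal).intervalIntegrable _ _
  · exact ((hcg.comp Complex.continuous_ofReal).const_mul _ : Continuous _).intervalIntegrable _ _

end IsOrderOne

theorem isOrderOne_jacobiTheta₂ {τ : ℂ} (hτ : 0 < τ.im) :
    IsOrderOne τ (Complex.exp (-(Real.pi * Complex.I * τ))) (fun z => jacobiTheta₂ z τ) where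
  differentiable := fun z => differentiableAt_jacobiTheta₂_fst z hτ
  add_one z := jacobiTheta₂_add_left z τ
  add_period z := by
    rw [jacobiTheta₂_add_left', ← Complex.exp_add]
    congr 2
    ring

/-- Only the term n = 0 has nonzero mean over a period. This serves to show that the Jacobi theta
function is not identically zero. -/
theorem integral_jacobiTheta₂ {τ : ℂ} (hτ : 0 < τ.im) :
    ∫ x : ℝ in 0..1, jacobiTheta₂ x τ = 1 := by
  let F : ℤ → C(ℝ, ℂ) := fun n => ⟨fun x => jacobiTheta₂_term n x τ, by
    unfold jacobiTheta₂_term; fun_prop⟩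
  have hnorm : ∀ n (x : ℝ), ‖jacobiTheta₂_term n x τ‖ = ‖jacobiTheta₂_term n 0 τ‖ := by
    intro n x
    simp [norm_jacobiTheta₂_term]
  have hsum : Summable fun n => ‖(F n).restrict (⟨Set.uIcc 0 1, isCompact_uIcc⟩ :
      TopologicalSpace.Compacts ℝ)‖ := by
    refine Summable.of_nonneg_of_le (fun _ => norm_nonneg _) (fun n => ?_)
      ((summable_jacobiTheta₂_term_iff 0 τ).2 hτ).norm
    rw [ContinuousMap.norm_le _ (norm_nonneg _)]
    exact fun x => (hnorm n x).le
  have h := intervalIntegral.hasSum_intervalIntegral_of_summable_norm hsum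
  have h0 : ∀ n : ℤ, n ≠ 0 → ∫ x : ℝ in 0..1, F n x = 0 := by
    intro n hn
    have hc : 2 * Real.pi * Complex.I * n ≠ 0 := by
      simp [hn, Real.pi_ne_zero]
    have : ∀ x : ℝ, F n x = Complex.exp (Real.pi * Complex.I * n ^ 2 * τ) *
        Complex.exp (2 * Real.pi * Complex.I * n * x) := by
      intro x
      change jacobiTheta₂_term n x τ = _
      rw [jacobiTheta₂_term, Complex.exp_add, mul_comm]
    simp only [this]
    rw [intervalIntegral.integral_const_mul, integral_exp_mul_complex hc]
    simp [exp_two_pi_int]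
  have h1 := h.unique (hasSum_single 0 h0)
  have h2 : ∫ x : ℝ in 0..1, F 0 x = 1 := by
    have : ∀ x : ℝ, F 0 x = 1 := fun x => by
      change jacobiTheta₂_term 0 x τ = _
      simp [jacobiTheta₂_term]
    simp [this]
  rw [h2] at h1
  exact h1

theorem exists_jacobiTheta₂_ne_zero {τ : ℂ} (hτ : 0 < τ.im) : ∃ z, jacobiTheta₂ z τ ≠ 0 := by
  by_contra! h
  have := integral_jacobiTheta₂ hτ
  simp [h] at this

/-- Theta functions of order one for the lattice `ℤ/4 + ℤη`. -/
structure IsQuarterTheta (η C : ℂ) (f : ℂ → ℂ) : Prop where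
  differentiable : Differentiable ℂ f
  add_quarter : ∀ z, f (z + 1 / 4) = f z
  add_period : ∀ z, f (z + η) = C * Complex.exp (-(8 * Real.pi * Complex.I * z)) * f z

theorem IsQuarterTheta.isOrderOne {η C : ℂ} {f : ℂ → ℂ} (hf : IsQuarterTheta η C f) :
    IsOrderOne (4 * η) C fun z => f (z / 4) where
  differentiable := hf.differentiable.comp (differentiable_id.div_const 4)
  add_one z := by rw [add_div, hf.add_quarter]
  add_period z := by
    have hη : 4 * η / 4 = η := by ring
    rw [add_div, hη, hf.add_period]
    congr 3
    ring

theorem IsQuarterTheta.exists_eq_smul {η C : ℂ} {f g : ℂ → ℂ} (hf : IsQuarterTheta η C f)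
    (hg : IsQuarterTheta η C g) (hC : C ≠ 0) (hg0 : ∃ z, g z ≠ 0) : ∃ k, ∀ z, f z = k * g z := by
  have h4 : ∀ z : ℂ, 4 * z / 4 = z := fun z => by ring
  obtain ⟨z, hz⟩ := hg0
  obtain ⟨k, hk⟩ := hf.isOrderOne.exists_eq_smul hg.isOrderOne hC
    ⟨4 * z, by rwa [h4]⟩
  refine ⟨k, fun z => ?_⟩
  have := hk (4 * z)
  rwa [h4] at this

theorem exp_pi_half : Complex.exp (Real.pi * Complex.I / 2) = Complex.I := by
  rw [show (Real.pi * Complex.I / 2 : ℂ) = Real.pi / 2 * Complex.I by ring,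
    Complex.exp_pi_div_two_mul_I]

theorem entire_eq_zero_of_mul {f g : ℂ → ℂ} (hf : Differentiable ℂ f) (hg : Differentiable ℂ g)
    (h : ∀ z, f z * g z = 0) : (∀ z, f z = 0) ∨ ∀ z, g z = 0 := by
  have := AnalyticOnNhd.eq_zero_or_eq_zero_of_mul_eq_zero (U := Set.univ)
    (fun z _ => hf.analyticAt z) (fun z _ => hg.analyticAt z) (fun z _ => h z)
    isPreconnected_univ
  simpa using this

/-! ### Translations and reflections of a theta system -/

/-- The automorphy factor of a theta system for the translation by `η / 4`. -/
noncomputable def quarterFactor (η z : ℂ) : ℂ :=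
  Complex.exp (-2 * Real.pi * Complex.I * z - Real.pi * Complex.I / 4
    + 3 * Real.pi * Complex.I * η / 4)

/-- The automorphy factor of a theta system for the translation by `η / 2`. -/
noncomputable def halfFactor (η z : ℂ) : ℂ :=
  Complex.exp (-4 * Real.pi * Complex.I * z - Real.pi * Complex.I / 2 + Real.pi * Complex.I * η)

theorem quarterFactor_mul (η z : ℂ) :
    quarterFactor η (z + η / 4) * quarterFactor η z = halfFactor η z := by
  rw [quarterFactor, quarterFactor, halfFactor, ← Complex.exp_add]
  congr 1
  ring

theorem halfFactor_mul (η z : ℂ) :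
    halfFactor η (z + η / 2) * halfFactor η z = -Complex.exp (-(8 * Real.pi * Complex.I * z)) := by
  rw [halfFactor, halfFactor, ← Complex.exp_add,
    show -4 * (Real.pi : ℂ) * Complex.I * (z + η / 2) - Real.pi * Complex.I / 2 +
      Real.pi * Complex.I * η + (-4 * Real.pi * Complex.I * z - Real.pi * Complex.I / 2 +
      Real.pi * Complex.I * η) = -(8 * Real.pi * Complex.I * z) - Real.pi * Complex.I by ring,
    Complex.exp_sub, Complex.exp_pi_mul_I, div_neg, div_one]

theorem halfFactor_sq (η z : ℂ) : halfFactor η z ^ 2 =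
    -Complex.exp (2 * Real.pi * Complex.I * η) * Complex.exp (-(8 * Real.pi * Complex.I * z)) := by
  rw [halfFactor, sq, ← Complex.exp_add,
    show -4 * (Real.pi : ℂ) * Complex.I * z - Real.pi * Complex.I / 2 + Real.pi * Complex.I * η +
      (-4 * Real.pi * Complex.I * z - Real.pi * Complex.I / 2 + Real.pi * Complex.I * η) =
      2 * Real.pi * Complex.I * η + -(8 * Real.pi * Complex.I * z) - Real.pi * Complex.I by ring,
    Complex.exp_sub, Complex.exp_add, Complex.exp_pi_mul_I, div_neg, div_one, neg_mul]

namespace IsThetaSystem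

variable {η : ℂ} {θ : ZMod 4 → ℂ → ℂ}

section

variable (hθ : IsThetaSystem η θ)
include hθ

theorem quarter0 (z : ℂ) : θ 0 (z + 1 / 4) = θ 0 z := by
  rw [hθ.add_quarter]
  simp

theorem quarter1 (z : ℂ) : θ 1 (z + 1 / 4) = Complex.I * θ 1 z := by
  rw [hθ.add_quarter, show (1 : ZMod 4).val = 1 from rfl, Nat.cast_one,
    show 2 * (Real.pi : ℂ) * Complex.I * (1 / 4) = Real.pi * Complex.I / 2 by ring, exp_pi_half]

theorem quarter2 (z : ℂ) : θ 2 (z + 1 / 4) = -θ 2 z := by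
  rw [hθ.add_quarter, neg_eq_neg_one_mul, ← Complex.exp_pi_mul_I]
  congr 2
  rw [show (2 : ZMod 4).val = 2 from rfl]
  push_cast
  ring

theorem quarter3 (z : ℂ) : θ 3 (z + 1 / 4) = -Complex.I * θ 3 z := by
  rw [hθ.add_quarter, show (3 : ZMod 4).val = 3 from rfl, Nat.cast_ofNat,
    show 2 * (Real.pi : ℂ) * Complex.I * (3 / 4) = Real.pi * Complex.I + Real.pi * Complex.I / 2
      by ring, Complex.exp_add, Complex.exp_pi_mul_I, exp_pi_half, neg_one_mul]

theorem half_one0 (z : ℂ) : θ 0 (z + 1 / 2) = θ 0 z := by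
  rw [show z + 1 / 2 = z + 1 / 4 + 1 / 4 by ring, hθ.quarter0, hθ.quarter0]

theorem half_one1 (z : ℂ) : θ 1 (z + 1 / 2) = -θ 1 z := by
  rw [show z + 1 / 2 = z + 1 / 4 + 1 / 4 by ring, hθ.quarter1, hθ.quarter1, ← mul_assoc,
    Complex.I_mul_I, neg_one_mul]

theorem half_one2 (z : ℂ) : θ 2 (z + 1 / 2) = θ 2 z := by
  rw [show z + 1 / 2 = z + 1 / 4 + 1 / 4 by ring, hθ.quarter2, hθ.quarter2, neg_neg]

theorem half_one3 (z : ℂ) : θ 3 (z + 1 / 2) = -θ 3 z := by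
  rw [show z + 1 / 2 = z + 1 / 4 + 1 / 4 by ring, hθ.quarter3, hθ.quarter3, ← mul_assoc,
    neg_mul_neg, Complex.I_mul_I, neg_one_mul]

theorem period_quarter (α : ZMod 4) (z : ℂ) :
    θ α (z + η / 4) = quarterFactor η z * θ (α + 1) z :=
  hθ.add_quarter_period α z

theorem period_quarter3 (z : ℂ) : θ 3 (z + η / 4) = quarterFactor η z * θ 0 z :=
  hθ.add_quarter_period 3 z

theorem period_half (α : ZMod 4) (z : ℂ) : θ α (z + η / 2) = halfFactor η z * θ (α + 2) z := by
  rw [show z + η / 2 = z + η / 4 + η / 4 by ring, hθ.period_quarter, hθ.period_quarter,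
    ← quarterFactor_mul, add_assoc, one_add_one_eq_two, mul_assoc]

theorem period_half2 (z : ℂ) : θ 2 (z + η / 2) = halfFactor η z * θ 0 z :=
  hθ.period_half 2 z

theorem period (α : ZMod 4) (z : ℂ) :
    θ α (z + η) = -Complex.exp (-(8 * Real.pi * Complex.I * z)) * θ α z := by
  have h4 : α + 2 + 2 = α := by
    rw [add_assoc, show (2 + 2 : ZMod 4) = 0 from rfl, add_zero]
  rw [show z + η = z + η / 2 + η / 2 by ring, hθ.period_half, hθ.period_half, ← halfFactor_mul,
    h4, mul_assoc]

theorem exists_ne_zero (α : ZMod 4) : ∃ z, θ α z ≠ 0 := by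
  by_contra! h
  exact hθ.nonconstant α ⟨0, h⟩

/-- Translation by 1/4 acts on θ₀ and θ₂ with different eigenvalues, 1 and −1. -/
theorem not_proportional (c : ℂ) : ¬ ∀ z, θ 0 z = c * θ 2 z := by
  intro h
  obtain ⟨z, hz⟩ := hθ.exists_ne_zero 0
  have h1 := h z
  have h2 := h (z + 1 / 4)
  rw [hθ.quarter0, hθ.quarter2] at h2
  exact hz (by linear_combination (h1 + h2) / 2)

theorem isQuarterTheta_zero : IsQuarterTheta η (-1) (θ 0) where
  differentiable := hθ.holomorphic 0
  add_quarter := hθ.quarter0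
  add_period z := by rw [hθ.period, neg_one_mul]

/-- The exponential changes sign under z ↦ z + 1/4, which cancels the sign of θ₂. -/
theorem isQuarterTheta_two : IsQuarterTheta η (-Complex.exp (4 * Real.pi * Complex.I * η))
    (fun z => Complex.exp (4 * Real.pi * Complex.I * z) * θ 2 z) where
  differentiable := by
    have := hθ.holomorphic 2
    fun_prop
  add_quarter z := by
    rw [hθ.quarter2, mul_add, Complex.exp_add,
      show 4 * (Real.pi : ℂ) * Complex.I * (1 / 4) = Real.pi * Complex.I by ring,
      Complex.exp_pi_mul_I]
    ring
  add_period z := by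
    rw [hθ.period, mul_add, Complex.exp_add]
    ring

end

/-- The theta function with a zero at the origin, in terms of Mathlib's Jacobi theta function. -/
theorem isQuarterTheta_jacobi (hη : 0 < η.im) :
    IsQuarterTheta η (-1) (fun z => jacobiTheta₂ (4 * z - 2 * η + 1 / 2) (4 * η)) where
  differentiable := by
    have h4 : 0 < (4 * η).im := by simpa using hη
    have : Differentiable ℂ fun z => jacobiTheta₂ z (4 * η) :=
      (isOrderOne_jacobiTheta₂ h4).differentiable
    exact this.comp (by fun_prop : Differentiable ℂ fun z : ℂ => 4 * z - 2 * η + 1 / 2)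
  add_quarter z := by
    rw [show 4 * (z + 1 / 4) - 2 * η + 1 / 2 = 4 * z - 2 * η + 1 / 2 + 1 by ring,
      jacobiTheta₂_add_left]
  add_period z := by
    rw [show 4 * (z + η) - 2 * η + 1 / 2 = 4 * z - 2 * η + 1 / 2 + 4 * η by ring,
      jacobiTheta₂_add_left', ← Complex.exp_pi_mul_I, ← Complex.exp_add,
      show -(Real.pi : ℂ) * Complex.I * (4 * η + 2 * (4 * z - 2 * η + 1 / 2)) =
        Real.pi * Complex.I + -(8 * Real.pi * Complex.I * z) - 2 * Real.pi * Complex.I by ring,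
      Complex.exp_periodic.sub_eq]

theorem jacobi_ne_zero (hη : 0 < η.im) :
    ∃ z, jacobiTheta₂ (4 * z - 2 * η + 1 / 2) (4 * η) ≠ 0 := by
  obtain ⟨z, hz⟩ := exists_jacobiTheta₂_ne_zero (τ := 4 * η) (by simpa using hη)
  refine ⟨(z + 2 * η - 1 / 2) / 4, ?_⟩
  convert hz using 2
  ring

theorem exists_eq_jacobi (hθ : IsThetaSystem η θ) (hη : 0 < η.im) :
    ∃ c ≠ 0, ∀ z, θ 0 z = c * jacobiTheta₂ (4 * z - 2 * η + 1 / 2) (4 * η) := by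
  obtain ⟨c, hc⟩ := hθ.isQuarterTheta_zero.exists_eq_smul (isQuarterTheta_jacobi hη) (by simp)
    (jacobi_ne_zero hη)
  refine ⟨c, ?_, hc⟩
  rintro rfl
  obtain ⟨z, hz⟩ := hθ.exists_ne_zero 0
  exact hz (by rw [hc, zero_mul])

/-- By uniqueness θ₀ is a Jacobi theta function of a translated argument, so the formula is evenness
of the latter combined with translations by 1/4 and η. -/
theorem neg0 (hθ : IsThetaSystem η θ) (hη : 0 < η.im) (z : ℂ) :
    θ 0 (-z) = -Complex.exp (-(8 * Real.pi * Complex.I * z)) * θ 0 z := by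
  obtain ⟨c, -, hc⟩ := hθ.exists_eq_jacobi hη
  have h := (isQuarterTheta_jacobi hη).add_period (z - 1 / 4)
  have h' := (isQuarterTheta_jacobi hη).add_quarter (z - 1 / 4)
  rw [sub_add_cancel] at h'
  rw [hc, hc, ← jacobiTheta₂_neg_left,
    show -(4 * -z - 2 * η + 1 / 2) = 4 * (z - 1 / 4 + η) - 2 * η + 1 / 2 by ring, h, h', mul_sub,
    show 8 * (Real.pi : ℂ) * Complex.I * (1 / 4) = 2 * Real.pi * Complex.I by ring, neg_sub,
    sub_eq_neg_add, Complex.exp_periodic]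
  ring

/-- Transports `neg0` along the translation by η/4, which takes θ₀ to θ₁ and θ₃ to θ₀ up to
exponential factors. -/
theorem neg1 (hθ : IsThetaSystem η θ) (hη : 0 < η.im) (z : ℂ) :
    θ 1 (-z) = -Complex.exp (-(8 * Real.pi * Complex.I * z)) * Complex.I * θ 3 z := by
  have h1 : θ 0 (-z + η / 4) = quarterFactor η (-z) * θ 1 (-z) := hθ.period_quarter 0 (-z)
  have h2 := hθ.neg0 hη (z - η / 4)
  have h3 := hθ.period_quarter3 (z - η / 4)
  rw [sub_add_cancel] at h3
  rw [neg_sub', sub_neg_eq_add] at h2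
  have hm : quarterFactor η (-z) * quarterFactor η (z - η / 4) =
      -Complex.I * Complex.exp (2 * Real.pi * Complex.I * η) := by
    rw [quarterFactor, quarterFactor, ← Complex.exp_add,
      show -2 * (Real.pi : ℂ) * Complex.I * -z - Real.pi * Complex.I / 4 +
        3 * Real.pi * Complex.I * η / 4 + (-2 * Real.pi * Complex.I * (z - η / 4) -
        Real.pi * Complex.I / 4 + 3 * Real.pi * Complex.I * η / 4) =
        2 * Real.pi * Complex.I * η - Real.pi * Complex.I / 2 by ring, Complex.exp_sub,
      exp_pi_half, div_eq_mul_inv, Complex.inv_I]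
    ring
  have he : Complex.exp (-(8 * Real.pi * Complex.I * (z - η / 4))) =
      Complex.exp (-(8 * Real.pi * Complex.I * z)) * Complex.exp (2 * Real.pi * Complex.I * η) := by
    rw [← Complex.exp_add]
    congr 1
    ring
  have hne := Complex.exp_ne_zero (2 * Real.pi * Complex.I * η)
  have hI := Complex.I_sq
  refine mul_left_cancel₀ hne ?_
  rw [he] at h2
  rw [h1] at h2
  linear_combination Complex.I * quarterFactor η (z - η / 4) * h2 -
    Complex.I * θ 1 (-z) * hm + Complex.I *
    Complex.exp (-(8 * Real.pi * Complex.I * z)) * Complex.exp (2 * Real.pi * Complex.I * η) * h3 +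
    θ 1 (-z) * Complex.exp (2 * Real.pi * Complex.I * η) * hI

theorem neg3 (hθ : IsThetaSystem η θ) (hη : 0 < η.im) (z : ℂ) :
    θ 3 (-z) = Complex.exp (-(8 * Real.pi * Complex.I * z)) * Complex.I * θ 1 z := by
  have h := hθ.neg1 hη (-z)
  rw [neg_neg, mul_neg, neg_neg] at h
  rw [h, Complex.exp_neg]
  have hne := Complex.exp_ne_zero (8 * Real.pi * Complex.I * z)
  field_simp
  rw [Complex.I_sq]
  ring

theorem neg2 (hθ : IsThetaSystem η θ) (hη : 0 < η.im) (z : ℂ) :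
    θ 2 (-z) = Complex.exp (-(8 * Real.pi * Complex.I * z)) * θ 2 z := by
  have h1 : θ 0 (-z + η / 2) = halfFactor η (-z) * θ 2 (-z) := hθ.period_half 0 (-z)
  have h2 := hθ.neg0 hη (z - η / 2)
  have h3 := hθ.period_half2 (z - η / 2)
  rw [sub_add_cancel] at h3
  rw [neg_sub', sub_neg_eq_add, h1] at h2
  have hm : halfFactor η (-z) * halfFactor η (z - η / 2) =
      -Complex.exp (4 * Real.pi * Complex.I * η) := by
    rw [halfFactor, halfFactor, ← Complex.exp_add,
      show -4 * (Real.pi : ℂ) * Complex.I * -z - Real.pi * Complex.I / 2 +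
        Real.pi * Complex.I * η + (-4 * Real.pi * Complex.I * (z - η / 2) -
        Real.pi * Complex.I / 2 + Real.pi * Complex.I * η) =
        4 * Real.pi * Complex.I * η - Real.pi * Complex.I by ring, Complex.exp_sub,
      Complex.exp_pi_mul_I, div_neg, div_one]
  have he : Complex.exp (-(8 * Real.pi * Complex.I * (z - η / 2))) =
      Complex.exp (-(8 * Real.pi * Complex.I * z)) * Complex.exp (4 * Real.pi * Complex.I * η) := by
    rw [← Complex.exp_add]
    congr 1
    ring
  have hne := Complex.exp_ne_zero (4 * Real.pi * Complex.I * η)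
  refine mul_left_cancel₀ hne ?_
  rw [he] at h2
  linear_combination -halfFactor η (z - η / 2) * h2 + θ 2 (-z) * hm -
    Complex.exp (-(8 * Real.pi * Complex.I * z)) * Complex.exp (4 * Real.pi * Complex.I * η) * h3

end IsThetaSystem

/-! ### Theta functions parametrize the curve E_k -/

namespace IsThetaSystem

variable {η : ℂ} {θ : ZMod 4 → ℂ → ℂ}

/-- The products `θ₁ θ₃` and the sum `θ₀² + θ₂²` lie in the same one-dimensional space. -/
theorem exists_onQuadrics (hθ : IsThetaSystem η θ) :
    ∃ k, ∀ z, OnQuadrics k (fun r => θ r z) := by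
  have d0 := hθ.holomorphic 0
  have d1 := hθ.holomorphic 1
  have d2 := hθ.holomorphic 2
  have d3 := hθ.holomorphic 3
  have p0 : ∀ z, θ 0 (z + η / 2) = halfFactor η z * θ 2 z := hθ.period_half 0
  have p1 : ∀ z, θ 1 (z + η / 2) = halfFactor η z * θ 3 z := hθ.period_half 1
  have p3 : ∀ z, θ 3 (z + η / 2) = halfFactor η z * θ 1 z := hθ.period_half 3
  have hf : IsQuarterTheta (η / 2) (-Complex.exp (2 * Real.pi * Complex.I * η))
      (fun z => θ 0 z ^ 2 + θ 2 z ^ 2) :=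
    ⟨by fun_prop, fun z => by rw [hθ.quarter0, hθ.quarter2, neg_sq], fun z => by
      rw [← halfFactor_sq, p0, hθ.period_half2]; ring⟩
  have hg : IsQuarterTheta (η / 2) (-Complex.exp (2 * Real.pi * Complex.I * η))
      (fun z => θ 1 z * θ 3 z) :=
    ⟨by fun_prop, fun z => by
      rw [hθ.quarter1, hθ.quarter3]
      linear_combination -(θ 1 z * θ 3 z) * Complex.I_mul_I, fun z => by
      rw [← halfFactor_sq, p1, p3]; ring⟩
  obtain ⟨k, hk⟩ := hf.exists_eq_smul hg (neg_ne_zero.2 (Complex.exp_ne_zero _)) (by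
    by_contra! h
    obtain ⟨z1, hz1⟩ := hθ.exists_ne_zero 1
    obtain ⟨z3, hz3⟩ := hθ.exists_ne_zero 3
    rcases entire_eq_zero_of_mul d1 d3 h with h | h
    · exact hz1 (h z1)
    · exact hz3 (h z3))
  -- Translation by η/4 raises every index by one and turns the first quadric into the second.
  refine ⟨k, fun z => ⟨hk z, ?_⟩⟩
  have h := hk (z + η / 4)
  have e0 : θ 0 (z + η / 4) = quarterFactor η z * θ 1 z := hθ.period_quarter 0 z
  have e1 : θ 1 (z + η / 4) = quarterFactor η z * θ 2 z := hθ.period_quarter 1 z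
  have e2 : θ 2 (z + η / 4) = quarterFactor η z * θ 3 z := hθ.period_quarter 2 z
  rw [e0, e1, e2, hθ.period_quarter3] at h
  have hq : quarterFactor η z ^ 2 ≠ 0 := pow_ne_zero _ (Complex.exp_ne_zero _)
  exact mul_left_cancel₀ hq (by linear_combination h)

/-- The identities combine to θ₁(θ₀² − θ₂²) = 0, while θ₀ = ±θ₂ is impossible. -/
theorem two_ne_zero_combination (hθ : IsThetaSystem η θ) {s : ℂ}
    (hA : ∀ z, θ 1 z * θ 2 z = s * (θ 0 z * θ 3 z)) (hB : ∀ z, θ 2 z * θ 3 z = s * (θ 0 z * θ 1 z))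
    (hs : s ^ 2 = 1) : False := by
  have d0 := hθ.holomorphic 0
  have d1 := hθ.holomorphic 1
  have d2 := hθ.holomorphic 2
  have h : ∀ z, θ 1 z * ((θ 0 z - θ 2 z) * (θ 0 z + θ 2 z)) = 0 := fun z => by
    linear_combination -θ 2 z * hA z - s * θ 0 z * hB z - θ 0 z ^ 2 * θ 1 z * hs
  rcases entire_eq_zero_of_mul d1 (by fun_prop) h with h | h
  · obtain ⟨z1, hz1⟩ := hθ.exists_ne_zero 1
    exact hz1 (h z1)
  · rcases entire_eq_zero_of_mul (by fun_prop) (by fun_prop) h with h | h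
    · exact hθ.not_proportional 1 fun z => by linear_combination h z
    · exact hθ.not_proportional (-1) fun z => by linear_combination h z

theorem parameter_ne_zero (hθ : IsThetaSystem η θ) {k : ℂ}
    (hk : ∀ z, OnQuadrics k (fun r => θ r z)) : k ≠ 0 := by
  rintro rfl
  have d0 := hθ.holomorphic 0
  have d2 := hθ.holomorphic 2
  have h : ∀ z, (θ 0 z - Complex.I * θ 2 z) * (θ 0 z + Complex.I * θ 2 z) = 0 := fun z => by
    linear_combination (hk z).even - θ 2 z ^ 2 * Complex.I_sq
  rcases entire_eq_zero_of_mul (by fun_prop) (by fun_prop) h with h | h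
  · exact hθ.not_proportional Complex.I fun z => by linear_combination h z
  · exact hθ.not_proportional (-Complex.I) fun z => by linear_combination h z

/-- Translation by 1/4 multiplies the two parts of the sum by −i and i, so each of them vanishes
separately. -/
theorem quarter_split (hθ : IsThetaSystem η θ) {s c : ℂ} (hc : c ^ 2 = -1)
    (h : ∀ z, θ 1 z * θ 2 z - s * (θ 0 z * θ 3 z) +
      c * (θ 2 z * θ 3 z - s * (θ 0 z * θ 1 z)) = 0) (hs : s ^ 2 = 1) : False := by
  have hI := Complex.I_sq
  have h' : ∀ z, θ 1 z * θ 2 z - s * (θ 0 z * θ 3 z) -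
      c * (θ 2 z * θ 3 z - s * (θ 0 z * θ 1 z)) = 0 := fun z => by
    have := h (z + 1 / 4)
    rw [hθ.quarter0, hθ.quarter1, hθ.quarter2, hθ.quarter3] at this
    linear_combination Complex.I * this + (θ 1 z * θ 2 z - s * (θ 0 z * θ 3 z) -
      c * (θ 2 z * θ 3 z - s * (θ 0 z * θ 1 z))) * hI
  refine hθ.two_ne_zero_combination (s := s) (fun z => ?_) (fun z => ?_) hs
  · linear_combination (h z + h' z) / 2
  · linear_combination -c * (h z - h' z) / 2 +
      (θ 2 z * θ 3 z - s * (θ 0 z * θ 1 z)) * hc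

/-- Otherwise the numerator or the denominator of ρ would vanish identically on the curve, which
`quarter_split` forbids. -/
theorem parameter_sq_ne_four (hθ : IsThetaSystem η θ) {k : ℂ}
    (hk : ∀ z, OnQuadrics k (fun r => θ r z)) : k ^ 2 ≠ 4 := by
  intro h4
  have d0 := hθ.holomorphic 0
  have d1 := hθ.holomorphic 1
  have d2 := hθ.holomorphic 2
  have d3 := hθ.holomorphic 3
  have hp : ∀ z, numRho (fun r => θ r z) * denRho (fun r => θ r z) = 0 := fun z => by
    rw [numRho_mul_denRho (hk z), h4, sub_self, zero_mul]
  simp only [numRho, denRho] at hp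
  rcases entire_eq_zero_of_mul (by fun_prop) (by fun_prop) hp with h | h
  · exact hθ.quarter_split (s := 1) Complex.I_sq (fun z => by linear_combination h z) (one_pow 2)
  · exact hθ.quarter_split (s := 1) (c := -Complex.I) (by rw [neg_sq, Complex.I_sq])
      (fun z => by linear_combination h z) (one_pow 2)

theorem parameter_sq_ne_neg_four (hθ : IsThetaSystem η θ) {k : ℂ}
    (hk : ∀ z, OnQuadrics k (fun r => θ r z)) : k ^ 2 ≠ -4 := by
  intro h4
  have d0 := hθ.holomorphic 0
  have d1 := hθ.holomorphic 1
  have d2 := hθ.holomorphic 2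
  have d3 := hθ.holomorphic 3
  have hp : ∀ z, numSigma (fun r => θ r z) * denSigma (fun r => θ r z) = 0 := fun z => by
    rw [numSigma_mul_denSigma (hk z), h4, neg_add_cancel, zero_mul]
  simp only [numSigma, denSigma] at hp
  rcases entire_eq_zero_of_mul (by fun_prop) (by fun_prop) hp with h | h
  · exact hθ.quarter_split (s := -1) Complex.I_sq (fun z => by linear_combination h z) (by norm_num)
  · exact hθ.quarter_split (s := -1) (c := -Complex.I) (by rw [neg_sq, Complex.I_sq])
      (fun z => by linear_combination h z) (by norm_num)

/-- Theta functions of order two for `ℤ + ℤη` lie in the span of `θ₀` and `θ₂`. -/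
theorem exists_combination (hθ : IsThetaSystem η θ) {f : ℂ → ℂ} (hf : Differentiable ℂ f)
    (h1 : ∀ z, f (z + 1 / 2) = f z)
    (h2 : ∀ z, f (z + η) = -Complex.exp (-(8 * Real.pi * Complex.I * z)) * f z) :
    ∃ a b, ∀ z, f z = a * θ 0 z + b * θ 2 z := by
  -- The function is split into its even and odd parts under translation by 1/4, which are multiples
  -- of θ₀ and θ₂.
  have h14 : ∀ z, f (z + 1 / 4 + 1 / 4) = f z := fun z => by
    rw [← h1 z]; congr 1; ring
  have hq : ∀ z, f (z + η + 1 / 4) =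
      -Complex.exp (-(8 * Real.pi * Complex.I * z)) * f (z + 1 / 4) := fun z => by
    rw [add_right_comm, h2, mul_add, neg_add, ← sub_eq_add_neg,
      show 8 * (Real.pi : ℂ) * Complex.I * (1 / 4) = 2 * Real.pi * Complex.I by ring,
      Complex.exp_periodic.sub_eq]
  have hp : IsQuarterTheta η (-1) (fun z => f z + f (z + 1 / 4)) :=
    ⟨by fun_prop, fun z => by rw [h14, add_comm], fun z => by rw [hq, h2]; ring⟩
  have hm : IsQuarterTheta η (-Complex.exp (4 * Real.pi * Complex.I * η))
      (fun z => Complex.exp (4 * Real.pi * Complex.I * z) * (f z - f (z + 1 / 4))) :=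
    ⟨by fun_prop, fun z => by
      rw [h14, mul_add, Complex.exp_add,
        show 4 * (Real.pi : ℂ) * Complex.I * (1 / 4) = Real.pi * Complex.I by ring,
        Complex.exp_pi_mul_I]
      ring, fun z => by rw [hq, h2, mul_add, Complex.exp_add]; ring⟩
  obtain ⟨a, ha⟩ := hp.exists_eq_smul hθ.isQuarterTheta_zero (by simp) (hθ.exists_ne_zero 0)
  obtain ⟨b, hb⟩ := hm.exists_eq_smul hθ.isQuarterTheta_two
    (neg_ne_zero.2 (Complex.exp_ne_zero _))
    ((hθ.exists_ne_zero 2).imp fun z hz => mul_ne_zero (Complex.exp_ne_zero _) hz)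
  refine ⟨a / 2, b / 2, fun z => ?_⟩
  have hb' : f z - f (z + 1 / 4) = b * θ 2 z :=
    mul_left_cancel₀ (Complex.exp_ne_zero (4 * Real.pi * Complex.I * z))
      (by linear_combination hb z)
  linear_combination (ha z + hb') / 2

/-- For every a, a product of translates of ϑ by a and −a lies in the span of θ₀ and θ₂. A common
zero would kill all these products, so one factor would vanish identically in a. -/
theorem no_common_zero (hθ : IsThetaSystem η θ) (hη : 0 < η.im) {z : ℂ} (h0 : θ 0 z = 0) :
    θ 2 z ≠ 0 := by
  intro h2
  have hη2 : 0 < (2 * η).im := by simpa using hη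
  have hJ : Differentiable ℂ fun z => jacobiTheta₂ z (2 * η) :=
    (isOrderOne_jacobiTheta₂ hη2).differentiable
  obtain ⟨ϑ, hϑ⟩ : ∃ ϑ : ℂ → ℂ, ϑ = fun z => jacobiTheta₂ (2 * z) (2 * η) := ⟨_, rfl⟩
  have hd : Differentiable ℂ ϑ := by
    rw [hϑ]
    exact hJ.comp (by fun_prop : Differentiable ℂ fun z : ℂ => 2 * z)
  have hp1 : ∀ z, ϑ (z + 1 / 2) = ϑ z := fun z => by
    simp only [hϑ]
    rw [mul_add, mul_one_div_cancel two_ne_zero, jacobiTheta₂_add_left]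
  have hp2 : ∀ z, ϑ (z + η) = Complex.exp (-(2 * Real.pi * Complex.I * (η + 2 * z))) * ϑ z :=
    fun z => by
      simp only [hϑ]
      rw [mul_add, jacobiTheta₂_add_left']
      congr 2
      ring
  have hne : ∀ w : ℂ, ¬ ∀ a, ϑ (w + a) = 0 := fun w h => by
    obtain ⟨z, hz⟩ := exists_jacobiTheta₂_ne_zero hη2
    have := h (z / 2 - w)
    simp only [hϑ] at this
    apply hz
    rw [← this]
    congr 1
    ring
  -- The extra shift 1/4 − η gives the product exactly the multiplier of θ₀ and θ₂.
  have key : ∀ a, ϑ (z + a) * ϑ (z - a + (1 / 4 - η)) = 0 := fun a => by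
    obtain ⟨b, c, h⟩ := hθ.exists_combination
      (f := fun z => ϑ (z + a) * ϑ (z - a + (1 / 4 - η)))
      ((hd.comp (by fun_prop : Differentiable ℂ fun z : ℂ => z + a)).mul
        (hd.comp (by fun_prop : Differentiable ℂ fun z : ℂ => z - a + (1 / 4 - η))))
      (fun z => by
        rw [add_right_comm z, hp1, show z + 1 / 2 - a + (1 / 4 - η) =
          z - a + (1 / 4 - η) + 1 / 2 by ring, hp1])
      (fun z => by
        rw [add_right_comm z, hp2, show z + η - a + (1 / 4 - η) =
          z - a + (1 / 4 - η) + η by ring, hp2, mul_mul_mul_comm, ← Complex.exp_add,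
          show -(2 * (Real.pi : ℂ) * Complex.I * (η + 2 * (z + a))) +
            -(2 * Real.pi * Complex.I * (η + 2 * (z - a + (1 / 4 - η)))) =
            -(8 * Real.pi * Complex.I * z) - Real.pi * Complex.I by ring, Complex.exp_sub,
          Complex.exp_pi_mul_I, div_neg, div_one])
    rw [h z, h0, h2, mul_zero, mul_zero, add_zero]
  rcases entire_eq_zero_of_mul
    (hd.comp (by fun_prop : Differentiable ℂ fun a : ℂ => z + a))
    (hd.comp (by fun_prop : Differentiable ℂ fun a : ℂ => z - a + (1 / 4 - η))) key with h | h
  · exact hne z h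
  · refine hne (z + (1 / 4 - η)) fun a => ?_
    rw [← h (-a)]
    simp only [Function.comp]
    congr 1
    ring

end IsThetaSystem

/-- An entire function with periods `1` and `η`, where `η` is not real, is constant. -/
theorem entire_doubly_periodic_const {η : ℂ} (hη : 0 < η.im) {q : ℂ → ℂ}
    (hq : Differentiable ℂ q) (h1 : Function.Periodic q 1) (h2 : Function.Periodic q η) (z w : ℂ) :
    q z = q w := by
  refine hq.apply_eq_apply_of_bounded ?_ z w
  have hK : IsCompact (Set.Icc (0 : ℝ) 1 ×ℂ Set.Icc 0 η.im) :=
    isCompact_Icc.reProdIm isCompact_Icc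
  refine (hK.image hq.continuous).isBounded.subset ?_
  rintro _ ⟨z, rfl⟩
  have hm : q z = q (z - ⌊z.im / η.im⌋ * η) := by
    rw [h2.sub_int_mul_eq]
  obtain ⟨y, hy⟩ : ∃ y, y = z - ⌊z.im / η.im⌋ * η := ⟨_, rfl⟩
  have hn : q y = q (y - ⌊y.re⌋ * 1) := by
    rw [h1.sub_int_mul_eq]
  have him : y.im = z.im - ⌊z.im / η.im⌋ * η.im := by
    rw [hy]
    simp
  refine ⟨y - ⌊y.re⌋ * 1, ?_, by rw [← hn, hm, hy]⟩
  rw [Complex.mem_reProdIm]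
  have hf1 := Int.floor_le (z.im / η.im)
  have hf2 := Int.lt_floor_add_one (z.im / η.im)
  rw [le_div_iff₀ hη] at hf1
  rw [div_lt_iff₀ hη] at hf2
  have hg1 := Int.floor_le y.re
  have hg2 := Int.lt_floor_add_one y.re
  simp only [mul_one, Complex.sub_re, Complex.intCast_re, Complex.sub_im, Complex.intCast_im,
    sub_zero, Set.mem_Icc]
  refine ⟨⟨?_, ?_⟩, ?_, ?_⟩ <;> linarith

namespace IsThetaSystem

variable {η : ℂ} {θ : ZMod 4 → ℂ → ℂ}

/-- If c were missed, θ₂/(θ₀ − cθ₂) would be entire and doubly periodic, hence constant, and θ₀, θ₂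
would be proportional. -/
theorem exists_ratio (hθ : IsThetaSystem η θ) (hη : 0 < η.im) (c : ℂ) :
    ∃ z, θ 0 z = c * θ 2 z := by
  by_contra! h
  have hg : ∀ z, θ 0 z - c * θ 2 z ≠ 0 := fun z => sub_ne_zero.2 (h z)
  have d0 := hθ.holomorphic 0
  have d2 := hθ.holomorphic 2
  have hd : Differentiable ℂ fun z => θ 2 z / (θ 0 z - c * θ 2 z) :=
    d2.div (by fun_prop) hg
  have h1 : Function.Periodic (fun z => θ 2 z / (θ 0 z - c * θ 2 z)) 1 := fun z => by
    have e0 : θ 0 (z + 1) = θ 0 z := by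
      rw [show z + 1 = z + 1 / 2 + 1 / 2 by ring, hθ.half_one0, hθ.half_one0]
    have e2 : θ 2 (z + 1) = θ 2 z := by
      rw [show z + 1 = z + 1 / 2 + 1 / 2 by ring, hθ.half_one2, hθ.half_one2]
    simp only [e0, e2]
  have h2 : Function.Periodic (fun z => θ 2 z / (θ 0 z - c * θ 2 z)) η := fun z => by
    simp only [hθ.period]
    rw [mul_left_comm, ← mul_sub, mul_div_mul_left]
    exact neg_ne_zero.2 (Complex.exp_ne_zero _)
  obtain ⟨b, hb⟩ : ∃ b, b = θ 2 0 / (θ 0 0 - c * θ 2 0) := ⟨_, rfl⟩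
  have hc : ∀ z, θ 2 z = b * (θ 0 z - c * θ 2 z) := fun z => by
    rw [hb, ← entire_doubly_periodic_const hη hd h1 h2 z 0, div_mul_cancel₀ _ (hg z)]
  have hb0 : b ≠ 0 := fun h0 => by
    obtain ⟨z, hz⟩ := hθ.exists_ne_zero 2
    exact hz (by rw [hc z, h0, zero_mul])
  refine hθ.not_proportional ((1 + b * c) / b) fun z => ?_
  field_simp
  linear_combination -hc z

theorem reflect (hθ : IsThetaSystem η θ) (hη : 0 < η.im) (z : ℂ) :
    ∃ e ≠ 0, θ 0 (-z + 1 / 4) = e * θ 0 z ∧ θ 1 (-z + 1 / 4) = -e * θ 3 z ∧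
      θ 2 (-z + 1 / 4) = e * θ 2 z ∧ θ 3 (-z + 1 / 4) = -e * θ 1 z := by
  have hI := Complex.I_mul_I
  refine ⟨-Complex.exp (-(8 * Real.pi * Complex.I * z)), neg_ne_zero.2 (Complex.exp_ne_zero _),
    ?_, ?_, ?_, ?_⟩
  · rw [hθ.quarter0, hθ.neg0 hη]
  · rw [hθ.quarter1, hθ.neg1 hη]
    linear_combination -(Complex.exp (-(8 * Real.pi * Complex.I * z)) * θ 3 z) * hI
  · rw [hθ.quarter2, hθ.neg2 hη, neg_mul]
  · rw [hθ.quarter3, hθ.neg3 hη]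
    linear_combination -(Complex.exp (-(8 * Real.pi * Complex.I * z)) * θ 1 z) * hI

/-- The theta functions parametrize the points of the curve with nonzero coordinates. -/
theorem exists_eq_mul (hθ : IsThetaSystem η θ) (hη : 0 < η.im) {k : ℂ}
    (hk : ∀ z, OnQuadrics k (fun r => θ r z)) {t : ZMod 4 → ℂ} (ht : OnQuadrics k t)
    (ht2 : t 2 ≠ 0) : ∃ τ l, l ≠ 0 ∧ ∀ r, θ r τ = l * t r := by
  obtain ⟨z, hz⟩ := hθ.exists_ratio hη (t 0 / t 2)
  obtain ⟨l, hl⟩ : ∃ l, l = θ 2 z / t 2 := ⟨_, rfl⟩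
  have hθ2 : θ 2 z ≠ 0 := fun h => hθ.no_common_zero hη (by rw [hz, h, mul_zero]) h
  have hl0 : l ≠ 0 := hl ▸ div_ne_zero hθ2 ht2
  have e2 : θ 2 z = l * t 2 := by rw [hl, div_mul_cancel₀ _ ht2]
  have e0 : θ 0 z = l * t 0 := by rw [hz, hl]; ring
  have hk0 := hθ.parameter_ne_zero hk
  have hprod : θ 1 z * θ 3 z = l ^ 2 * (t 1 * t 3) := by
    refine mul_left_cancel₀ hk0 ?_
    have := (hk z).even
    simp only [e0, e2] at this
    linear_combination -this + l ^ 2 * ht.even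
  have hsum : θ 1 z ^ 2 + θ 3 z ^ 2 = l ^ 2 * (t 1 ^ 2 + t 3 ^ 2) := by
    have := (hk z).odd
    simp only [e0, e2] at this
    linear_combination this - l ^ 2 * ht.odd
  -- Once θ₀ and θ₂ are matched, the quadrics fix (θ₁, θ₃) up to exchange and a common sign. The
  -- four cases are reached from z, −z + 1/4 and their translates by 1/2.
  have hp : (θ 1 z + θ 3 z) ^ 2 = (l * (t 1 + t 3)) ^ 2 := by
    linear_combination hsum + 2 * hprod
  have hm : (θ 1 z - θ 3 z) ^ 2 = (l * (t 1 - t 3)) ^ 2 := by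
    linear_combination hsum - 2 * hprod
  rcases sq_eq_sq_iff_eq_or_eq_neg.1 hp with hp | hp <;>
    rcases sq_eq_sq_iff_eq_or_eq_neg.1 hm with hm | hm
  · refine ⟨z, l, hl0, ?_⟩
    rw [forall_zmod_four]
    exact ⟨e0, by linear_combination (hp + hm) / 2, e2, by linear_combination (hp - hm) / 2⟩
  · obtain ⟨e, he, h0, h1, h2, h3⟩ := hθ.reflect hη z
    refine ⟨-z + 1 / 4 + 1 / 2, e * l, mul_ne_zero he hl0, ?_⟩
    rw [forall_zmod_four, hθ.half_one0, hθ.half_one1, hθ.half_one2, hθ.half_one3, h0, h1, h2, h3,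
      e0, e2]
    exact ⟨by ring, by linear_combination e * (hp - hm) / 2, by ring,
      by linear_combination e * (hp + hm) / 2⟩
  · obtain ⟨e, he, h0, h1, h2, h3⟩ := hθ.reflect hη z
    refine ⟨-z + 1 / 4, e * l, mul_ne_zero he hl0, ?_⟩
    rw [forall_zmod_four, h0, h1, h2, h3, e0, e2]
    exact ⟨by ring, by linear_combination -e * (hp - hm) / 2, by ring,
      by linear_combination -e * (hp + hm) / 2⟩
  · refine ⟨z + 1 / 2, l, hl0, ?_⟩
    rw [forall_zmod_four, hθ.half_one0, hθ.half_one1, hθ.half_one2, hθ.half_one3]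
    exact ⟨e0, by linear_combination -(hp + hm) / 2, e2, by linear_combination -(hp - hm) / 2⟩

end IsThetaSystem

/-! ### Existence of theta systems and the value of k -/

theorem natAbs_sq_cast (m : ℤ) : ((m.natAbs ^ 2 : ℕ) : ℂ) = (m : ℂ) ^ 2 := by
  rw [Nat.cast_pow, ← Int.cast_natCast, ← Int.cast_pow, Int.natCast_natAbs, sq_abs, Int.cast_pow]

theorem jacobiTheta₂_zero_eq_nomeEven (η : ℂ) :
    jacobiTheta₂ 0 (4 * η) = nomeEven (Complex.exp (Real.pi * Complex.I * η)) := by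
  rw [jacobiTheta₂, nomeEven]
  refine tsum_congr fun n => ?_
  rw [jacobiTheta₂_term, ← Complex.exp_nat_mul, natAbs_sq_cast]
  congr 1
  push_cast
  ring

theorem jacobiTheta₂_half_eq_nomeOdd (η : ℂ) :
    jacobiTheta₂ (2 * η) (4 * η) = Complex.exp (-(Real.pi * Complex.I * η)) *
      nomeOdd (Complex.exp (Real.pi * Complex.I * η)) := by
  rw [jacobiTheta₂, nomeOdd, ← tsum_mul_left]
  refine tsum_congr fun n => ?_
  rw [jacobiTheta₂_term, ← Complex.exp_nat_mul, natAbs_sq_cast, ← Complex.exp_add]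
  congr 1
  push_cast
  ring

/-- The exponent of the factor relating the theta functions of index `0` and `n`. -/
noncomputable def shiftExponent (η : ℂ) (n : ℕ) (z : ℂ) : ℂ :=
  n * (2 * Real.pi * Complex.I * z + Real.pi * Complex.I / 4 - 3 * Real.pi * Complex.I * η / 4) +
    Real.pi * Complex.I * η * (n * (n - 1)) / 4

/-- The theta function of index `n` attached to a function `f`. -/
noncomputable def quarterShift (η : ℂ) (f : ℂ → ℂ) (n : ℕ) (z : ℂ) : ℂ :=
  Complex.exp (shiftExponent η n z) * f (z + n * η / 4)

section

variable {η : ℂ} {f : ℂ → ℂ}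

theorem quarterShift_add_quarter (hf : IsQuarterTheta η (-1) f) (n : ℕ) (z : ℂ) :
    quarterShift η f n (z + 1 / 4) =
      Complex.exp (2 * Real.pi * Complex.I * (n / 4)) * quarterShift η f n z := by
  have h : shiftExponent η n (z + 1 / 4) =
      2 * Real.pi * Complex.I * (n / 4) + shiftExponent η n z := by
    simp only [shiftExponent]
    ring
  rw [quarterShift, quarterShift, add_right_comm z, hf.add_quarter, h, Complex.exp_add, mul_assoc]

theorem quarterShift_succ (n : ℕ) (z : ℂ) : quarterShift η f n (z + η / 4) =
    quarterFactor η z * quarterShift η f (n + 1) z := by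
  have h : shiftExponent η n (z + η / 4) = -2 * Real.pi * Complex.I * z - Real.pi * Complex.I / 4 +
      3 * Real.pi * Complex.I * η / 4 + shiftExponent η (n + 1) z := by
    simp only [shiftExponent]
    push_cast
    ring
  have hz : z + η / 4 + n * η / 4 = z + (n + 1 : ℕ) * η / 4 := by
    push_cast
    ring
  rw [quarterShift, quarterShift, quarterFactor, h, hz, Complex.exp_add, mul_assoc]

theorem quarterShift_add_period (hf : IsQuarterTheta η (-1) f) (n : ℕ) (z : ℂ) :
    quarterShift η f n (z + η) =
      -Complex.exp (-(8 * Real.pi * Complex.I * z)) * quarterShift η f n z := by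
  have h : shiftExponent η n (z + η) =
      shiftExponent η n z + 2 * Real.pi * Complex.I * (n * η) := by
    simp only [shiftExponent]
    ring
  have h' : -(8 * Real.pi * Complex.I * (z + n * η / 4)) =
      -(8 * Real.pi * Complex.I * z) - 2 * Real.pi * Complex.I * (n * η) := by ring
  have hne := Complex.exp_ne_zero (2 * Real.pi * Complex.I * (n * η))
  rw [quarterShift, quarterShift, add_right_comm, hf.add_period, h, h', Complex.exp_add,
    Complex.exp_sub]
  field_simp

/-- This lets the index be read modulo four: four quarter translations make the period η, and the
exponent absorbs its multiplier. -/
theorem quarterShift_four (hf : IsQuarterTheta η (-1) f) (z : ℂ) :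
    quarterShift η f 4 z = quarterShift η f 0 z := by
  have h : shiftExponent η 4 z = shiftExponent η 0 z + 8 * Real.pi * Complex.I * z +
      Real.pi * Complex.I := by
    simp only [shiftExponent]
    push_cast
    ring
  have hne := Complex.exp_ne_zero (8 * Real.pi * Complex.I * z)
  rw [quarterShift, quarterShift, show z + ((4 : ℕ) : ℂ) * η / 4 = z + η by push_cast; ring,
    show z + ((0 : ℕ) : ℂ) * η / 4 = z by push_cast; ring, hf.add_period, h, Complex.exp_add,
    Complex.exp_add, Complex.exp_pi_mul_I, Complex.exp_neg]
  field_simp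

end

theorem exists_isThetaSystem {η : ℂ} (hη : 0 < η.im) : ∃ θ, IsThetaSystem η θ := by
  obtain ⟨f, hf, z0, hz0⟩ : ∃ f, IsQuarterTheta η (-1) f ∧ ∃ z, f z ≠ 0 :=
    ⟨_, IsThetaSystem.isQuarterTheta_jacobi hη, IsThetaSystem.jacobi_ne_zero hη⟩
  have hd := hf.differentiable
  refine ⟨fun α => quarterShift η f α.val, ⟨fun α => ?_, fun α => ?_, fun α z => ?_, fun α z => ?_⟩⟩
  · unfold quarterShift shiftExponent
    exact Differentiable.mul (by fun_prop)
      (hd.comp (by fun_prop : Differentiable ℂ fun z : ℂ => z + α.val * η / 4))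
  · rintro ⟨c, hc⟩
    -- At 0 the multiplier of the period η is −1, so a constant would have to be 0.
    have h0 := quarterShift_add_period hf α.val 0
    rw [hc, hc, mul_zero, neg_zero, Complex.exp_zero] at h0
    have hc0 : c = 0 := by linear_combination h0 / 2
    have h1 := hc (z0 - α.val * η / 4)
    rw [hc0, quarterShift, sub_add_cancel] at h1
    exact mul_ne_zero (Complex.exp_ne_zero _) hz0 h1
  · exact quarterShift_add_quarter hf _ z
  · change quarterShift η f α.val (z + η / 4) =
      quarterFactor η z * quarterShift η f (α + 1).val z
    rw [quarterShift_succ]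
    congr 1
    revert α
    rw [forall_zmod_four]
    exact ⟨rfl, rfl, rfl, quarterShift_four hf z⟩

namespace IsThetaSystem

variable {η : ℂ} {θ : ZMod 4 → ℂ → ℂ}

/-- The point z = 1/8 is fixed by z ↦ −z + 1/4, so θ₁ = −θ₃ there, and θ₀ : θ₂ is minus the ratio of
the odd to the even theta constant. Eliminating θ₃ from the two quadrics leaves a relation in k². -/
theorem parameter_equation (hθ : IsThetaSystem η θ) (hη : 0 < η.im) {k : ℂ}
    (hk : ∀ z, OnQuadrics k (fun r => θ r z)) :
    2 * (nomeOdd (Complex.exp (Real.pi * Complex.I * η)) ^ 2 +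
      nomeEven (Complex.exp (Real.pi * Complex.I * η)) ^ 2) =
    k ^ 2 * (nomeOdd (Complex.exp (Real.pi * Complex.I * η)) *
      nomeEven (Complex.exp (Real.pi * Complex.I * η))) := by
  obtain ⟨c, hc0, hc⟩ := hθ.exists_eq_jacobi hη
  obtain ⟨x, hx⟩ : ∃ x, x = Complex.exp (-(Real.pi * Complex.I * η)) := ⟨_, rfl⟩
  have hx0 : x ≠ 0 := hx ▸ Complex.exp_ne_zero _
  have h0 : θ 0 (1 / 8) = c * (x * nomeOdd (Complex.exp (Real.pi * Complex.I * η))) := by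
    rw [hc, show 4 * (1 / 8 : ℂ) - 2 * η + 1 / 2 = -(2 * η) + 1 by ring, jacobiTheta₂_add_left,
      jacobiTheta₂_neg_left, jacobiTheta₂_half_eq_nomeOdd, hx]
  have h2 : θ 2 (1 / 8) = -(c * (x * nomeEven (Complex.exp (Real.pi * Complex.I * η)))) := by
    have h : θ 0 (1 / 8 + η / 2) = halfFactor η (1 / 8) * θ 2 (1 / 8) := hθ.period_half 0 _
    have hf : x * halfFactor η (1 / 8) = -1 := by
      rw [hx, halfFactor, ← Complex.exp_add, show -((Real.pi : ℂ) * Complex.I * η) +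
        (-4 * Real.pi * Complex.I * (1 / 8) - Real.pi * Complex.I / 2 + Real.pi * Complex.I * η) =
        -(Real.pi * Complex.I) by ring, Complex.exp_neg, Complex.exp_pi_mul_I, inv_neg, inv_one]
    rw [hc, show 4 * (1 / 8 + η / 2 : ℂ) - 2 * η + 1 / 2 = 0 + 1 by ring, jacobiTheta₂_add_left,
      jacobiTheta₂_zero_eq_nomeEven] at h
    linear_combination x * h + θ 2 (1 / 8) * hf
  have h13 : θ 1 (1 / 8) = -θ 3 (1 / 8) := by
    have h := hθ.quarter1 (-(1 / 8))
    rw [hθ.neg1 hη, show 8 * (Real.pi : ℂ) * Complex.I * (1 / 8) = Real.pi * Complex.I by ring,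
      Complex.exp_neg, Complex.exp_pi_mul_I, inv_neg, inv_one,
      show -(1 / 8) + 1 / 4 = (1 / 8 : ℂ) by norm_num] at h
    linear_combination h + θ 3 (1 / 8) * Complex.I_sq
  have e := (hk (1 / 8)).even
  have o := (hk (1 / 8)).odd
  simp only [h0, h2, h13] at e o
  refine mul_left_cancel₀ (pow_ne_zero 2 (mul_ne_zero hc0 hx0)) ?_
  linear_combination 2 * e - k * o

/-- Translation of the period by two changes the sign of the parameter of the curve. -/
theorem twist (hθ : IsThetaSystem η θ) {ψ : ZMod 4 → ℂ → ℂ} (h0 : ψ 0 = θ 0)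
    (h1 : ψ 1 = fun z => Complex.I * θ 1 z) (h2 : ψ 2 = θ 2)
    (h3 : ψ 3 = fun z => Complex.I * θ 3 z) : IsThetaSystem (η + 2) ψ := by
  have hI := Complex.I_mul_I
  have hnc : ∀ g : ℂ → ℂ, (¬ ∃ c, ∀ z, g z = c) → ¬ ∃ c, ∀ z, Complex.I * g z = c := by
    rintro g hg ⟨c, hc⟩
    exact hg ⟨-Complex.I * c, fun z => by linear_combination -Complex.I * hc z + g z * hI⟩
  have hq : ∀ z, quarterFactor (η + 2) z = -Complex.I * quarterFactor η z := fun z => by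
    rw [quarterFactor, quarterFactor, show -2 * (Real.pi : ℂ) * Complex.I * z -
      Real.pi * Complex.I / 4 + 3 * Real.pi * Complex.I * (η + 2) / 4 = Real.pi * Complex.I +
      Real.pi * Complex.I / 2 + (-2 * Real.pi * Complex.I * z - Real.pi * Complex.I / 4 +
      3 * Real.pi * Complex.I * η / 4) by ring, Complex.exp_add, Complex.exp_add,
      Complex.exp_pi_mul_I, exp_pi_half, neg_one_mul]
  have hz : ∀ z, z + (η + 2) / 4 = z + η / 4 + 1 / 2 := fun z => by ring
  refine ⟨?_, ?_, ?_, ?_⟩ <;> rw [forall_zmod_four, h0, h1, h2, h3]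
  · exact ⟨hθ.holomorphic 0, (hθ.holomorphic 1).const_mul _, hθ.holomorphic 2,
      (hθ.holomorphic 3).const_mul _⟩
  · exact ⟨hθ.nonconstant 0, hnc _ (hθ.nonconstant 1), hθ.nonconstant 2, hnc _ (hθ.nonconstant 3)⟩
  · refine ⟨hθ.add_quarter 0, fun z => ?_, hθ.add_quarter 2, fun z => ?_⟩ <;>
      beta_reduce <;> rw [hθ.add_quarter, mul_left_comm]
  · refine ⟨fun z => ?_, fun z => ?_, fun z => ?_, fun z => ?_⟩
    · have e : θ 0 (z + η / 4) = quarterFactor η z * θ 1 z := hθ.period_quarter 0 z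
      change _ = quarterFactor (η + 2) z * ψ 1 z
      rw [h1, hz, hθ.half_one0, e, hq]
      linear_combination quarterFactor η z * θ 1 z * hI
    · have e : θ 1 (z + η / 4) = quarterFactor η z * θ 2 z := hθ.period_quarter 1 z
      change Complex.I * θ 1 (z + (η + 2) / 4) = quarterFactor (η + 2) z * ψ 2 z
      rw [h2, hz, hθ.half_one1, e, hq]
      ring
    · have e : θ 2 (z + η / 4) = quarterFactor η z * θ 3 z := hθ.period_quarter 2 z
      change _ = quarterFactor (η + 2) z * ψ 3 z
      rw [h3, hz, hθ.half_one2, e, hq]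
      linear_combination quarterFactor η z * θ 3 z * hI
    · change Complex.I * θ 3 (z + (η + 2) / 4) = quarterFactor (η + 2) z * ψ 0 z
      rw [h0, hz, hθ.half_one3, hθ.period_quarter3, hq]
      ring

end IsThetaSystem

/-- Every nonsingular curve of the pencil is parametrized by theta functions. -/
theorem exists_isThetaSystem_onQuadrics {k : ℂ} (h0 : k ≠ 0) (h4 : k ^ 2 ≠ 4) (h4' : k ^ 2 ≠ -4) :
    ∃ η θ, 0 < η.im ∧ IsThetaSystem η θ ∧ ∀ z, OnQuadrics k (fun r => θ r z) := by
  obtain ⟨s, hs⟩ := IsAlgClosed.exists_pow_nat_eq (k ^ 4 - 16) zero_lt_two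
  -- This is the equation of `parameter_equation` for the ratio ℓ. The cusps ℓ = 1, ℓ = −1 and ℓ² =
  -- −1 correspond to k² = 4, k² = −4 and k = 0.
  obtain ⟨ℓ, hℓ⟩ : ∃ ℓ : ℂ, 2 * (ℓ ^ 2 + 1) = k ^ 2 * ℓ :=
    ⟨(k ^ 2 + s) / 4, by linear_combination hs / 8⟩
  have hℓ0 : ℓ ≠ 0 := by
    rintro rfl
    norm_num at hℓ
  have hℓ4 : ℓ ^ 4 ≠ 1 := fun h => by
    have : (ℓ - 1) * ((ℓ + 1) * (ℓ ^ 2 + 1)) = 0 := by linear_combination h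
    rcases mul_eq_zero.1 this with h | h
    · obtain rfl : ℓ = 1 := by linear_combination h
      exact h4 (by linear_combination -hℓ)
    rcases mul_eq_zero.1 h with h | h
    · obtain rfl : ℓ = -1 := by linear_combination h
      exact h4' (by linear_combination hℓ)
    · rw [h, mul_zero] at hℓ
      exact mul_ne_zero (pow_ne_zero 2 h0) hℓ0 hℓ.symm
  obtain ⟨w, hw0, hw1, hE, hO⟩ := isNomeRatio_of_ne hℓ0 hℓ4
  have hpi : (Real.pi : ℂ) * Complex.I ≠ 0 :=
    mul_ne_zero (Complex.ofReal_ne_zero.2 Real.pi_ne_zero) Complex.I_ne_zero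
  obtain ⟨η, hη⟩ : ∃ η, η = Complex.log w / (Real.pi * Complex.I) := ⟨_, rfl⟩
  have hw : Complex.exp (Real.pi * Complex.I * η) = w := by
    rw [hη, mul_div_cancel₀ _ hpi, Complex.exp_log hw0]
  have him : 0 < η.im := by
    have h := congrArg norm hw
    rw [Complex.norm_exp] at h
    rw [← h, Real.exp_lt_one_iff] at hw1
    simp only [Complex.mul_re, Complex.mul_im, Complex.ofReal_re, Complex.ofReal_im, Complex.I_re,
      Complex.I_im, mul_zero, zero_mul, sub_zero, add_zero, mul_one, zero_sub] at hw1
    nlinarith [Real.pi_pos]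
  obtain ⟨θ, hθ⟩ := exists_isThetaSystem him
  obtain ⟨m, hm⟩ := hθ.exists_onQuadrics
  have heq := hθ.parameter_equation him hm
  rw [hw, hO] at heq
  have hsq : m ^ 2 = k ^ 2 := by
    refine mul_right_cancel₀ (mul_ne_zero hℓ0 (pow_ne_zero 2 hE)) ?_
    linear_combination -heq + nomeEven w ^ 2 * hℓ
  -- The theta constants determine only k²; if the sign is wrong, η is replaced by η + 2.
  rcases sq_eq_sq_iff_eq_or_eq_neg.1 hsq with rfl | rfl
  · exact ⟨η, θ, him, hθ, hm⟩
  · refine ⟨η + 2, ![θ 0, fun z => Complex.I * θ 1 z, θ 2, fun z => Complex.I * θ 3 z], by simpa,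
      hθ.twist rfl rfl rfl rfl, fun z => ⟨?_, ?_⟩⟩
    · change θ 0 z ^ 2 + θ 2 z ^ 2 = k * (Complex.I * θ 1 z * (Complex.I * θ 3 z))
      linear_combination (hm z).even - k * θ 1 z * θ 3 z * Complex.I_mul_I
    · change (Complex.I * θ 1 z) ^ 2 + (Complex.I * θ 3 z) ^ 2 = k * (θ 0 z * θ 2 z)
      linear_combination -(hm z).odd + (θ 1 z ^ 2 + θ 3 z ^ 2) * Complex.I_sq

/-! ### Sklyanin algebras and the nondegenerate locus -/

/-- The parameters attached to a point of `ℙ³` do not depend on its coordinates. -/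
theorem quadricParams_smul {t u : ZMod 4 → ℂ} {l : ℂ} (hl : l ≠ 0) (h : ∀ r, u r = l * t r) :
    quadricParams u = quadricParams t := by
  have hl2 : l ^ 2 ≠ 0 := pow_ne_zero 2 hl
  have e1 : paramK u = paramK t := by
    rw [paramK, paramK, h 0, h 1, h 2, h 3, ← mul_div_mul_left (t 0 * t 2) _ hl2]
    congr 1 <;> ring
  have e2 : paramRho u = paramRho t := by
    rw [paramRho, paramRho, ← mul_div_mul_left (numRho t) _ hl2]
    congr 1 <;> simp only [numRho, denRho, h] <;> ring
  have e3 : paramSigma u = paramSigma t := by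
    rw [paramSigma, paramSigma, ← mul_div_mul_left (numSigma t) _ hl2]
    congr 1 <;> simp only [numSigma, denSigma, h] <;> ring
  rw [quadricParams, quadricParams, e1, e2, e3]

theorem quadricParams_products (t : ZMod 4 → ℂ) :
    quadricParams t 0 * quadricParams t 3 = paramK t ^ 2 ∧
    quadricParams t 1 * quadricParams t 4 = -paramRho t ^ 2 ∧
    quadricParams t 2 * quadricParams t 5 = paramSigma t ^ 2 := by
  refine ⟨?_, ?_, ?_⟩
  · change -Complex.I * paramK t * (Complex.I * paramK t) = _
    linear_combination -paramK t ^ 2 * Complex.I_mul_I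
  · change paramRho t * -paramRho t = _
    ring
  · exact (sq _).symm

/-- The Sklyanin algebra of a theta system is a member of the family. -/
theorem IsThetaSystem.gradedIso_family {η : ℂ} {θ : ZMod 4 → ℂ → ℂ} (hθ : IsThetaSystem η θ)
    (hη : 0 < η.im) {k τ : ℂ} (hk : ∀ z, OnQuadrics k (fun r => θ r z)) (hτ : ∀ r, θ r τ ≠ 0) :
    GradedIso (PresentedAlgebra.piece (sklyaninRelations θ τ))
      (PresentedAlgebra.piece (familyRelations (quadricParams fun r => θ r τ))) := by
  refine gradedIso_sklyanin_family fun {B} _ _ x => ?_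
  rw [satisfiesSklyanin_iff θ τ _ (neg_ne_zero.2 (Complex.exp_ne_zero _)) hτ (hθ.neg0 hη τ)
    (hθ.neg1 hη τ) (by rw [neg_neg, hθ.neg2 hη]) (by rw [neg_neg, hθ.neg3 hη])]
  exact satisfiesSklyanin_iff_quadricParams hτ
    (rho_ne_zero (hk τ) hτ (hθ.parameter_sq_ne_four hk)).2
    (sigma_ne_zero (hk τ) hτ (hθ.parameter_sq_ne_neg_four hk)).2 x

theorem IsThetaSystem.neg_ne_zero {η : ℂ} {θ : ZMod 4 → ℂ → ℂ} (hθ : IsThetaSystem η θ)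
    (hη : 0 < η.im) {τ : ℂ} (hτ : ∀ r, θ r τ ≠ 0) (r : ZMod 4) : θ r (-τ) ≠ 0 := by
  revert r
  rw [forall_zmod_four, hθ.neg0 hη, hθ.neg1 hη, hθ.neg2 hη, hθ.neg3 hη]
  simp [hτ]

theorem isFourDimSklyanin_of_mem {p : Fin 6 → ℂ} (hp : p ∈ nondegenerateLocus) :
    IsFourDimSklyanin (PresentedAlgebra.piece (familyRelations p)) := by
  obtain ⟨hs, hnd⟩ := hp
  obtain ⟨k, t, ht, ht0, hk0, hk4, hk4', hα, hβ, hγ⟩ := exists_quadric_of_nondegenerate hnd (by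
    change p 0 * p 3 + p 1 * p 4 + p 2 * p 5 + p 0 * p 3 * p 1 * p 4 * p 2 * p 5 = 0 at hs
    linear_combination hs)
  obtain ⟨η, θ, hη, hθ, hk⟩ := exists_isThetaSystem_onQuadrics hk0 hk4 hk4'
  obtain ⟨τ, l, hl, h⟩ := hθ.exists_eq_mul hη hk ht (ht0 2)
  have hτ : ∀ r, θ r τ ≠ 0 := fun r => by
    rw [h]
    exact mul_ne_zero hl (ht0 r)
  refine ⟨η, θ, τ, hη, hθ, fun r => ⟨hτ r, hθ.neg_ne_zero hη hτ r⟩,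
    (hθ.gradedIso_family hη hk hτ).trans ?_⟩
  rw [quadricParams_smul hl h]
  -- The parameters of t need not be p itself, but their three products agree with those of p, which
  -- is enough.
  obtain ⟨q0, q1, q2⟩ := quadricParams_products t
  rw [hα] at q0
  rw [hβ] at q1
  rw [hγ] at q2
  exact gradedIso_family_of_products q0 q1 q2 (q0 ▸ hnd.ne_zero_left) (q1 ▸ hnd.ne_zero_middle)
    (q2 ▸ hnd.ne_zero_right)

theorem exists_mem_of_isFourDimSklyanin {A : Type*} [Ring A] [Algebra ℂ A]
    {𝒜 : ℕ → Submodule ℂ A} (h : IsFourDimSklyanin 𝒜) :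
    ∃ p ∈ nondegenerateLocus, GradedIso (PresentedAlgebra.piece (familyRelations p)) 𝒜 := by
  obtain ⟨η, θ, τ, hη, hθ, hτ, h⟩ := h
  have hτ' : ∀ r, θ r τ ≠ 0 := fun r => (hτ r).1
  obtain ⟨k, hk⟩ := hθ.exists_onQuadrics
  have hk4 := hθ.parameter_sq_ne_four hk
  have hk4' := hθ.parameter_sq_ne_neg_four hk
  refine ⟨quadricParams fun r => θ r τ, ⟨quadricParams_mem_fivefold (hk τ) hτ' hk4 hk4', ?_⟩,
    (hθ.gradedIso_family hη hk hτ').symm.trans h⟩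
  obtain ⟨q0, q1, q2⟩ := quadricParams_products fun r => θ r τ
  rw [q0, q1, q2]
  exact quadric_products_nondegenerate (hk τ) hτ' (hθ.parameter_ne_zero hk) hk4 hk4'

theorem mainTheorem7 :
    ∃ U : Set (Fin 6 → ℂ), IsZariskiOpenDense U fivefold ∧
      (∀ p ∈ U, IsFourDimSklyanin (PresentedAlgebra.piece (familyRelations p))) ∧
      (∀ (A : Type*) [Ring A] [Algebra ℂ A] (𝒜 : ℕ → Submodule ℂ A), IsFourDimSklyanin 𝒜 →
        ∃ p ∈ U, GradedIso (PresentedAlgebra.piece (familyRelations p)) 𝒜) :=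
  ⟨nondegenerateLocus, nondegenerateLocus_openDense, fun _ => isFourDimSklyanin_of_mem,
    fun _ _ _ _ => exists_mem_of_isFourDimSklyanin⟩
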